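/- Let $d\ge 1$ and let $\Lambda_N\subset\mathbb{Z}^d$ be the cube of side $N\ge1$ (with $N^d$ sites) centered at the origin. For an even function $\Psi:\mathbb{R}\to\mathbb{R}$ and $\phi\in[0,\infty)^{\Lambda_N}$ let $$H_N(\phi)=\sum_{\langle x,y\rangle\subset\Lambda_N}\Psi(\phi_x-\phi_y)+\sum_{\langle x,y\rangle:\,x\in\Lambda_N,\,y\notin\Lambda_N}\Psi(\phi_x),$$ where $\langle x,y\rangle$ denotes a pair of nearest neighbours of $\mathbb{Z}^d$. For $\varepsilon>0$, the $\delta$-pinning model above a hard wall is the probability measure on $[0,\infty)^{\Lambda_N}$ $$\mu_N^{\varepsilon}(d\phi)=\frac{e^{-H_N(\phi)}}{Z_N^{\varepsilon}}\prod_{x\in\Lambda_N}\bigl(d\phi_x+\varepsilon\,\delta_0(d\phi_x)\bigr),$$ with $Z_N^\varepsilon$ the normalizing constant. Let $\nu_N(\phi)=\#\{x\in\Lambda_N:\phi_x=0\}$, $\rho_N(\varepsilon)=N^{-d}\,\mu_N^\varepsilon(\nu_N)$ (the mean density of pinned sites) and $\rho(\varepsilon)=\lim_{N\to\infty}\rho_N(\varepsilon)$.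 Theorem. Consider the two cases: 1. (SOS model) $\Psi(x)=|x|$, $d\ge1$, $0<\varepsilon<e^{-2d}$; 2. (massless Gaussian model) $\Psi(x)=\frac12x^2$, $d=2$, $0<\varepsilon<\varepsilon_0$, for some small absolute constant $\varepsilon_0>0$. Then there exist constants $C_3,C_4>0$, depending only on $\varepsilon,d$ in the first case and only on $\varepsilon$ in the second case, such that for all $N\ge1$ and all real $M>C_3N^{d-1}$, $$\mu_N^{\varepsilon}(\nu_N>M)\le e^{-C_4M}.$$ In particular, the limit $\rho(\varepsilon)$ exists and equals $0$ in both cases. Moreover, the SOS model in every dimension $d\ge1$ and the Gaussian model in dimension $d=2$ have a wetting transition: in each of these models there is a critical value $\varepsilon_c\in(0,\infty)$ such that $\lim_{N\to\infty}\rho_N(\varepsilon)=0$ for $0<\varepsilon<\varepsilon_c$ and $\liminf_{N\to\infty}\rho_N(\varepsilon)>0$ for $\varepsilon>\varepsilon_c$. -/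

import Mathlib

open MeasureTheory Filter Topology

noncomputable section

namespace Wetting

/-- The sites of the lattice `ℤ^d`. -/
abbrev Site (d : ℕ) : Type := Fin d → ℤ

/-- The cube `Λ_N ⊂ ℤ^d` of side `N` (it has `N ^ d` sites) centered at the origin; for even `N` it
is centered up to half a lattice spacing: the coordinates range over `-⌊N/2⌋, …, N - 1 - ⌊N/2⌋`. -/
def box (d N : ℕ) : Finset (Site d) :=
  Fintype.piFinset fun _ : Fin d => Finset.Ico (-((N / 2 : ℕ) : ℤ)) ((N : ℤ) - ((N / 2 : ℕ) : ℤ))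

/-- The `2d` nearest neighbours `x ± e_i` of a site `x`. -/
def neighbors {d : ℕ} (x : Site d) : Finset (Site d) :=
  (Finset.univ.image fun i : Fin d => x + Pi.single i 1) ∪
    (Finset.univ.image fun i : Fin d => x - Pi.single i 1)

/-- A configuration of heights in the box `Λ_N`. The reference measure `refMeasure` below lives
on the nonnegative configurations (hard wall). -/
abbrev Config (d N : ℕ) : Type := box d N → ℝ

/-- The height at an arbitrary site, with zero boundary condition outside the box. -/
def height {d N : ℕ} (φ : Config d N) (x : Site d) : ℝ :=
  if h : x ∈ box d N then φ ⟨x, h⟩ else 0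

/-- The Hamiltonian with zero boundary condition and even interaction `Ψ`. The factor `1 / 2`
makes every unordered nearest neighbour pair inside the box count once. -/
def hamiltonian (d N : ℕ) (Ψ : ℝ → ℝ) (φ : Config d N) : ℝ :=
  (1 / 2 : ℝ) * (∑ x ∈ box d N, ∑ y ∈ neighbors x ∩ box d N, Ψ (height φ x - height φ y)) +
    ∑ x ∈ box d N, ∑ _y ∈ neighbors x \ box d N, Ψ (height φ x)

/-- The a priori measure `∏_x (dφ_x + ε δ_0(dφ_x))` on nonnegative configurations. -/
def refMeasure (d N : ℕ) (ε : ℝ) : Measure (Config d N) :=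
  Measure.pi fun _ : box d N =>
    (volume : Measure ℝ).restrict (Set.Ici 0) + ENNReal.ofReal ε • Measure.dirac (0 : ℝ)

/-- The partition function of the `δ`-pinning model above a hard wall. -/
def partitionFunction (d N : ℕ) (Ψ : ℝ → ℝ) (ε : ℝ) : ENNReal :=
  ∫⁻ φ, ENNReal.ofReal (Real.exp (-hamiltonian d N Ψ φ)) ∂refMeasure d N ε

/-- The Gibbs measure of the `δ`-pinning model above a hard wall. -/
def gibbsMeasure (d N : ℕ) (Ψ : ℝ → ℝ) (ε : ℝ) : Measure (Config d N) :=
  (partitionFunction d N Ψ ε)⁻¹ •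
    (refMeasure d N ε).withDensity fun φ => ENNReal.ofReal (Real.exp (-hamiltonian d N Ψ φ))

open scoped Classical in
/-- The number of pinned sites, i.e. of sites at height exactly `0`. -/
def pinnedCount {d N : ℕ} (φ : Config d N) : ℕ :=
  (Finset.univ.filter fun x : box d N => φ x = 0).card

/-- The mean density `ρ_N(ε)` of pinned sites. -/
def density (d : ℕ) (Ψ : ℝ → ℝ) (ε : ℝ) (N : ℕ) : ℝ :=
  ((box d N).card : ℝ)⁻¹ * ∫ φ, (pinnedCount φ : ℝ) ∂gibbsMeasure d N Ψ ε

/-- The absolute value (continuous SOS) interaction. -/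
def sos (x : ℝ) : ℝ := |x|

/-- The quadratic (massless Gaussian) interaction. -/
def gaussian (x : ℝ) : ℝ := x ^ 2 / 2

/-- There are constants `C₃`, `C₄` (not depending on `N` and `M`) such that the probability of more
than `M` pinned sites is at most `exp (-C₄ M)` as soon as `M > C₃ N ^ (d - 1)`; here `1 ≤ d`. -/
def PinnedTailBound (d : ℕ) (Ψ : ℝ → ℝ) (ε : ℝ) : Prop :=
  ∃ C₃ : ℝ, 0 < C₃ ∧ ∃ C₄ : ℝ, 0 < C₄ ∧
    ∀ N : ℕ, 1 ≤ N → ∀ M : ℝ, C₃ * (N : ℝ) ^ (d - 1) < M →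
      gibbsMeasure d N Ψ ε {φ | M < (pinnedCount φ : ℝ)} ≤ ENNReal.ofReal (Real.exp (-(C₄ * M)))

/-- The asymptotic density of pinned sites exists and is zero: `ρ(ε) = lim_N ρ_N(ε) = 0`. -/
def DensityVanishes (d : ℕ) (Ψ : ℝ → ℝ) (ε : ℝ) : Prop :=
  Tendsto (fun N : ℕ => density d Ψ ε N) atTop (𝓝 0)

/-- The asymptotic density of pinned sites is positive: `liminf_N ρ_N(ε) > 0`. -/
def DensityPositive (d : ℕ) (Ψ : ℝ → ℝ) (ε : ℝ) : Prop :=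
  ∃ c : ℝ, 0 < c ∧ ∀ᶠ N : ℕ in atTop, c ≤ density d Ψ ε N

/-- Wetting transition: there is a nonzero (and finite) critical pinning strength below which the
density of pinned sites vanishes and above which it is positive. -/
def HasWettingTransition (d : ℕ) (Ψ : ℝ → ℝ) : Prop :=
  ∃ εc : ℝ, 0 < εc ∧ (∀ ε : ℝ, 0 < ε → ε < εc → DensityVanishes d Ψ ε) ∧
    ∀ ε : ℝ, εc < ε → DensityPositive d Ψ ε

end Wetting

end

noncomputable section

namespace Wetting

open scoped ENNReal
open Function

/-! ### Finite product integrals over arbitrary sets of coordinates -/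

section ProductMeasure

variable {δ : Type*} [DecidableEq δ]

/-! Write `Z^ε` for the partition function and `ν` for the number of pinned sites. Weighting by
`l^ν` replaces `ε` by `l * ε`, so the mean of `(c/ε)^ν` under the Gibbs measure is `Z^c / Z^ε`. Both
the tail bound (exponential Chebyshev) and the vanishing of the density (Jensen) follow once `Z^c ≤
exp(K * N^(d-1)) * Z^ε` for some `c > ε`. It is enough to have `Z^0` on the right, since `Z^ε`
increases with `ε`.

The comparison comes from a shift. The map `t ↦ max (t-1) 0` sends Lebesgue measure on `[0,∞)` to
itself plus a unit atom at zero (`lintegral_lower`). Thus `Z^0` is an integral over pinned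
configurations of strength one, lifted by one unit, and the lift costs energy only on bonds with a
pinned or exterior end point (`energy_le_add_liftCost`). In the SOS model such a bond costs at most
one, so a pinned site costs at most `2d`. This gives `c = exp(-2d)` with a boundary factor.

In the Gaussian model a bond from a pinned site to a neighbour `y` costs `φ_y + 1/2`, which is
unbounded. Jensen, in the form `exp t ≥ 1 + t`, needs only its mean given that the site is pinned,
and in the plane this mean is bounded uniformly in the region and in `ε`
(`exists_mean_height_bound`). The bound is proved by FKG: the mean rises if all heights are forced
to be positive and the law is tilted by the Laplacian of a superharmonic profile `a` of logarithmic
growth. Positivity removes the atoms, and the tilt turns the law into a centred Gaussian field plus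
`a`, conditioned to be positive. Pinning one point makes the variance at most logarithmic in the
distance (`sq_le_logProfile_mul_energy`). Hence a large enough multiple of the profile makes the
condition have probability at least `1/2`, while next to the pinned point the profile is a constant.

The transition itself uses superadditivity of `log Z` (`exists_freeEnergy`). By Jensen, `log (ε'/ε)`
times the density at `ε` is at most the increment of free energy from `ε` to `ε'`, for either sign
of the logarithm. The density is therefore monotone, and it vanishes below a threshold and is
bounded away from zero above it. The threshold is finite because the free energy is at least `log
ε`, and positive by the comparison above (`hasWettingTransition`). -/

theorem lmarginal_mono_ae {μ : Measure ℝ} [SigmaFinite μ] {p : ℝ → Prop} (hp : ∀ᵐ t ∂μ, p t)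
    (s : Finset δ) (f g : (δ → ℝ) → ℝ≥0∞) (x : δ → ℝ)
    (h : ∀ φ : δ → ℝ, (∀ i ∈ s, p (φ i)) → (∀ i ∉ s, φ i = x i) → f φ ≤ g φ) :
    lmarginal (fun _ => μ) s f x ≤ lmarginal (fun _ => μ) s g x := by
  refine lintegral_mono_ae ?_
  have h1 : ∀ᵐ y : s → ℝ ∂(Measure.pi fun _ => μ), ∀ i, p (y i) := by
    rw [ae_all_iff]
    intro i
    exact (Measure.tendsto_eval_ae_ae (μ := fun _ : s => μ) (i := i)).eventually hp
  filter_upwards [h1] with y hy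
  apply h
  · intro i hi
    simpa [updateFinset, hi] using hy ⟨i, hi⟩
  · intro i hi
    simp [updateFinset, hi]

theorem lmarginal_const_mul {μ : Measure ℝ} [SigmaFinite μ] (s : Finset δ)
    (f g : (δ → ℝ) → ℝ≥0∞) (x : δ → ℝ) (c : ℝ≥0∞) (hg : Measurable g)
    (h : ∀ φ : δ → ℝ, (∀ i ∉ s, φ i = x i) → f φ = c * g φ) :
    lmarginal (fun _ => μ) s f x = c * lmarginal (fun _ => μ) s g x := by
  unfold lmarginal
  have hg' : Measurable fun y : s → ℝ => g (updateFinset x s y) := hg.comp measurable_updateFinset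
  rw [← lintegral_const_mul _ hg']
  refine lintegral_congr fun y => ?_
  apply h
  intro i hi
  simp [updateFinset, hi]

/-- Transport of a product integral along a density and a map acting on each coordinate. -/
theorem lmarginal_site_change {μ ν : Measure ℝ} [SigmaFinite μ] [SigmaFinite ν]
    {h : ℝ → ℝ≥0∞} {T : ℝ → ℝ} (hh : Measurable h) (hT : Measurable T)
    (hμν : ∀ f : ℝ → ℝ≥0∞, Measurable f → ∫⁻ t, f t ∂ν = ∫⁻ t, h t * f (T t) ∂μ)
    (s : Finset δ) : ∀ (F : (δ → ℝ) → ℝ≥0∞), Measurable F → ∀ x : δ → ℝ,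
    lmarginal (fun _ => ν) s F x =
      lmarginal (fun _ => μ) s
        (fun φ => (∏ i ∈ s, h (φ i)) * F (fun i => if i ∈ s then T (φ i) else φ i)) x := by
  induction s using Finset.induction_on with
  | empty => intro F hF x; simp
  | insert i s hi ih =>
    intro F hF x
    have hm : Measurable fun φ : δ → ℝ =>
        (∏ j ∈ insert i s, h (φ j)) * F (fun j => if j ∈ insert i s then T (φ j) else φ j) := by
      refine (Finset.measurable_prod _ fun j _ => hh.comp (measurable_pi_apply j)).mul
        (hF.comp (measurable_pi_lambda _ fun j => ?_))
      by_cases hj : j ∈ insert i s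
      · simp only [hj, if_true]; exact hT.comp (measurable_pi_apply j)
      · simp only [hj, if_false]; exact measurable_pi_apply j
    have hm2 : Measurable fun φ : δ → ℝ =>
        (∏ j ∈ s, h (φ j)) * F (fun j => if j ∈ s then T (φ j) else φ j) := by
      refine (Finset.measurable_prod _ fun j _ => hh.comp (measurable_pi_apply j)).mul
        (hF.comp (measurable_pi_lambda _ fun j => ?_))
      by_cases hj : j ∈ s
      · simp only [hj, if_true]; exact hT.comp (measurable_pi_apply j)
      · simp only [hj, if_false]; exact measurable_pi_apply j
    rw [lmarginal_insert _ hF hi, lmarginal_insert _ hm hi]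
    -- With the coordinate `i` frozen at `t`, its factor `h t` leaves the inner integral and the
    -- induction hypothesis handles the others. The one-dimensional identity `hμν` then finishes.
    have key : ∀ t : ℝ, lmarginal (fun _ => μ) s
        (fun φ => (∏ j ∈ insert i s, h (φ j)) *
          F (fun j => if j ∈ insert i s then T (φ j) else φ j)) (update x i t) =
        h t * lmarginal (fun _ => ν) s F (update x i (T t)) := by
      intro t
      rw [ih F hF]
      have e1 : lmarginal (fun _ => μ) s (fun φ => (∏ j ∈ s, h (φ j)) *
          F (fun j => if j ∈ s then T (φ j) else φ j)) (update x i (T t)) =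
          lmarginal (fun _ => μ) s (fun φ => (∏ j ∈ s, h (φ j)) *
          F (fun j => if j ∈ insert i s then T (φ j) else φ j)) (update x i t) := by
        unfold lmarginal
        refine lintegral_congr fun y => ?_
        refine congrArg₂ (· * ·) (Finset.prod_congr rfl fun j hj => ?_) (congrArg F ?_)
        · simp [updateFinset, hj]
        · funext j
          by_cases hj : j ∈ s
          · simp [updateFinset, hj]
          · by_cases hji : j = i
            · subst hji; simp [updateFinset, hj]
            · simp [updateFinset, hj, hji]
      rw [e1]
      apply lmarginal_const_mul
      · refine (Finset.measurable_prod _ fun j _ => hh.comp (measurable_pi_apply j)).mul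
          (hF.comp (measurable_pi_lambda _ fun j => ?_))
        by_cases hj : j ∈ insert i s
        · simp only [hj, if_true]; exact hT.comp (measurable_pi_apply j)
        · simp only [hj, if_false]; exact measurable_pi_apply j
      · intro φ hφ
        rw [Finset.prod_insert hi, hφ i hi, update_self, mul_assoc]
    simp_rw [key]
    exact hμν _ ((hF.lmarginal _).comp (measurable_update x))

/-- Product formula for weights living on disjoint sets of coordinates. -/
theorem lmarginal_union_mul {μ : Measure ℝ} [SigmaFinite μ] {s t : Finset δ}
    (hst : Disjoint s t) (f g : (δ → ℝ) → ℝ≥0∞) (hf : Measurable f) (hg : Measurable g)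
    (hfs : ∀ φ ψ : δ → ℝ, (∀ i ∈ s, φ i = ψ i) → f φ = f ψ)
    (hgt : ∀ φ ψ : δ → ℝ, (∀ i ∈ t, φ i = ψ i) → g φ = g ψ) (x : δ → ℝ) :
    lmarginal (fun _ => μ) (s ∪ t) (fun φ => f φ * g φ) x =
      lmarginal (fun _ => μ) s f x * lmarginal (fun _ => μ) t g x := by
  rw [lmarginal_union _ (fun φ => f φ * g φ) (hf.mul hg) hst, mul_comm]
  have h1 : ∀ φ : δ → ℝ, lmarginal (fun _ => μ) t (fun φ => f φ * g φ) φ =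
      lmarginal (fun _ => μ) t g x * f φ := by
    intro φ
    rw [lmarginal_const_mul (c := f φ) (g := g) (hg := hg), mul_comm]
    · congr 1
      unfold lmarginal
      refine lintegral_congr fun y => hgt _ _ fun i hi => ?_
      simp [updateFinset, hi]
    · intro ψ hψ
      congr 1
      exact hfs _ _ fun i hi => hψ i (Finset.disjoint_left.1 hst hi)
  refine lmarginal_const_mul _ _ _ _ _ hf fun φ _ => h1 φ

end ProductMeasure

/-! ### Four functions theorem and FKG inequality -/

section FourFunctions

/-- Expanding `(c - a) * (c - b) ≥ 0` and using `a * b ≤ c * d` gives `c * (a + b) ≤ c * (c + d)`.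
-/
theorem add_le_add_of_le_of_mul_le {a b c d : ℝ≥0∞} (ha : a ≤ c) (hb : b ≤ c)
    (hab : a * b ≤ c * d) : a + b ≤ c + d := by
  rcases eq_or_ne c ⊤ with rfl | hc
  · simp
  rcases eq_or_ne d ⊤ with rfl | hd
  · simp
  lift c to NNReal using hc
  lift d to NNReal using hd
  lift a to NNReal using ne_top_of_le_ne_top ENNReal.coe_ne_top ha
  lift b to NNReal using ne_top_of_le_ne_top ENNReal.coe_ne_top hb
  norm_cast at *
  have ha' : (a : ℝ) ≤ c := by exact_mod_cast ha
  have hb' : (b : ℝ) ≤ c := by exact_mod_cast hb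
  have hab' : (a : ℝ) * b ≤ c * d := by exact_mod_cast hab
  have : (a : ℝ) + b ≤ c + d := by
    rcases (NNReal.coe_nonneg c).eq_or_lt with h0 | h0
    · have := NNReal.coe_nonneg d
      linarith
    · by_contra hlt
      push Not at hlt
      nlinarith [mul_nonneg (sub_nonneg.2 ha') (sub_nonneg.2 hb')]
  exact_mod_cast this

/-- Symmetrize both products of integrals over `(x, y)` and `(y, x)`. For `x ≤ y` the hypothesis
bounds each term on the left by `f₃ y * f₄ x`, and its diagonal cases bound their product, so
`add_le_add_of_le_of_mul_le` applies pointwise. -/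
theorem four_functions_real (μ : Measure ℝ) [SigmaFinite μ] (f₁ f₂ f₃ f₄ : ℝ → ℝ≥0∞)
    (h₁ : Measurable f₁) (h₂ : Measurable f₂) (h₃ : Measurable f₃) (h₄ : Measurable f₄)
    (h : ∀ x y, f₁ x * f₂ y ≤ f₃ (x ⊔ y) * f₄ (x ⊓ y)) :
    (∫⁻ x, f₁ x ∂μ) * ∫⁻ x, f₂ x ∂μ ≤ (∫⁻ x, f₃ x ∂μ) * ∫⁻ x, f₄ x ∂μ := by
  have dbl : ∀ f g : ℝ → ℝ≥0∞, Measurable f → Measurable g →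
      2 * ((∫⁻ x, f x ∂μ) * ∫⁻ x, g x ∂μ) =
        ∫⁻ x, ∫⁻ y, (f x * g y + f y * g x) ∂μ ∂μ := by
    intro f g hf hg
    have : ∀ x, ∫⁻ y, (f x * g y + f y * g x) ∂μ =
        f x * (∫⁻ y, g y ∂μ) + (∫⁻ y, f y ∂μ) * g x := by
      intro x
      rw [lintegral_add_left (hg.const_mul _), lintegral_const_mul _ hg, lintegral_mul_const _ hf]
    simp_rw [this]
    rw [lintegral_add_left (hf.mul_const _), lintegral_mul_const _ hf, lintegral_const_mul _ hg,
      two_mul]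
  have key : 2 * ((∫⁻ x, f₁ x ∂μ) * ∫⁻ x, f₂ x ∂μ) ≤
      2 * ((∫⁻ x, f₃ x ∂μ) * ∫⁻ x, f₄ x ∂μ) := by
    rw [dbl _ _ h₁ h₂, dbl _ _ h₃ h₄]
    have main : ∀ x y : ℝ, x ≤ y →
        f₁ x * f₂ y + f₁ y * f₂ x ≤ f₃ x * f₄ y + f₃ y * f₄ x := by
      intro x y hxy
      have e1 := h x y
      have e2 := h y x
      have e3 := h x x
      have e4 := h y y
      simp only [sup_of_le_right hxy, inf_of_le_left hxy, sup_of_le_left hxy,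
        inf_of_le_right hxy, sup_idem, inf_idem] at e1 e2 e3 e4
      rw [add_comm (f₃ x * f₄ y)]
      refine add_le_add_of_le_of_mul_le e1 e2 ?_
      calc f₁ x * f₂ y * (f₁ y * f₂ x) = (f₁ x * f₂ x) * (f₁ y * f₂ y) := by ring
        _ ≤ (f₃ x * f₄ x) * (f₃ y * f₄ y) := mul_le_mul' e3 e4
        _ = _ := by ring
    refine lintegral_mono fun x => lintegral_mono fun y => ?_
    rcases le_total x y with hxy | hxy
    · exact main x y hxy
    · have := main y x hxy
      rw [add_comm, add_comm (f₃ x * f₄ y)]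
      exact this
  exact (ENNReal.mul_le_mul_iff_right two_ne_zero ENNReal.ofNat_ne_top).1 key

variable {δ : Type*} [DecidableEq δ]

/-- The four functions theorem of Ahlswede and Daykin for a finite product of measures on `ℝ`. -/
theorem four_functions_lmarginal (μ : Measure ℝ) [SigmaFinite μ] (s : Finset δ) :
    ∀ f₁ f₂ f₃ f₄ : (δ → ℝ) → ℝ≥0∞, Measurable f₁ → Measurable f₂ → Measurable f₃ →
      Measurable f₄ → (∀ x y, f₁ x * f₂ y ≤ f₃ (x ⊔ y) * f₄ (x ⊓ y)) → ∀ x y,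
      lmarginal (fun _ => μ) s f₁ x * lmarginal (fun _ => μ) s f₂ y ≤
        lmarginal (fun _ => μ) s f₃ (x ⊔ y) * lmarginal (fun _ => μ) s f₄ (x ⊓ y) := by
  induction s using Finset.induction_on with
  | empty => intro f₁ f₂ f₃ f₄ _ _ _ _ h x y; simpa using h x y
  | insert i s hi ih =>
    intro f₁ f₂ f₃ f₄ h₁ h₂ h₃ h₄ h x y
    rw [lmarginal_insert _ h₁ hi, lmarginal_insert _ h₂ hi, lmarginal_insert _ h₃ hi,
      lmarginal_insert _ h₄ hi]
    refine four_functions_real μ _ _ _ _ ((h₁.lmarginal _).comp (measurable_update x))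
      ((h₂.lmarginal _).comp (measurable_update y))
      ((h₃.lmarginal _).comp (measurable_update _))
      ((h₄.lmarginal _).comp (measurable_update _)) fun t u => ?_
    have := ih f₁ f₂ f₃ f₄ h₁ h₂ h₃ h₄ h (update x i t) (update y i u)
    convert this using 3
    · funext j
      by_cases hj : j = i
      · subst hj; simp
      · simp [hj]
    · funext j
      by_cases hj : j = i
      · subst hj; simp
      · simp [hj]

/-- The FKG inequality for a log-supermodular weight on a finite product of measures on `ℝ`. -/
theorem fkg_lmarginal (μ : Measure ℝ) [SigmaFinite μ] (s : Finset δ)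
    (w f g : (δ → ℝ) → ℝ≥0∞) (hw : Measurable w) (hf : Measurable f) (hg : Measurable g)
    (hfm : Monotone f) (hgm : Monotone g)
    (h : ∀ x y, w x * w y ≤ w (x ⊔ y) * w (x ⊓ y)) (x : δ → ℝ) :
    lmarginal (fun _ => μ) s (fun φ => f φ * w φ) x *
        lmarginal (fun _ => μ) s (fun φ => g φ * w φ) x ≤
      lmarginal (fun _ => μ) s (fun φ => f φ * g φ * w φ) x * lmarginal (fun _ => μ) s w x := by
  have := four_functions_lmarginal μ s (fun φ => f φ * w φ) (fun φ => g φ * w φ)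
    (fun φ => f φ * g φ * w φ) w (hf.mul hw) (hg.mul hw) ((hf.mul hg).mul hw) hw ?_ x x
  · simpa using this
  · intro x y
    calc f x * w x * (g y * w y) = (f x * g y) * (w x * w y) := by ring
      _ ≤ (f (x ⊔ y) * g (x ⊔ y)) * (w (x ⊔ y) * w (x ⊓ y)) :=
        mul_le_mul' (mul_le_mul' (hfm le_sup_left) (hgm le_sup_right)) (h x y)
      _ = _ := by ring

end FourFunctions

/-! ### Lattice geometry and the energy of a finite region -/

section Lattice

variable {d : ℕ}

theorem mem_neighbors_iff {x y : Site d} :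
    y ∈ neighbors x ↔ ∃ i : Fin d, y = x + Pi.single i 1 ∨ y = x - Pi.single i 1 := by
  simp only [neighbors, Finset.mem_union, Finset.mem_image, Finset.mem_univ, true_and]
  constructor
  · rintro (⟨i, rfl⟩ | ⟨i, rfl⟩)
    · exact ⟨i, Or.inl rfl⟩
    · exact ⟨i, Or.inr rfl⟩
  · rintro ⟨i, rfl | rfl⟩
    · exact Or.inl ⟨i, rfl⟩
    · exact Or.inr ⟨i, rfl⟩

theorem neighbors_symm {x y : Site d} : y ∈ neighbors x ↔ x ∈ neighbors y := by
  have h : ∀ x y : Site d, y ∈ neighbors x → x ∈ neighbors y := by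
    intro x y hxy
    rw [mem_neighbors_iff] at *
    obtain ⟨i, rfl | rfl⟩ := hxy
    · exact ⟨i, Or.inr (by simp)⟩
    · exact ⟨i, Or.inl (by simp)⟩
  exact ⟨h x y, h y x⟩

theorem card_neighbors_le (x : Site d) : (neighbors x).card ≤ 2 * d := by
  unfold neighbors
  refine (Finset.card_union_le _ _).trans ?_
  have h1 := Finset.card_image_le (s := Finset.univ) (f := fun i : Fin d => x + Pi.single i 1)
  have h2 := Finset.card_image_le (s := Finset.univ) (f := fun i : Fin d => x - Pi.single i 1)
  simp only [Finset.card_univ, Fintype.card_fin] at h1 h2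
  omega

theorem sum_neighbors_add (x v : Site d) (f : Site d → ℝ) :
    ∑ y ∈ neighbors (x + v), f y = ∑ y ∈ neighbors x, f (y + v) := by
  refine (Finset.sum_bij (fun y _ => y + v) ?_ ?_ ?_ ?_).symm
  · intro y hy
    rw [mem_neighbors_iff] at *
    obtain ⟨i, rfl | rfl⟩ := hy
    · exact ⟨i, Or.inl (by abel)⟩
    · exact ⟨i, Or.inr (by abel)⟩
  · intro a _ b _ h; simpa using h
  · intro y hy
    refine ⟨y - v, ?_, by simp⟩
    rw [mem_neighbors_iff] at *
    obtain ⟨i, rfl | rfl⟩ := hy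
    · exact ⟨i, Or.inl (by abel)⟩
    · exact ⟨i, Or.inr (by abel)⟩
  · intro y _; rfl

/-- Nonnegative even pair interactions with the properties used for general gradient models. -/
structure IsInteraction (Ψ : ℝ → ℝ) : Prop where
  measurable : Measurable Ψ
  even : ∀ t, Ψ (-t) = Ψ t
  zero : Ψ 0 = 0
  nonneg : ∀ t, 0 ≤ Ψ t
  sub_le : ∀ a b, 0 ≤ a → 0 ≤ b → Ψ (a - b) ≤ Ψ a + Ψ b
  lintegral_ne_top : ∫⁻ t, ENNReal.ofReal (Real.exp (-Ψ t)) ≠ ⊤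

/-- The Hamiltonian of an arbitrary finite region, as a function of all heights. -/
def energy (Ψ : ℝ → ℝ) (D : Finset (Site d)) (φ : Site d → ℝ) : ℝ :=
  (1 / 2 : ℝ) * (∑ x ∈ D, ∑ y ∈ neighbors x ∩ D, Ψ (φ x - φ y)) +
    ∑ x ∈ D, ∑ _y ∈ neighbors x \ D, Ψ (φ x)

/-- The configuration with all heights outside the region set to zero. -/
def truncate (D : Finset (Site d)) (φ : Site d → ℝ) (x : Site d) : ℝ := if x ∈ D then φ x else 0

variable {Ψ : ℝ → ℝ}

theorem energy_congr (D : Finset (Site d)) {φ ψ : Site d → ℝ} (h : ∀ x ∈ D, φ x = ψ x) :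
    energy Ψ D φ = energy Ψ D ψ := by
  unfold energy
  congr 1
  · congr 1
    refine Finset.sum_congr rfl fun x hx => Finset.sum_congr rfl fun y hy => ?_
    rw [h x hx, h y (Finset.mem_inter.1 hy).2]
  · refine Finset.sum_congr rfl fun x hx => Finset.sum_congr rfl fun y _ => ?_
    rw [h x hx]

/-- With heights extended by zero, inner and boundary bonds have the same form and each is counted
from both ends. The value does not depend on `S`, so different regions can be compared bond by bond.
-/
theorem energy_eq_sum (hΨ : IsInteraction Ψ) (D S : Finset (Site d)) (hD : D ⊆ S)
    (hS : ∀ x ∈ D, neighbors x ⊆ S) (φ : Site d → ℝ) :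
    energy Ψ D φ =
      (1 / 2 : ℝ) * ∑ x ∈ S, ∑ y ∈ neighbors x, Ψ (truncate D φ x - truncate D φ y) := by
  have h1 : ∀ x ∈ D, ∑ y ∈ neighbors x, Ψ (truncate D φ x - truncate D φ y) =
      ∑ y ∈ neighbors x ∩ D, Ψ (φ x - φ y) + ∑ y ∈ neighbors x \ D, Ψ (φ x) := by
    intro x hx
    rw [← Finset.sum_inter_add_sum_sdiff (neighbors x) D]
    congr 1
    · refine Finset.sum_congr rfl fun y hy => ?_
      simp [truncate, hx, (Finset.mem_inter.1 hy).2]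
    · refine Finset.sum_congr rfl fun y hy => ?_
      simp [truncate, hx, (Finset.mem_sdiff.1 hy).2]
  have h2 : ∑ x ∈ S \ D, ∑ y ∈ neighbors x, Ψ (truncate D φ x - truncate D φ y) =
      ∑ x ∈ D, ∑ _y ∈ neighbors x \ D, Ψ (φ x) := by
    have : ∀ x ∈ S \ D, ∑ y ∈ neighbors x, Ψ (truncate D φ x - truncate D φ y) =
        ∑ y ∈ neighbors x ∩ D, Ψ (φ y) := by
      intro x hx
      rw [← Finset.sum_inter_add_sum_sdiff (neighbors x) D, add_eq_left.2]
      · refine Finset.sum_congr rfl fun y hy => ?_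
        simp [truncate, (Finset.mem_sdiff.1 hx).2, (Finset.mem_inter.1 hy).2, hΨ.even]
      · refine Finset.sum_eq_zero fun y hy => ?_
        simp [truncate, (Finset.mem_sdiff.1 hx).2, (Finset.mem_sdiff.1 hy).2, hΨ.zero]
    rw [Finset.sum_congr rfl this]
    refine Finset.sum_comm' fun x y => ?_
    simp only [Finset.mem_sdiff, Finset.mem_inter]
    constructor
    · rintro ⟨⟨_, h⟩, h', h''⟩
      exact ⟨⟨neighbors_symm.1 h', h⟩, h''⟩
    · rintro ⟨⟨h, h'⟩, h''⟩
      exact ⟨⟨hS y h'' h, h'⟩, neighbors_symm.1 h, h''⟩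
  rw [← Finset.sum_sdiff hD, h2, Finset.sum_congr rfl h1, Finset.sum_add_distrib, energy]
  ring

/-- A finite region together with its outer boundary. -/
def closure (D : Finset (Site d)) : Finset (Site d) := D ∪ D.biUnion neighbors

theorem subset_closure (D : Finset (Site d)) : D ⊆ closure D := Finset.subset_union_left

theorem neighbors_subset_closure (D : Finset (Site d)) : ∀ x ∈ D, neighbors x ⊆ closure D :=
  fun _ hx => (Finset.subset_biUnion_of_mem neighbors hx).trans Finset.subset_union_right

theorem energy_nonneg (hΨ : IsInteraction Ψ) (D : Finset (Site d)) (φ : Site d → ℝ) :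
    0 ≤ energy Ψ D φ :=
  add_nonneg (mul_nonneg (by norm_num) (Finset.sum_nonneg fun _ _ => Finset.sum_nonneg
    fun _ _ => hΨ.nonneg _)) (Finset.sum_nonneg fun _ _ => Finset.sum_nonneg fun _ _ => hΨ.nonneg _)

theorem energy_zero (hΨ : IsInteraction Ψ) (D : Finset (Site d)) : energy Ψ D 0 = 0 := by
  simp [energy, hΨ.zero]

/-- A pinned site plays the same role as an exterior site. This is what lets conditioning on pinning
become a change of region. -/
theorem energy_update_zero (hΨ : IsInteraction Ψ) (D : Finset (Site d)) (x : Site d)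
    (φ : Site d → ℝ) : energy Ψ D (update φ x 0) = energy Ψ (D.erase x) φ := by
  rw [energy_eq_sum hΨ D (closure D) (subset_closure D) (neighbors_subset_closure D),
    energy_eq_sum hΨ (D.erase x) (closure D) ((Finset.erase_subset _ _).trans (subset_closure D))
      (fun y hy => neighbors_subset_closure D y (Finset.mem_of_mem_erase hy))]
  have : truncate D (update φ x 0) = truncate (D.erase x) φ := by
    funext y
    by_cases hy : y = x
    · subst hy; simp [truncate]
    · simp [truncate, hy]
  rw [this]

/-- Only bonds between `D` and `E` differ: on the right each is replaced by two bonds to height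
zero, and `Ψ (a - b) ≤ Ψ a + Ψ b` for nonnegative heights. -/
theorem energy_union_le (hΨ : IsInteraction Ψ) {D E : Finset (Site d)} (hDE : Disjoint D E)
    (φ : Site d → ℝ) (hφ : ∀ x ∈ D ∪ E, 0 ≤ φ x) :
    energy Ψ (D ∪ E) φ ≤ energy Ψ D φ + energy Ψ E φ := by
  have hs : ∀ x ∈ D ∪ E, neighbors x ⊆ closure (D ∪ E) := neighbors_subset_closure (D ∪ E)
  rw [energy_eq_sum hΨ (D ∪ E) _ (subset_closure _) hs,
    energy_eq_sum hΨ D _ (Finset.subset_union_left.trans (subset_closure (D ∪ E)))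
      fun x hx => hs x (Finset.mem_union_left _ hx),
    energy_eq_sum hΨ E _ (Finset.subset_union_right.trans (subset_closure (D ∪ E)))
      fun x hx => hs x (Finset.mem_union_right _ hx), ← mul_add, ← Finset.sum_add_distrib]
  refine mul_le_mul_of_nonneg_left (Finset.sum_le_sum fun x _ => ?_) (by norm_num)
  rw [← Finset.sum_add_distrib]
  refine Finset.sum_le_sum fun y _ => ?_
  have hd : ∀ z ∈ D, z ∉ E := fun z hz => Finset.disjoint_left.1 hDE hz
  have hn := hΨ.nonneg
  by_cases hxD : x ∈ D <;> by_cases hyD : y ∈ D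
  · simp [truncate, hxD, hyD, hd x hxD, hd y hyD, hΨ.zero]
  · by_cases hyE : y ∈ E
    · have := hΨ.sub_le (φ x) (φ y) (hφ x (by simp [hxD])) (hφ y (by simp [hyE]))
      simpa [truncate, hxD, hyD, hd x hxD, hyE, hΨ.even] using this
    · simp [truncate, hxD, hyD, hd x hxD, hyE, hΨ.zero]
  · by_cases hxE : x ∈ E
    · have := hΨ.sub_le (φ x) (φ y) (hφ x (by simp [hxE])) (hφ y (by simp [hyD]))
      rw [add_comm] at this
      simpa [truncate, hxD, hyD, hd y hyD, hxE, hΨ.even] using this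
    · simp [truncate, hxD, hyD, hd y hyD, hxE, hΨ.zero]
  · by_cases hxE : x ∈ E <;> by_cases hyE : y ∈ E <;>
      simp [truncate, hxD, hyD, hxE, hyE, hΨ.zero]

theorem energy_translate (D : Finset (Site d)) (v : Site d) (φ : Site d → ℝ) :
    energy Ψ (D.image (· + v)) φ = energy Ψ D (fun x => φ (x + v)) := by
  have hmem : ∀ y, y + v ∈ D.image (· + v) ↔ y ∈ D := by
    intro y; simp
  have h : ∀ (E : Finset (Site d)) (ψ : Site d → ℝ), energy Ψ E ψ =
      ∑ x ∈ E, ∑ y ∈ neighbors x,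
        if y ∈ E then (1 / 2 : ℝ) * Ψ (ψ x - ψ y) else Ψ (ψ x) := by
    intro E ψ
    unfold energy
    rw [Finset.mul_sum, ← Finset.sum_add_distrib]
    refine Finset.sum_congr rfl fun x _ => ?_
    rw [← Finset.sum_inter_add_sum_sdiff (neighbors x) E, Finset.mul_sum]
    congr 1
    · refine Finset.sum_congr rfl fun y hy => ?_
      rw [if_pos (Finset.mem_inter.1 hy).2]
    · refine Finset.sum_congr rfl fun y hy => ?_
      rw [if_neg (Finset.mem_sdiff.1 hy).2]
  rw [h, h, Finset.sum_image (by intro a _ b _ hab; simpa using hab)]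
  refine Finset.sum_congr rfl fun x _ => ?_
  rw [sum_neighbors_add]
  simp only [hmem]

/-- Keep only the bonds in direction `i` that go backwards from sites of `D`. The remaining
one-dimensional chains can be integrated one site at a time. -/
theorem sum_chain_le_energy (hΨ : IsInteraction Ψ) (D : Finset (Site d)) (i : Fin d)
    (φ : Site d → ℝ) :
    ∑ x ∈ D, Ψ (φ x - truncate D φ (x - Pi.single i 1)) ≤ energy Ψ D φ := by
  set e : Site d := Pi.single i 1 with he
  have hne : ∀ x : Site d, x + e ≠ x - e := by
    intro x h
    have := congrFun h i
    simp [he] at this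
    omega
  rw [energy_eq_sum hΨ D (closure D) (subset_closure D) (neighbors_subset_closure D)]
  have h1 : ∑ x ∈ closure D, (Ψ (truncate D φ x - truncate D φ (x - e)) +
      Ψ (truncate D φ x - truncate D φ (x + e))) ≤
      ∑ x ∈ closure D, ∑ y ∈ neighbors x, Ψ (truncate D φ x - truncate D φ y) := by
    refine Finset.sum_le_sum fun x _ => ?_
    rw [← Finset.sum_pair (f := fun y => Ψ (truncate D φ x - truncate D φ y)) (hne x).symm]
    refine Finset.sum_le_sum_of_subset_of_nonneg ?_ fun _ _ _ => hΨ.nonneg _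
    intro y hy
    rw [mem_neighbors_iff]
    simp only [Finset.mem_insert, Finset.mem_singleton] at hy
    rcases hy with rfl | rfl
    · exact ⟨i, Or.inr rfl⟩
    · exact ⟨i, Or.inl rfl⟩
  have hD : ∀ x ∈ D, truncate D φ x = φ x := fun x hx => by simp [truncate, hx]
  have h2 : ∑ x ∈ D, Ψ (φ x - truncate D φ (x - e)) ≤
      ∑ x ∈ closure D, Ψ (truncate D φ x - truncate D φ (x - e)) := by
    rw [Finset.sum_congr rfl fun x hx => by rw [← hD x hx]]
    exact Finset.sum_le_sum_of_subset_of_nonneg (subset_closure D) fun _ _ _ => hΨ.nonneg _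
  -- The same bonds seen from their other end. Together with `h2` this compensates the factor `1/2`
  -- of `energy_eq_sum`.
  have h3 : ∑ x ∈ D, Ψ (φ x - truncate D φ (x - e)) ≤
      ∑ x ∈ closure D, Ψ (truncate D φ x - truncate D φ (x + e)) := by
    have : ∑ x ∈ D, Ψ (φ x - truncate D φ (x - e)) =
        ∑ x ∈ D.image (· - e), Ψ (truncate D φ x - truncate D φ (x + e)) := by
      rw [Finset.sum_image (by intro a _ b _ hab; simpa using hab)]
      refine Finset.sum_congr rfl fun x hx => ?_
      rw [sub_add_cancel, hD x hx, ← hΨ.even, neg_sub]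
    rw [this]
    refine Finset.sum_le_sum_of_subset_of_nonneg ?_ fun _ _ _ => hΨ.nonneg _
    intro y hy
    obtain ⟨x, hx, rfl⟩ := Finset.mem_image.1 hy
    exact neighbors_subset_closure D x hx (mem_neighbors_iff.2 ⟨i, Or.inr rfl⟩)
  rw [Finset.sum_add_distrib] at h1
  linarith

end Lattice

/-! ### Partition functions: superadditivity, translation invariance, finiteness -/

section Partition

variable {d : ℕ} {Ψ : ℝ → ℝ}

/-- The a priori measure of a single height. -/
def siteMeasure (ε : ℝ) : Measure ℝ :=
  (volume : Measure ℝ).restrict (Set.Ici 0) + ENNReal.ofReal ε • Measure.dirac (0 : ℝ)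

instance (ε : ℝ) : SigmaFinite (siteMeasure ε) := by
  unfold siteMeasure
  have : IsFiniteMeasure (ENNReal.ofReal ε • Measure.dirac (0 : ℝ)) :=
    Measure.smul_finite _ ENNReal.ofReal_ne_top
  infer_instance

theorem lintegral_siteMeasure (ε : ℝ) (f : ℝ → ℝ≥0∞) :
    ∫⁻ t, f t ∂siteMeasure ε =
      (∫⁻ t in Set.Ici 0, f t) + ENNReal.ofReal ε * f 0 := by
  rw [siteMeasure, lintegral_add_measure, lintegral_smul_measure, lintegral_dirac, smul_eq_mul]

theorem siteMeasure_ae_nonneg (ε : ℝ) : ∀ᵐ t ∂siteMeasure ε, 0 ≤ t := by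
  unfold siteMeasure
  rw [ae_add_measure_iff]
  refine ⟨ae_restrict_mem measurableSet_Ici, Measure.ae_smul_measure ?_ _⟩
  rw [ae_dirac_iff (measurableSet_Ici (a := (0 : ℝ)))]

/-- The Boltzmann weight of a region. -/
def weight (Ψ : ℝ → ℝ) (D : Finset (Site d)) (φ : Site d → ℝ) : ℝ≥0∞ :=
  ENNReal.ofReal (Real.exp (-energy Ψ D φ))

/-- The partition function of a region with zero boundary condition. -/
def partitionOn (Ψ : ℝ → ℝ) (μ : Measure ℝ) (D : Finset (Site d)) : ℝ≥0∞ :=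
  lmarginal (fun _ => μ) D (weight Ψ D) 0

theorem measurable_energy (hΨ : Measurable Ψ) (D : Finset (Site d)) :
    Measurable (energy Ψ D) := by
  unfold energy
  have h : ∀ x : Site d, Measurable fun φ : Site d → ℝ => φ x := fun x => measurable_pi_apply x
  refine Measurable.add (Measurable.const_mul ?_ _) ?_
  · exact Finset.measurable_sum _ fun x _ => Finset.measurable_sum _ fun y _ =>
      hΨ.comp ((h x).sub (h y))
  · exact Finset.measurable_sum _ fun x _ => Finset.measurable_sum _ fun y _ => hΨ.comp (h x)

theorem measurable_weight (hΨ : Measurable Ψ) (D : Finset (Site d)) : Measurable (weight Ψ D) :=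
  ((measurable_energy hΨ D).neg.exp).ennreal_ofReal

theorem weight_congr (D : Finset (Site d)) {φ ψ : Site d → ℝ} (h : ∀ x ∈ D, φ x = ψ x) :
    weight Ψ D φ = weight Ψ D ψ := by
  rw [weight, energy_congr D h, weight]

theorem partitionOn_mul_le_union (hΨ : IsInteraction Ψ) (ε : ℝ) {D E : Finset (Site d)}
    (hDE : Disjoint D E) :
    partitionOn Ψ (siteMeasure ε) D * partitionOn Ψ (siteMeasure ε) E ≤
      partitionOn Ψ (siteMeasure ε) (D ∪ E) := by
  unfold partitionOn
  rw [← lmarginal_union_mul hDE _ _ (measurable_weight hΨ.measurable D)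
    (measurable_weight hΨ.measurable E) (fun φ ψ h => weight_congr D h)
    (fun φ ψ h => weight_congr E h)]
  refine lmarginal_mono_ae (siteMeasure_ae_nonneg ε) _ _ _ _ fun φ hφ _ => ?_
  rw [weight, weight, weight, ← ENNReal.ofReal_mul (Real.exp_pos _).le, ← Real.exp_add]
  have := energy_union_le hΨ hDE φ hφ
  exact ENNReal.ofReal_le_ofReal (Real.exp_le_exp.2 (by linarith))

theorem partitionOn_translate (hΨ : IsInteraction Ψ) (μ : Measure ℝ) [SigmaFinite μ]
    (D : Finset (Site d)) (v : Site d) :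
    partitionOn Ψ μ (D.image (· + v)) = partitionOn Ψ μ D := by
  unfold partitionOn
  have hinj : Injective (fun x : Site d => x + v) := add_left_injective v
  have := lmarginal_image (μ := fun _ : Site d => μ) hinj D
    (measurable_weight hΨ.measurable D) 0
  have h2 : (weight Ψ D ∘ fun φ : Site d → ℝ => fun x => φ (x + v)) =
      weight Ψ (D.image (· + v)) := by
    funext φ
    simp only [comp, weight, energy_translate]
  rw [← h2]
  exact this

/-- A site with largest `i`-th coordinate is nobody's predecessor, so it occurs in a single factor.
Integrating it out costs at most `κ` and leaves the same product over the erased region. -/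
theorem lmarginal_chain_le {k : ℝ → ℝ≥0∞} (hk : Measurable k) (μ : Measure ℝ) [SigmaFinite μ]
    (κ : ℝ≥0∞) (hκ : ∀ b, ∫⁻ t, k (t - b) ∂μ ≤ κ) (i : Fin d) (D : Finset (Site d)) :
    ∀ φ, lmarginal (fun _ => μ) D
      (fun φ => ∏ x ∈ D, k (φ x - truncate D φ (x - Pi.single i 1))) φ ≤ κ ^ D.card := by
  have hmeas : ∀ E : Finset (Site d), Measurable fun φ : Site d → ℝ =>
      ∏ x ∈ E, k (φ x - truncate E φ (x - Pi.single i 1)) := by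
    intro E
    refine Finset.measurable_prod _ fun x _ => hk.comp ((measurable_pi_apply x).sub ?_)
    unfold truncate
    split_ifs
    · exact measurable_pi_apply _
    · exact measurable_const
  induction D using Finset.strongInduction with
  | H D ih =>
    rcases D.eq_empty_or_nonempty with rfl | hne
    · intro φ; simp
    obtain ⟨x, hx, hmax⟩ := D.exists_max_image (fun x => x i) hne
    have hDx : insert x (D.erase x) = D := Finset.insert_erase hx
    have key : ∀ φ : Site d → ℝ, (fun φ => ∫⁻ t, ∏ z ∈ D, k (update φ x t z -
        truncate D (update φ x t) (z - Pi.single i 1)) ∂μ) φ ≤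
        κ * ∏ z ∈ D.erase x, k (φ z - truncate (D.erase x) φ (z - Pi.single i 1)) := by
      intro φ
      have : ∀ t, ∏ z ∈ D, k (update φ x t z -
          truncate D (update φ x t) (z - Pi.single i 1)) =
          k (t - truncate D φ (x - Pi.single i 1)) *
            ∏ z ∈ D.erase x, k (φ z - truncate (D.erase x) φ (z - Pi.single i 1)) := by
        intro t
        rw [← Finset.mul_prod_erase D _ hx]
        congr 1
        · have hx' : x - Pi.single i 1 ≠ x := by simp
          simp [truncate, hx']
        · refine Finset.prod_congr rfl fun z hz => ?_
          have hz' := Finset.mem_erase.1 hz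
          have hzx : z - Pi.single i 1 ≠ x := by
            rintro rfl
            have := hmax z hz'.2
            simp at this
          simp [truncate, hz'.1, hzx]
      simp only [this]
      rw [lintegral_mul_const _ (by exact hk.comp (measurable_id.sub_const _))]
      exact mul_le_mul_left (hκ _) _
    intro φ
    have hcard : D.card = (D.erase x).card + 1 := (Finset.card_erase_add_one hx).symm
    rw [lmarginal_erase' _ (hmeas D) hx]
    refine (lmarginal_mono key φ).trans ?_
    rw [lmarginal_const_mul (c := κ) (hg := hmeas (D.erase x)) (h := fun _ _ => rfl), hcard,
      pow_succ', ]
    exact mul_le_mul_right (ih _ (Finset.erase_ssubset hx) φ) _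

/-- The assumption `1 ≤ d` supplies a direction for the chains. -/
theorem partitionOn_le_pow (hd : 1 ≤ d) (hΨ : IsInteraction Ψ) (μ : Measure ℝ) [SigmaFinite μ]
    (κ : ℝ≥0∞) (hκ : ∀ b, ∫⁻ t, ENNReal.ofReal (Real.exp (-Ψ (t - b))) ∂μ ≤ κ)
    (D : Finset (Site d)) : partitionOn Ψ μ D ≤ κ ^ D.card := by
  refine le_trans (lmarginal_mono (fun φ => ?_) 0) (lmarginal_chain_le
    (k := fun t => ENNReal.ofReal (Real.exp (-Ψ t))) hΨ.measurable.neg.exp.ennreal_ofReal μ κ hκ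
    (⟨0, hd⟩ : Fin d) D 0)
  rw [← ENNReal.ofReal_prod_of_nonneg fun _ _ => (Real.exp_pos _).le, ← Real.exp_sum, weight]
  refine ENNReal.ofReal_le_ofReal (Real.exp_le_exp.2 ?_)
  rw [Finset.sum_neg_distrib]
  exact neg_le_neg (sum_chain_le_energy hΨ D _ φ)

theorem lintegral_exp_translate (b : ℝ) :
    ∫⁻ t, ENNReal.ofReal (Real.exp (-Ψ (t - b))) = ∫⁻ t, ENNReal.ofReal (Real.exp (-Ψ t)) :=
  lintegral_sub_right_eq_self (fun t => ENNReal.ofReal (Real.exp (-Ψ t))) b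

theorem lintegral_siteMeasure_le (hΨ : IsInteraction Ψ) (ε b : ℝ) :
    ∫⁻ t, ENNReal.ofReal (Real.exp (-Ψ (t - b))) ∂siteMeasure ε ≤
      (∫⁻ t, ENNReal.ofReal (Real.exp (-Ψ t))) + ENNReal.ofReal ε := by
  rw [lintegral_siteMeasure, ← lintegral_exp_translate b]
  refine add_le_add (setLIntegral_le_lintegral _ _) ?_
  refine mul_le_of_le_one_right zero_le ?_
  rw [← ENNReal.ofReal_one]
  refine ENNReal.ofReal_le_ofReal ?_
  rw [Real.exp_le_one_iff]
  linarith [hΨ.nonneg (0 - b)]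

theorem partitionOn_siteMeasure_ne_top (hd : 1 ≤ d) (hΨ : IsInteraction Ψ) (ε : ℝ)
    (D : Finset (Site d)) : partitionOn Ψ (siteMeasure ε) D ≠ ⊤ := by
  refine ne_top_of_le_ne_top ?_
    (partitionOn_le_pow hd hΨ (siteMeasure ε) _ (lintegral_siteMeasure_le hΨ ε) D)
  exact ENNReal.pow_ne_top (ENNReal.add_ne_top.2 ⟨hΨ.lintegral_ne_top, ENNReal.ofReal_ne_top⟩)

theorem partitionOn_volume_ne_top (hd : 1 ≤ d) (hΨ : IsInteraction Ψ) (D : Finset (Site d)) :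
    partitionOn Ψ volume D ≠ ⊤ :=
  ne_top_of_le_ne_top (ENNReal.pow_ne_top hΨ.lintegral_ne_top)
    (partitionOn_le_pow hd hΨ volume _ (fun b => (lintegral_exp_translate b).le) D)

theorem partitionOn_ne_zero (hΨ : IsInteraction Ψ) {μ : Measure ℝ} [SigmaFinite μ] (hμ : μ ≠ 0)
    (D : Finset (Site d)) : partitionOn Ψ μ D ≠ 0 := by
  unfold partitionOn lmarginal
  have hm : Measurable fun y : D → ℝ => weight Ψ D (updateFinset 0 D y) :=
    (measurable_weight hΨ.measurable D).comp measurable_updateFinset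
  rw [Ne, lintegral_eq_zero_iff hm]
  intro h
  have h1 : ∀ᵐ y : D → ℝ ∂(Measure.pi fun _ => μ), False := by
    filter_upwards [h] with y hy
    simp only [weight, Pi.zero_apply, ENNReal.ofReal_eq_zero] at hy
    exact absurd hy (not_le.2 (Real.exp_pos _))
  rw [eventually_false_iff_eq_bot, ae_eq_bot] at h1
  have := congrArg (fun ν => ν Set.univ) h1
  simp only [Measure.pi_univ, Measure.coe_zero, Pi.zero_apply, Finset.prod_eq_zero_iff,
    Measure.measure_univ_eq_zero] at this
  obtain ⟨_, _, h0⟩ := this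
  exact hμ h0

theorem siteMeasure_ne_zero (ε : ℝ) : siteMeasure ε ≠ 0 := by
  intro h
  have := congrArg (fun ν => ν Set.univ) h
  simp [siteMeasure] at this

end Partition

/-! ### Exponential moments of the number of pinned sites -/

section Gibbs

variable {d : ℕ} {Ψ : ℝ → ℝ}

theorem card_box (d N : ℕ) : (box d N).card = N ^ d := by
  simp [box, Fintype.card_piFinset]

theorem measurable_height {N : ℕ} : Measurable (height : Config d N → Site d → ℝ) := by
  have : (height : Config d N → Site d → ℝ) = updateFinset (0 : Site d → ℝ) (box d N) := rfl
  rw [this]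
  exact measurable_updateFinset

theorem lintegral_gibbsMeasure (hΨ : Measurable Ψ) (N : ℕ) (ε : ℝ) {f : (Site d → ℝ) → ℝ≥0∞}
    (hf : Measurable f) :
    ∫⁻ φ, f (height φ) ∂gibbsMeasure d N Ψ ε = (partitionOn Ψ (siteMeasure ε) (box d N))⁻¹ *
      lmarginal (fun _ => siteMeasure ε) (box d N) (fun φ => weight Ψ (box d N) φ * f φ) 0 := by
  unfold gibbsMeasure
  have hw : Measurable fun φ : Config d N =>
      ENNReal.ofReal (Real.exp (-hamiltonian d N Ψ φ)) :=
    (measurable_weight hΨ (box d N)).comp measurable_height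
  have hf' : Measurable fun φ : Config d N => f (height φ) := hf.comp measurable_height
  rw [lintegral_smul_measure, lintegral_withDensity_eq_lintegral_mul _ hw hf']
  rfl

theorem isProbabilityMeasure_gibbsMeasure (hd : 1 ≤ d) (hΨ : IsInteraction Ψ) (N : ℕ) (ε : ℝ) :
    IsProbabilityMeasure (gibbsMeasure d N Ψ ε) := by
  constructor
  have := lintegral_gibbsMeasure (d := d) hΨ.measurable N ε (f := fun _ => 1) measurable_const
  simp only [lintegral_const, one_mul, mul_one] at this
  rw [this]
  exact ENNReal.inv_mul_cancel (partitionOn_ne_zero hΨ (siteMeasure_ne_zero ε) _)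
    (partitionOn_siteMeasure_ne_top hd hΨ ε _)

/-- The weight `l` at height zero and `1` elsewhere. -/
def pinWeight (l : ℝ) (t : ℝ) : ℝ≥0∞ := if t = 0 then ENNReal.ofReal l else 1

theorem measurable_pinWeight (l : ℝ) : Measurable (pinWeight l) :=
  Measurable.ite (measurableSet_singleton 0) measurable_const measurable_const

/-- The weight acts only on the atom, because a single point is Lebesgue-null. Changes of pinning
strength thus become reweightings. -/
theorem lintegral_pinWeight {l ε : ℝ} (hl : 0 ≤ l) (f : ℝ → ℝ≥0∞) :
    ∫⁻ t, f t ∂siteMeasure (l * ε) = ∫⁻ t, pinWeight l t * f t ∂siteMeasure ε := by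
  rw [lintegral_siteMeasure, lintegral_siteMeasure]
  congr 1
  · refine lintegral_congr_ae ?_
    have : ∀ᵐ t : ℝ, t ≠ 0 := by simp [ae_iff]
    filter_upwards [ae_restrict_of_ae this] with t ht
    simp [pinWeight, ht]
  · rw [ENNReal.ofReal_mul hl]
    simp only [pinWeight, if_true]
    ring

theorem lmarginal_pinWeight {l ε : ℝ} (hl : 0 ≤ l) (D : Finset (Site d))
    {F : (Site d → ℝ) → ℝ≥0∞} (hF : Measurable F) (x : Site d → ℝ) :
    lmarginal (fun _ => siteMeasure (l * ε)) D F x =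
      lmarginal (fun _ => siteMeasure ε) D (fun φ => (∏ i ∈ D, pinWeight l (φ i)) * F φ) x := by
  rw [lmarginal_site_change (measurable_pinWeight l) measurable_id
    (fun f _ => lintegral_pinWeight hl f) D F hF]
  simp

theorem partitionOn_mono (hΨ : IsInteraction Ψ) (D : Finset (Site d)) {ε ε' : ℝ} (hε : 0 ≤ ε)
    (h : ε < ε') : partitionOn Ψ (siteMeasure ε) D ≤ partitionOn Ψ (siteMeasure ε') D := by
  have hε' : 0 < ε' := hε.trans_lt h
  have e : ε = (ε / ε') * ε' := by field_simp
  unfold partitionOn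
  rw [e, lmarginal_pinWeight (by positivity) D (measurable_weight hΨ.measurable D)]
  refine lmarginal_mono (fun φ => ?_) 0
  refine mul_le_of_le_one_left zero_le ?_
  refine Finset.prod_le_one' fun i _ => ?_
  unfold pinWeight
  split_ifs
  · rw [← ENNReal.ofReal_one]
    exact ENNReal.ofReal_le_ofReal ((div_le_one hε').2 h.le)
  · exact le_rfl

theorem prod_pinWeight {N : ℕ} {l : ℝ} (hl : 0 ≤ l) (φ : Config d N) :
    ∏ i ∈ box d N, pinWeight l (height φ i) = ENNReal.ofReal (l ^ pinnedCount φ) := by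
  classical
  rw [← Finset.prod_attach]
  have : ∀ x : box d N, pinWeight l (height φ x) = if φ x = 0 then ENNReal.ofReal l else 1 := by
    intro x
    simp [pinWeight, height]
  simp only [this]
  rw [Finset.prod_ite]
  simp only [Finset.prod_const, one_pow, mul_one]
  rw [← ENNReal.ofReal_pow hl, pinnedCount]
  congr! 3

theorem pinnedCount_le {N : ℕ} (φ : Config d N) : pinnedCount φ ≤ N ^ d := by
  classical
  unfold pinnedCount
  refine (Finset.card_le_univ _).trans ?_
  rw [Fintype.card_coe, card_box]

theorem measurable_pinnedCount {N : ℕ} :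
    Measurable fun φ : Config d N => (pinnedCount φ : ℝ) := by
  classical
  have : (fun φ : Config d N => (pinnedCount φ : ℝ)) =
      fun φ => ∑ x : box d N, if φ x = 0 then (1 : ℝ) else 0 := by
    funext φ
    rw [pinnedCount, Finset.card_filter]
    push_cast
    refine Finset.sum_congr rfl fun x _ => ?_
    congr
  rw [this]
  exact Finset.measurable_sum _ fun x _ => Measurable.ite
    (measurable_pi_apply x (measurableSet_singleton 0)) measurable_const measurable_const

theorem lintegral_pow_pinnedCount (hΨ : IsInteraction Ψ) (N : ℕ) {l : ℝ} (hl : 0 ≤ l) (ε : ℝ) :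
    ∫⁻ φ, ENNReal.ofReal (l ^ pinnedCount φ) ∂gibbsMeasure d N Ψ ε =
      (partitionOn Ψ (siteMeasure ε) (box d N))⁻¹ *
        partitionOn Ψ (siteMeasure (l * ε)) (box d N) := by
  simp_rw [← prod_pinWeight hl]
  rw [lintegral_gibbsMeasure hΨ.measurable N ε
    (f := fun φ => ∏ i ∈ box d N, pinWeight l (φ i))
    (Finset.measurable_prod _ fun i _ => (measurable_pinWeight l).comp (measurable_pi_apply i))]
  congr 1
  unfold partitionOn
  rw [lmarginal_pinWeight hl _ (measurable_weight hΨ.measurable _)]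
  simp_rw [mul_comm (weight Ψ (box d N) _)]

/-- The logarithm of the partition function. -/
def logPartition (Ψ : ℝ → ℝ) (ε : ℝ) (D : Finset (Site d)) : ℝ :=
  Real.log (partitionOn Ψ (siteMeasure ε) D).toReal

theorem toReal_partitionOn_pos (hd : 1 ≤ d) (hΨ : IsInteraction Ψ) (ε : ℝ) (D : Finset (Site d)) :
    0 < (partitionOn Ψ (siteMeasure ε) D).toReal :=
  ENNReal.toReal_pos (partitionOn_ne_zero hΨ (siteMeasure_ne_zero ε) D)
    (partitionOn_siteMeasure_ne_top hd hΨ ε D)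

theorem integrable_pinnedCount (hd : 1 ≤ d) (hΨ : IsInteraction Ψ) (N : ℕ) (ε : ℝ) :
    Integrable (fun φ => (pinnedCount φ : ℝ)) (gibbsMeasure d N Ψ ε) := by
  have := isProbabilityMeasure_gibbsMeasure hd hΨ N ε
  refine Integrable.of_bound measurable_pinnedCount.aestronglyMeasurable ((N : ℝ) ^ d)
    (Eventually.of_forall fun φ => ?_)
  rw [Real.norm_natCast]
  exact_mod_cast pinnedCount_le φ

/-- Jensen's inequality for `exp`, applied to `(ε'/ε)^ν`. No order between `ε` and `ε'` is assumed:
the case `ε' < ε` yields lower bounds on the mean. -/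
theorem log_mul_mean_pinnedCount_le (hd : 1 ≤ d) (hΨ : IsInteraction Ψ) (N : ℕ) {ε ε' : ℝ}
    (hε : 0 < ε) (hε' : 0 < ε') :
    Real.log (ε' / ε) * ∫ φ, (pinnedCount φ : ℝ) ∂gibbsMeasure d N Ψ ε ≤
      logPartition Ψ ε' (box d N) - logPartition Ψ ε (box d N) := by
  have hprob := isProbabilityMeasure_gibbsMeasure hd hΨ N ε
  set l := ε' / ε with hl
  have hl0 : 0 < l := div_pos hε' hε
  have e : ε' = l * ε := by rw [hl]; field_simp
  have hm : Measurable fun φ : Config d N => l ^ pinnedCount φ := by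
    have : (fun φ : Config d N => l ^ pinnedCount φ) =
        fun φ => Real.exp ((pinnedCount φ : ℝ) * Real.log l) := by
      funext φ
      rw [mul_comm, Real.exp_mul, Real.exp_log hl0, Real.rpow_natCast]
    rw [this]
    exact (measurable_pinnedCount.mul_const _).exp
  have hexp : ∀ φ : Config d N, Real.exp (Real.log l * pinnedCount φ) = l ^ pinnedCount φ := by
    intro φ
    rw [Real.exp_mul, Real.exp_log hl0, Real.rpow_natCast]
  have hli := lintegral_pow_pinnedCount (d := d) hΨ N hl0.le ε
  have hint : Integrable (fun φ : Config d N => l ^ pinnedCount φ) (gibbsMeasure d N Ψ ε) := by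
    refine Integrable.of_bound hm.aestronglyMeasurable ((1 + l) ^ (N ^ d))
      (Eventually.of_forall fun φ => ?_)
    rw [Real.norm_of_nonneg (by positivity)]
    calc l ^ pinnedCount φ ≤ (1 + l) ^ pinnedCount φ := by gcongr; linarith
      _ ≤ (1 + l) ^ (N ^ d) := pow_le_pow_right₀ (by linarith) (pinnedCount_le φ)
  have hval : ∫ φ, l ^ pinnedCount φ ∂gibbsMeasure d N Ψ ε =
      (partitionOn Ψ (siteMeasure ε) (box d N)).toReal⁻¹ *
        (partitionOn Ψ (siteMeasure ε') (box d N)).toReal := by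
    rw [integral_eq_lintegral_of_nonneg_ae (Eventually.of_forall fun φ => by positivity)
      hm.aestronglyMeasurable, hli, ENNReal.toReal_mul, ENNReal.toReal_inv, ← e]
  have hJ := convexOn_exp.map_integral_le (μ := gibbsMeasure d N Ψ ε)
    (f := fun φ => Real.log l * pinnedCount φ) Real.continuous_exp.continuousOn isClosed_univ
    (Eventually.of_forall fun φ => Set.mem_univ _)
    ((integrable_pinnedCount hd hΨ N ε).const_mul _) (by simpa only [comp_def, hexp] using hint)
  simp only [hexp] at hJ
  rw [hval, integral_const_mul] at hJ
  have hp := toReal_partitionOn_pos hd hΨ ε (box d N)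
  have hp' := toReal_partitionOn_pos hd hΨ ε' (box d N)
  have := Real.log_le_log (Real.exp_pos _) hJ
  rw [Real.log_exp, Real.log_mul (by positivity) hp'.ne', Real.log_inv] at this
  unfold logPartition
  linarith

theorem density_nonneg (d : ℕ) (Ψ : ℝ → ℝ) (ε : ℝ) (N : ℕ) : 0 ≤ density d Ψ ε N :=
  mul_nonneg (by positivity) (integral_nonneg fun _ => by positivity)

theorem log_mul_density_le (hd : 1 ≤ d) (hΨ : IsInteraction Ψ) {N : ℕ} (hN : 1 ≤ N) {ε ε' : ℝ}
    (hε : 0 < ε) (hε' : 0 < ε') :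
    Real.log (ε' / ε) * density d Ψ ε N ≤
      logPartition Ψ ε' (box d N) / (N : ℝ) ^ d - logPartition Ψ ε (box d N) / (N : ℝ) ^ d := by
  have h := log_mul_mean_pinnedCount_le hd hΨ N hε hε'
  have hN' : (0 : ℝ) < (N : ℝ) ^ d := by positivity
  rw [density, card_box, ← sub_div, le_div_iff₀ hN']
  push_cast
  field_simp
  exact h

/-- Exponential Chebyshev inequality with the moment of `(c/ε)^ν`, which equals `Z^c / Z^ε`. -/
theorem pinnedTailBound_of_partitionOn_le (hd : 1 ≤ d) (hΨ : IsInteraction Ψ) {ε c K : ℝ}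
    (hε : 0 < ε) (hc : ε < c) (hK : 0 ≤ K)
    (h : ∀ N : ℕ, 1 ≤ N → partitionOn Ψ (siteMeasure c) (box d N) ≤
      ENNReal.ofReal (Real.exp (K * (N : ℝ) ^ (d - 1))) *
        partitionOn Ψ (siteMeasure ε) (box d N)) :
    PinnedTailBound d Ψ ε := by
  set l := c / ε with hl
  have hl1 : 1 < l := (one_lt_div hε).2 hc
  have hl0 : 0 < l := by linarith
  have hlog : 0 < Real.log l := Real.log_pos hl1
  have e : l * ε = c := by rw [hl]; field_simp
  -- Half of the exponent `M * log l` absorbs `K * N^(d-1)` and the other half remains. The summand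
  -- `1` keeps `C₃` positive when `K = 0`.
  refine ⟨2 * K / Real.log l + 1, by positivity, Real.log l / 2, by positivity, ?_⟩
  intro N hN M hM
  have hprob := isProbabilityMeasure_gibbsMeasure hd hΨ N ε
  have hZ0 := partitionOn_ne_zero (d := d) hΨ (siteMeasure_ne_zero ε) (box d N)
  have hZt := partitionOn_siteMeasure_ne_top hd hΨ ε (box d N)
  have hm : MeasurableSet {φ : Config d N | M < (pinnedCount φ : ℝ)} :=
    measurableSet_lt measurable_const measurable_pinnedCount
  have h1 : gibbsMeasure d N Ψ ε {φ | M < (pinnedCount φ : ℝ)} ≤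
      ENNReal.ofReal (Real.exp (-(M * Real.log l))) *
        ∫⁻ φ, ENNReal.ofReal (l ^ pinnedCount φ) ∂gibbsMeasure d N Ψ ε := by
    rw [← lintegral_indicator_one hm, ← lintegral_const_mul' _ _ ENNReal.ofReal_ne_top]
    refine lintegral_mono fun φ => ?_
    by_cases hφ : M < (pinnedCount φ : ℝ)
    · rw [Set.indicator_of_mem (by exact hφ), Pi.one_apply,
        ← ENNReal.ofReal_mul (Real.exp_pos _).le, ← ENNReal.ofReal_one]
      refine ENNReal.ofReal_le_ofReal ?_
      have : l ^ pinnedCount φ = Real.exp (Real.log l * pinnedCount φ) := by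
        rw [Real.exp_mul, Real.exp_log hl0, Real.rpow_natCast]
      rw [this, ← Real.exp_add, Real.one_le_exp_iff]
      nlinarith
    · rw [Set.indicator_of_notMem (by exact hφ)]
      exact zero_le
  refine h1.trans ?_
  rw [lintegral_pow_pinnedCount hΨ N hl0.le ε, e]
  have h2 : (partitionOn Ψ (siteMeasure ε) (box d N))⁻¹ *
      partitionOn Ψ (siteMeasure c) (box d N) ≤
      ENNReal.ofReal (Real.exp (K * (N : ℝ) ^ (d - 1))) := by
    refine (mul_le_mul_right (h N hN) _).trans ?_
    rw [mul_left_comm, ENNReal.inv_mul_cancel hZ0 hZt, mul_one]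
  refine (mul_le_mul_right h2 _).trans ?_
  rw [← ENNReal.ofReal_mul (Real.exp_pos _).le, ← Real.exp_add]
  refine ENNReal.ofReal_le_ofReal (Real.exp_le_exp.2 ?_)
  have hNp : (0 : ℝ) ≤ (N : ℝ) ^ (d - 1) := by positivity
  have h3 : 2 * K / Real.log l * (N : ℝ) ^ (d - 1) ≤ M := by nlinarith
  have h4 : 2 * K * (N : ℝ) ^ (d - 1) ≤ M * Real.log l := by
    calc 2 * K * (N : ℝ) ^ (d - 1) = 2 * K / Real.log l * (N : ℝ) ^ (d - 1) * Real.log l := by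
          field_simp
      _ ≤ _ := mul_le_mul_of_nonneg_right h3 hlog.le
  linarith

/-- A comparison up to surface order makes the increment of `log Z` per site at most `K / N`. -/
theorem densityVanishes_of_partitionOn_le (hd : 1 ≤ d) (hΨ : IsInteraction Ψ) {ε c K : ℝ}
    (hε : 0 < ε) (hc : ε < c)
    (h : ∀ N : ℕ, 1 ≤ N → partitionOn Ψ (siteMeasure c) (box d N) ≤
      ENNReal.ofReal (Real.exp (K * (N : ℝ) ^ (d - 1))) *
        partitionOn Ψ (siteMeasure ε) (box d N)) :
    DensityVanishes d Ψ ε := by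
  have hl1 : 1 < c / ε := (one_lt_div hε).2 hc
  have hlog : 0 < Real.log (c / ε) := Real.log_pos hl1
  have hlim : Tendsto (fun N : ℕ => K / Real.log (c / ε) / (N : ℝ)) atTop (𝓝 0) :=
    tendsto_const_div_atTop_nhds_zero_nat _
  refine squeeze_zero' (Eventually.of_forall fun N => density_nonneg d Ψ ε N) ?_ hlim
  filter_upwards [eventually_ge_atTop 1] with N hN
  have hN0 : (0 : ℝ) < N := by exact_mod_cast hN
  have h1 := log_mul_density_le hd hΨ hN hε (hε.trans hc)
  have hp := toReal_partitionOn_pos hd hΨ ε (box d N)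
  have hp' := toReal_partitionOn_pos hd hΨ c (box d N)
  have h2 : logPartition Ψ c (box d N) ≤
      K * (N : ℝ) ^ (d - 1) + logPartition Ψ ε (box d N) := by
    unfold logPartition
    have := ENNReal.toReal_mono (ENNReal.mul_ne_top ENNReal.ofReal_ne_top
      (partitionOn_siteMeasure_ne_top hd hΨ ε (box d N))) (h N hN)
    rw [ENNReal.toReal_mul, ENNReal.toReal_ofReal (Real.exp_pos _).le] at this
    have := Real.log_le_log hp' this
    rwa [Real.log_mul (Real.exp_pos _).ne' hp.ne', Real.log_exp] at this
  rw [← sub_div] at h1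
  have hpow : (N : ℝ) ^ d = (N : ℝ) ^ (d - 1) * N := by
    rw [← pow_succ, Nat.sub_add_cancel hd]
  have h3 : Real.log (c / ε) * density d Ψ ε N ≤ K / N := by
    refine h1.trans ?_
    rw [div_le_div_iff₀ (by positivity) hN0, hpow]
    nlinarith [show (0 : ℝ) < (N : ℝ) ^ (d - 1) by positivity]
  rw [div_right_comm, le_div_iff₀ hlog]
  linarith

end Gibbs

/-! ### Free energy and existence of the critical value -/

section FreeEnergy

variable {d : ℕ} {Ψ : ℝ → ℝ}

theorem logPartition_translate (hΨ : IsInteraction Ψ) (ε : ℝ) (D : Finset (Site d)) (v : Site d) :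
    logPartition Ψ ε (D.image (· + v)) = logPartition Ψ ε D := by
  rw [logPartition, partitionOn_translate hΨ, logPartition]

theorem add_le_logPartition_union (hd : 1 ≤ d) (hΨ : IsInteraction Ψ) (ε : ℝ)
    {D E : Finset (Site d)} (h : Disjoint D E) :
    logPartition Ψ ε D + logPartition Ψ ε E ≤ logPartition Ψ ε (D ∪ E) := by
  have hD := toReal_partitionOn_pos hd hΨ ε D
  have hE := toReal_partitionOn_pos hd hΨ ε E
  unfold logPartition
  rw [← Real.log_mul hD.ne' hE.ne', ← ENNReal.toReal_mul]
  refine Real.log_le_log ?_ (ENNReal.toReal_mono (partitionOn_siteMeasure_ne_top hd hΨ ε _)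
    (partitionOn_mul_le_union hΨ ε h))
  rw [ENNReal.toReal_mul]
  positivity

theorem logPartition_empty (ε : ℝ) : logPartition Ψ ε (∅ : Finset (Site d)) = 0 := by
  simp [logPartition, partitionOn, weight, energy]

theorem card_mul_le_logPartition_biUnion (hd : 1 ≤ d) (hΨ : IsInteraction Ψ) (ε : ℝ)
    (D : Finset (Site d)) {ι : Type*} [DecidableEq ι] (v : ι → Site d) (s : Finset ι) :
    (∀ a ∈ s, ∀ b ∈ s, a ≠ b → Disjoint (D.image (· + v a)) (D.image (· + v b))) →
    (s.card : ℝ) * logPartition Ψ ε D ≤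
      logPartition Ψ ε (s.biUnion fun a => D.image (· + v a)) := by
  induction s using Finset.induction_on with
  | empty => simp [logPartition_empty]
  | insert a s ha ih =>
    intro h
    have h1 := ih fun b hb c hc => h b (Finset.mem_insert_of_mem hb) c (Finset.mem_insert_of_mem hc)
    have h2 : Disjoint (D.image (· + v a)) (s.biUnion fun a => D.image (· + v a)) := by
      rw [Finset.disjoint_biUnion_right]
      intro b hb
      exact h a (Finset.mem_insert_self _ _) b (Finset.mem_insert_of_mem hb)
        (fun hab => ha (hab ▸ hb))
    have h3 := add_le_logPartition_union hd hΨ ε h2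
    rw [logPartition_translate hΨ] at h3
    rw [Finset.biUnion_insert, Finset.card_insert_of_notMem ha]
    push_cast
    linarith

theorem card_mul_singleton_le_logPartition (hd : 1 ≤ d) (hΨ : IsInteraction Ψ) (ε : ℝ)
    (D : Finset (Site d)) :
    (D.card : ℝ) * logPartition Ψ ε ({0} : Finset (Site d)) ≤ logPartition Ψ ε D := by
  have := card_mul_le_logPartition_biUnion hd hΨ ε {0} (fun x : Site d => x) D
    (by intro a _ b _ hab; simpa using hab)
  simpa using this

/-- The atom alone contributes `ε`. This makes the free energy unbounded in `ε`, hence the critical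
value finite. -/
theorem log_le_logPartition_singleton (hd : 1 ≤ d) (hΨ : IsInteraction Ψ) {ε : ℝ} (hε : 0 < ε) :
    Real.log ε ≤ logPartition Ψ ε ({0} : Finset (Site d)) := by
  unfold logPartition
  refine Real.log_le_log hε ?_
  rw [← ENNReal.ofReal_le_iff_le_toReal (partitionOn_siteMeasure_ne_top hd hΨ ε _), partitionOn,
    lmarginal_singleton]
  simp only
  rw [lintegral_siteMeasure]
  refine le_trans ?_ (self_le_add_left _ _)
  have : weight Ψ ({0} : Finset (Site d)) (update 0 0 0) = 1 := by
    have h0 : update (0 : Site d → ℝ) 0 0 = 0 := by simp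
    rw [h0, weight, energy_zero hΨ]
    simp
  rw [this, mul_one]

theorem logPartition_le_card_mul (hd : 1 ≤ d) (hΨ : IsInteraction Ψ) (ε : ℝ) :
    ∃ C : ℝ, ∀ D : Finset (Site d), logPartition Ψ ε D ≤ D.card * C := by
  set κ : ℝ≥0∞ := (∫⁻ t, ENNReal.ofReal (Real.exp (-Ψ t))) + ENNReal.ofReal ε with hκ
  have hκt : κ ≠ ⊤ := ENNReal.add_ne_top.2 ⟨hΨ.lintegral_ne_top, ENNReal.ofReal_ne_top⟩
  refine ⟨Real.log κ.toReal, fun D => ?_⟩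
  have h := partitionOn_le_pow hd hΨ (siteMeasure ε) κ (lintegral_siteMeasure_le hΨ ε) D
  have h2 := ENNReal.toReal_mono (ENNReal.pow_ne_top hκt) h
  rw [ENNReal.toReal_pow] at h2
  have := Real.log_le_log (toReal_partitionOn_pos hd hΨ ε D) h2
  rwa [Real.log_pow] at this

/-- A large box contains `(n / N) ^ d` disjoint translates of the box of side `N`. -/
theorem logPartition_box_ge (hd : 1 ≤ d) (hΨ : IsInteraction Ψ) (ε : ℝ) {N : ℕ} (hN : 1 ≤ N)
    (n : ℕ) :
    ((n / N : ℕ) : ℝ) ^ d * logPartition Ψ ε (box d N) +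
      ((n : ℝ) ^ d - ((n / N : ℕ) : ℝ) ^ d * (N : ℝ) ^ d) *
        logPartition Ψ ε ({0} : Finset (Site d)) ≤ logPartition Ψ ε (box d n) := by
  set k := n / N with hk
  have hkn : (k : ℤ) * N ≤ n := by exact_mod_cast Nat.div_mul_le_self n N
  have hN0 : (0 : ℤ) < N := by exact_mod_cast hN
  set s : Finset (Fin d → ℕ) := Fintype.piFinset fun _ => Finset.range k with hs
  -- Boxes are centred, so the translation first aligns the lower corners `-⌊N/2⌋` and `-⌊n/2⌋` and
  -- then moves by multiples of `N`.
  set v : (Fin d → ℕ) → Site d := fun t i =>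
    -((n / 2 : ℕ) : ℤ) + ((N / 2 : ℕ) : ℤ) + (t i : ℤ) * N with hv
  have hbox : ∀ (m : ℕ) (x : Site d), x ∈ box d m ↔
      ∀ i, -((m / 2 : ℕ) : ℤ) ≤ x i ∧ x i < (m : ℤ) - ((m / 2 : ℕ) : ℤ) := by
    intro m x
    simp [box, Fintype.mem_piFinset]
  have hdisj : ∀ a ∈ s, ∀ b ∈ s, a ≠ b →
      Disjoint ((box d N).image (· + v a)) ((box d N).image (· + v b)) := by
    intro a _ b _ hab
    rw [Finset.disjoint_left]
    intro z hz hz'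
    obtain ⟨x, hx, rfl⟩ := Finset.mem_image.1 hz
    obtain ⟨y, hy, hxy⟩ := Finset.mem_image.1 hz'
    apply hab
    funext i
    have h1 := (hbox N x).1 hx i
    have h2 := (hbox N y).1 hy i
    have h3 := congrFun hxy i
    simp only [Pi.add_apply, hv] at h3
    have h4 : ((a i : ℤ) - b i) * N = y i - x i := by linarith
    have h5 : ((a i : ℤ) - b i) < 1 := by
      by_contra hlt
      push Not at hlt
      nlinarith
    have h6 : -1 < ((a i : ℤ) - b i) := by
      by_contra hlt
      push Not at hlt
      nlinarith
    omega
  have hsub : (s.biUnion fun a => (box d N).image (· + v a)) ⊆ box d n := by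
    intro z hz
    obtain ⟨a, ha, hz⟩ := Finset.mem_biUnion.1 hz
    obtain ⟨x, hx, rfl⟩ := Finset.mem_image.1 hz
    rw [hbox]
    intro i
    have h1 := (hbox N x).1 hx i
    have h2 : a i < k := by simpa using (Fintype.mem_piFinset.1 ha) i
    have h3 : ((a i : ℤ) + 1) * N ≤ k * N := by
      have : (a i : ℤ) + 1 ≤ k := by exact_mod_cast h2
      nlinarith
    have h4 : (0 : ℤ) ≤ a i * N := by positivity
    simp only [Pi.add_apply, hv]
    constructor
    · linarith
    · linarith
  have hcardU : (s.biUnion fun a => (box d N).image (· + v a)).card = k ^ d * N ^ d := by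
    rw [Finset.card_biUnion fun a ha b hb hab => hdisj a ha b hb hab]
    have : ∀ a ∈ s, ((box d N).image (· + v a)).card = N ^ d := by
      intro a _
      rw [Finset.card_image_of_injective _ (add_left_injective (v a)), card_box]
    rw [Finset.sum_congr rfl this, Finset.sum_const, smul_eq_mul, hs, Fintype.card_piFinset]
    simp
  have h1 := card_mul_le_logPartition_biUnion hd hΨ ε (box d N) v s hdisj
  -- The sites left over by the tiling are filled with single-site regions. Their contribution may
  -- be negative, so it cannot be dropped.
  have h2 := card_mul_singleton_le_logPartition hd hΨ ε
    (box d n \ (s.biUnion fun a => (box d N).image (· + v a)))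
  have h3 := add_le_logPartition_union hd hΨ ε (Finset.disjoint_sdiff (s :=
    (s.biUnion fun a => (box d N).image (· + v a))) (t := box d n))
  rw [Finset.union_sdiff_of_subset hsub] at h3
  have hc : ((box d n \ (s.biUnion fun a => (box d N).image (· + v a))).card : ℝ) =
      (n : ℝ) ^ d - (k : ℝ) ^ d * (N : ℝ) ^ d := by
    rw [Finset.card_sdiff_of_subset hsub, Nat.cast_sub (Finset.card_le_card hsub), hcardU, card_box]
    push_cast
    rfl
  have hsc : (s.card : ℝ) = (k : ℝ) ^ d := by
    rw [hs, Fintype.card_piFinset]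
    simp
  rw [hc] at h2
  rw [hsc] at h1
  linarith

/-- The free energy exists. -/
theorem exists_freeEnergy (hd : 1 ≤ d) (hΨ : IsInteraction Ψ) {ε : ℝ} (hε : 0 < ε) :
    ∃ F : ℝ, Real.log ε ≤ F ∧
      Tendsto (fun N : ℕ => logPartition Ψ ε (box d N) / (N : ℝ) ^ d) atTop (𝓝 F) := by
  obtain ⟨C, hC⟩ := logPartition_le_card_mul (d := d) hd hΨ ε
  set u : ℕ → ℝ := fun N => logPartition Ψ ε (box d N) / (N : ℝ) ^ d with hu
  have hub : ∀ N : ℕ, 1 ≤ N → u N ≤ C := by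
    intro N hN
    have := hC (box d N)
    rw [card_box] at this
    push_cast at this
    rw [hu]
    simp only
    rw [div_le_iff₀ (by positivity)]
    linarith
  have hlog : ∀ N : ℕ, 1 ≤ N → Real.log ε ≤ u N := by
    intro N hN
    have h1 := card_mul_singleton_le_logPartition hd hΨ ε (box d N)
    have h2 := log_le_logPartition_singleton (d := d) hd hΨ hε
    rw [card_box] at h1
    push_cast at h1
    rw [hu]
    simp only
    have hp : (0 : ℝ) < (N : ℝ) ^ d := by positivity
    rw [le_div_iff₀ hp]
    nlinarith
  set S : Set ℝ := u '' Set.Ici 1 with hS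
  have hSne : S.Nonempty := ⟨u 1, 1, by simp, rfl⟩
  have hSb : BddAbove S := ⟨C, by rintro _ ⟨N, hN, rfl⟩; exact hub N hN⟩
  -- As in Fekete's lemma, the limit is the supremum. The tiling bound makes `u n` eventually exceed
  -- anything below `u N`, for each fixed `N`.
  have hle : ∀ N : ℕ, 1 ≤ N → u N ≤ sSup S := fun N hN => le_csSup hSb ⟨N, hN, rfl⟩
  refine ⟨sSup S, (hlog 1 le_rfl).trans (hle 1 le_rfl),
    tendsto_order.2 ⟨fun a ha => ?_, fun a ha => ?_⟩⟩
  · obtain ⟨_, ⟨N, hN, rfl⟩, haN⟩ := exists_lt_of_lt_csSup hSne ha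
    have hN1 : 1 ≤ N := hN
    have hN0 : (0 : ℝ) < N := by exact_mod_cast hN1
    set c₀ := logPartition Ψ ε ({0} : Finset (Site d))
    have hfl : Tendsto (fun n : ℕ => ((n / N : ℕ) : ℝ) / (n : ℝ)) atTop (𝓝 (1 / (N : ℝ))) := by
      have := (tendsto_nat_floor_mul_div_atTop (R := ℝ) (a := 1 / (N : ℝ)) (by positivity)).comp
        tendsto_natCast_atTop_atTop
      refine this.congr fun n => ?_
      simp only [comp]
      rw [one_div_mul_eq_div, Nat.floor_div_eq_div]
    have hlow : Tendsto (fun n : ℕ => (((n / N : ℕ) : ℝ) / (n : ℝ)) ^ d *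
        logPartition Ψ ε (box d N) + (1 - (((n / N : ℕ) : ℝ) / (n : ℝ)) ^ d * (N : ℝ) ^ d) * c₀)
        atTop (𝓝 (u N)) := by
      have h := ((hfl.pow d).mul_const (logPartition Ψ ε (box d N))).add
        (((hfl.pow d).mul_const ((N : ℝ) ^ d)).const_sub 1 |>.mul_const c₀)
      convert h using 2
      rw [hu]
      have : (1 / (N : ℝ)) ^ d * (N : ℝ) ^ d = 1 := by rw [← mul_pow]; field_simp; simp
      rw [this, sub_self, zero_mul, add_zero, one_div, inv_pow]
      exact div_eq_inv_mul _ _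
    filter_upwards [(tendsto_order.1 hlow).1 a haN, eventually_ge_atTop 1] with n hn hn1
    refine hn.trans_le ?_
    have hn0 : (0 : ℝ) < n := by exact_mod_cast hn1
    have := logPartition_box_ge hd hΨ ε hN1 n
    rw [hu]
    simp only
    rw [le_div_iff₀ (by positivity)]
    refine le_trans (le_of_eq ?_) this
    rw [div_pow]
    field_simp
    rfl
  · filter_upwards [eventually_ge_atTop 1] with n hn
    exact (hle n hn).trans_lt ha

/-- The same free energy increment bounds `log (ε'/ε)` times the density at `ε` from above and at
`ε'` from below. -/
theorem density_mono (hd : 1 ≤ d) (hΨ : IsInteraction Ψ) {N : ℕ} (hN : 1 ≤ N) {ε ε' : ℝ}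
    (hε : 0 < ε) (h : ε < ε') : density d Ψ ε N ≤ density d Ψ ε' N := by
  have hε' := hε.trans h
  have h1 := log_mul_density_le hd hΨ hN hε hε'
  have h2 := log_mul_density_le hd hΨ hN hε' hε
  have hl : Real.log (ε / ε') = -Real.log (ε' / ε) := by
    rw [← Real.log_inv, inv_div]
  have hpos : 0 < Real.log (ε' / ε) := Real.log_pos ((one_lt_div hε).2 h)
  rw [hl] at h2
  nlinarith

/-- The critical value is the supremum of the strengths with vanishing density. That set is downward
closed; positivity above it is read off from the increase of the free energy. -/
theorem hasWettingTransition (hd : 1 ≤ d) (hΨ : IsInteraction Ψ) {ε₁ : ℝ} (hε₁ : 0 < ε₁)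
    (hvan : DensityVanishes d Ψ ε₁) : HasWettingTransition d Ψ := by
  choose F hF using fun ε : Set.Ioi (0 : ℝ) => exists_freeEnergy (d := d) hd hΨ ε.2
  have down : ∀ ε ε' : ℝ, 0 < ε → ε < ε' → DensityVanishes d Ψ ε' → DensityVanishes d Ψ ε := by
    intro ε ε' hε h hv
    refine squeeze_zero' (Eventually.of_forall fun N => density_nonneg d Ψ ε N) ?_ hv
    filter_upwards [eventually_ge_atTop 1] with N hN
    exact density_mono hd hΨ hN hε h
  have logneg : ∀ {ε ε' : ℝ}, Real.log (ε / ε') = -Real.log (ε' / ε) := by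
    intro ε ε'
    rw [← Real.log_inv, inv_div]
  have lim : ∀ (ε ε' : ℝ) (hε : 0 < ε) (hε' : 0 < ε'),
      Tendsto (fun N : ℕ => logPartition Ψ ε' (box d N) / (N : ℝ) ^ d -
        logPartition Ψ ε (box d N) / (N : ℝ) ^ d) atTop (𝓝 (F ⟨ε', hε'⟩ - F ⟨ε, hε⟩)) :=
    fun ε ε' hε hε' => (hF ⟨ε', hε'⟩).2.sub (hF ⟨ε, hε⟩).2
  have flat : ∀ (ε ε' : ℝ) (hε : 0 < ε) (h : ε < ε'), DensityVanishes d Ψ ε' →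
      F ⟨ε', hε.trans h⟩ ≤ F ⟨ε, hε⟩ := by
    intro ε ε' hε h hv
    have hε' := hε.trans h
    have h1 := lim ε ε' hε hε'
    have h2 := hv.const_mul (Real.log (ε' / ε))
    rw [mul_zero] at h2
    have := le_of_tendsto_of_tendsto h1 h2 ?_
    · linarith
    · filter_upwards [eventually_ge_atTop 1] with N hN
      have := log_mul_density_le hd hΨ hN hε' hε
      rw [logneg] at this
      linarith
  -- If the free energy did not increase, the increments in finite volume would tend to zero and
  -- squeeze the density at `ε`.
  have strict : ∀ (ε ε' : ℝ) (hε : 0 < ε) (h : ε < ε'), ¬ DensityVanishes d Ψ ε →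
      F ⟨ε, hε⟩ < F ⟨ε', hε.trans h⟩ := by
    intro ε ε' hε h hnv
    by_contra hle
    push Not at hle
    apply hnv
    have hε' := hε.trans h
    have hpos : 0 < Real.log (ε' / ε) := Real.log_pos ((one_lt_div hε).2 h)
    have h1 := (lim ε ε' hε hε').div_const (Real.log (ε' / ε))
    have hub : ∀ᶠ N : ℕ in atTop, density d Ψ ε N ≤ (logPartition Ψ ε' (box d N) / (N : ℝ) ^ d -
        logPartition Ψ ε (box d N) / (N : ℝ) ^ d) / Real.log (ε' / ε) := by
      filter_upwards [eventually_ge_atTop 1] with N hN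
      rw [le_div_iff₀ hpos, mul_comm]
      exact log_mul_density_le hd hΨ hN hε hε'
    have h0 : (F ⟨ε', hε'⟩ - F ⟨ε, hε⟩) / Real.log (ε' / ε) = 0 := by
      refine le_antisymm (div_nonpos_of_nonpos_of_nonneg (by linarith) hpos.le) ?_
      refine ge_of_tendsto h1 ?_
      filter_upwards [hub] with N hN
      exact (density_nonneg d Ψ ε N).trans hN
    rw [h0] at h1
    exact squeeze_zero' (Eventually.of_forall fun N => density_nonneg d Ψ ε N) hub h1
  have exists_not : ∃ ε : ℝ, ε₁ < ε ∧ ¬ DensityVanishes d Ψ ε := by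
    by_contra hall
    push Not at hall
    -- Here `log ε` exceeds the free energy at `ε₁`, so the free energy cannot be flat between `ε₁`
    -- and `ε`.
    set ε := max (2 * ε₁) (Real.exp (F ⟨ε₁, hε₁⟩ + 1)) with hεdef
    have hlt : ε₁ < ε := lt_of_lt_of_le (by linarith) (le_max_left _ _)
    have h1 := flat ε₁ ε hε₁ hlt (hall ε hlt)
    have h2 := (hF ⟨ε, hε₁.trans hlt⟩).1
    have h3 : F ⟨ε₁, hε₁⟩ + 1 ≤ Real.log ε := by
      rw [Real.le_log_iff_exp_le (hε₁.trans hlt)]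
      exact le_max_right _ _
    simp only at h2
    linarith
  obtain ⟨ε₂, hε₂, hnot⟩ := exists_not
  set S : Set ℝ := {ε | 0 < ε ∧ DensityVanishes d Ψ ε} with hS
  have hSne : S.Nonempty := ⟨ε₁, hε₁, hvan⟩
  have hSb : BddAbove S := by
    refine ⟨ε₂, ?_⟩
    rintro ε ⟨_, hv⟩
    by_contra hlt
    push Not at hlt
    exact hnot (down ε₂ ε (hε₁.trans hε₂) hlt hv)
  refine ⟨sSup S, hε₁.trans_le (le_csSup hSb ⟨hε₁, hvan⟩), fun ε hε hlt => ?_, fun ε hlt => ?_⟩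
  · obtain ⟨ε', ⟨_, hv⟩, hεε'⟩ := exists_lt_of_lt_csSup hSne hlt
    exact down ε ε' hε hεε' hv
  · obtain ⟨ε', h1, h2⟩ := exists_between hlt
    have hε' : 0 < ε' := (hε₁.trans_le (le_csSup hSb ⟨hε₁, hvan⟩)).trans h1
    have hε : 0 < ε := hε'.trans h2
    have hnv : ¬ DensityVanishes d Ψ ε' := fun hv => (le_csSup hSb ⟨hε', hv⟩).not_gt h1
    have hF' := strict ε' ε hε' h2 hnv
    have hpos : 0 < Real.log (ε / ε') := Real.log_pos ((one_lt_div hε').2 h2)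
    set Δ := F ⟨ε, hε⟩ - F ⟨ε', hε'⟩ with hΔ
    have hΔpos : 0 < Δ := sub_pos.2 hF'
    -- The increment over `[ε', ε]` tends to `Δ > 0`, so it eventually exceeds `Δ / 2`, and it
    -- bounds the density at the upper end from below.
    refine ⟨Δ / 2 / Real.log (ε / ε'), by positivity, ?_⟩
    filter_upwards [(tendsto_order.1 (lim ε' ε hε' hε)).1 (Δ / 2) (by linarith),
      eventually_ge_atTop 1] with N hN hN1
    have := log_mul_density_le hd hΨ hN1 hε hε'
    rw [logneg] at this
    rw [div_le_iff₀ hpos]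
    linarith

end FreeEnergy

/-! ### Lowering by one unit and the cost of lifting -/

section Shift

variable {d : ℕ} {Ψ : ℝ → ℝ}

/-- Lowering a height by one, stopped at the wall. -/
def lower (t : ℝ) : ℝ := max (t - 1) 0

theorem measurable_lower : Measurable lower := (measurable_id.sub_const 1).max measurable_const

theorem lower_nonneg (t : ℝ) : 0 ≤ lower t := le_max_right _ _

/-- The interval `[0,1)` collapses to the point zero and has length one, which creates a unit atom;
`[1,∞)` is translated onto `[0,∞)`. -/
theorem lintegral_lower (f : ℝ → ℝ≥0∞) :
    ∫⁻ t, f t ∂siteMeasure 1 = ∫⁻ t, 1 * f (lower t) ∂siteMeasure 0 := by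
  rw [lintegral_siteMeasure, lintegral_siteMeasure]
  simp only [one_mul, ENNReal.ofReal_one, ENNReal.ofReal_zero, zero_mul, add_zero]
  have hsplit : Set.Ici (0 : ℝ) = Set.Ico 0 1 ∪ Set.Ici 1 :=
    (Set.Ico_union_Ici_eq_Ici zero_le_one).symm
  have hdisj : Disjoint (Set.Ico (0 : ℝ) 1) (Set.Ici 1) := by
    rw [Set.disjoint_left]
    intro t ht ht'
    exact absurd ht.2 (not_lt.2 ht')
  have h0 : ∫⁻ t in Set.Ici (0 : ℝ), f (lower t) =
      (∫⁻ t in Set.Ico (0 : ℝ) 1, f (lower t)) + ∫⁻ t in Set.Ici (1 : ℝ), f (lower t) := by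
    rw [hsplit, lintegral_union measurableSet_Ici hdisj]
  rw [h0, add_comm]
  congr 1
  · have : ∫⁻ t in Set.Ico (0 : ℝ) 1, f (lower t) = ∫⁻ _ in Set.Ico (0 : ℝ) 1, f 0 := by
      refine setLIntegral_congr_fun measurableSet_Ico fun t ht => ?_
      simp only [lower]
      rw [max_eq_right (by linarith [ht.2])]
    rw [this, setLIntegral_const, Real.volume_Ico]
    simp
  · have h1 : ∫⁻ t in Set.Ici (1 : ℝ), f (lower t) = ∫⁻ t in Set.Ici (1 : ℝ), f (t - 1) := by
      refine setLIntegral_congr_fun measurableSet_Ici fun t ht => ?_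
      simp only [lower]
      rw [max_eq_left (by linarith [Set.mem_Ici.1 ht])]
    rw [h1, ← lintegral_indicator measurableSet_Ici, ← lintegral_indicator measurableSet_Ici,
      ← lintegral_sub_right_eq_self (fun t => (Set.Ici (0 : ℝ)).indicator f t) 1]
    refine lintegral_congr fun t => ?_
    by_cases ht : 1 ≤ t
    · rw [Set.indicator_of_mem (show t - 1 ∈ Set.Ici (0 : ℝ) by simpa using ht),
        Set.indicator_of_mem (show t ∈ Set.Ici (1 : ℝ) from ht)]
    · rw [Set.indicator_of_notMem (show t - 1 ∉ Set.Ici (0 : ℝ) by simpa using ht),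
        Set.indicator_of_notMem (show t ∉ Set.Ici (1 : ℝ) from ht)]

theorem lmarginal_le_partitionOn_of_lower (D : Finset (Site d))
    {G : (Site d → ℝ) → ℝ≥0∞} (hG : Measurable G)
    (h : ∀ φ : Site d → ℝ, (∀ x ∈ D, 0 ≤ φ x) →
      G (fun x => if x ∈ D then lower (φ x) else φ x) ≤ weight Ψ D φ) :
    lmarginal (fun _ => siteMeasure 1) D G 0 ≤ partitionOn Ψ (siteMeasure 0) D := by
  rw [lmarginal_site_change (h := fun _ => 1) measurable_const measurable_lower
    (fun f _ => lintegral_lower f) D G hG]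
  refine lmarginal_mono_ae (siteMeasure_ae_nonneg 0) _ _ _ _ fun φ hφ _ => ?_
  simpa using h φ hφ

/-- The cost of lifting all unpinned heights of `φ` by one, when a single bond with a pinned
end point costs `ρ` of the height at the other end point. -/
def liftCost (ρ : ℝ → ℝ) (D : Finset (Site d)) (φ : Site d → ℝ) : ℝ :=
  ∑ x ∈ D, (if φ x = 0 then ∑ y ∈ neighbors x ∩ D, ρ (φ y) else 0) +
    ∑ x ∈ D, ∑ _y ∈ neighbors x \ D, ρ (φ x)

theorem sum_neighbors_inter_comm (D : Finset (Site d)) (f : Site d → Site d → ℝ) :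
    ∑ x ∈ D, ∑ y ∈ neighbors x ∩ D, f x y = ∑ x ∈ D, ∑ y ∈ neighbors x ∩ D, f y x := by
  refine Finset.sum_comm' fun x y => ?_
  simp only [Finset.mem_inter]
  constructor
  · rintro ⟨h1, h2, h3⟩; exact ⟨⟨neighbors_symm.1 h2, h1⟩, h3⟩
  · rintro ⟨⟨h1, h2⟩, h3⟩; exact ⟨h2, neighbors_symm.1 h1, h3⟩

theorem energy_le_add_liftCost {ρ : ℝ → ℝ}
    (h1 : ∀ a b, 0 ≤ a → 0 ≤ b → Ψ (a - b) ≤ Ψ (lower a - lower b) +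
      (if lower a = 0 then ρ (lower b) else 0) + (if lower b = 0 then ρ (lower a) else 0))
    (h2 : ∀ a, 0 ≤ a → Ψ a ≤ Ψ (lower a) + ρ (lower a))
    (D : Finset (Site d)) (φ : Site d → ℝ) (hφ : ∀ x ∈ D, 0 ≤ φ x) :
    energy Ψ D φ ≤ energy Ψ D (fun x => lower (φ x)) +
      liftCost ρ D (fun x => lower (φ x)) := by
  set ψ : Site d → ℝ := fun x => lower (φ x) with hψ
  have e1 : ∑ x ∈ D, ∑ y ∈ neighbors x ∩ D, Ψ (φ x - φ y) ≤
      ∑ x ∈ D, ∑ y ∈ neighbors x ∩ D, (Ψ (ψ x - ψ y) + (if ψ x = 0 then ρ (ψ y) else 0) +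
        (if ψ y = 0 then ρ (ψ x) else 0)) :=
    Finset.sum_le_sum fun x hx => Finset.sum_le_sum fun y hy =>
      h1 _ _ (hφ x hx) (hφ y (Finset.mem_inter.1 hy).2)
  have e2 : ∑ x ∈ D, ∑ _y ∈ neighbors x \ D, Ψ (φ x) ≤
      ∑ x ∈ D, ∑ _y ∈ neighbors x \ D, (Ψ (ψ x) + ρ (ψ x)) :=
    Finset.sum_le_sum fun x hx => Finset.sum_le_sum fun y _ => h2 _ (hφ x hx)
  -- The two end points of an inner bond contribute equally to the ordered sum, which cancels the
  -- factor `1/2` in the energy.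
  have e3 : ∑ x ∈ D, ∑ y ∈ neighbors x ∩ D, (if ψ y = 0 then ρ (ψ x) else 0) =
      ∑ x ∈ D, ∑ y ∈ neighbors x ∩ D, (if ψ x = 0 then ρ (ψ y) else 0) :=
    sum_neighbors_inter_comm D fun x y => if ψ y = 0 then ρ (ψ x) else 0
  have e4 : ∑ x ∈ D, (if ψ x = 0 then ∑ y ∈ neighbors x ∩ D, ρ (ψ y) else 0) =
      ∑ x ∈ D, ∑ y ∈ neighbors x ∩ D, (if ψ x = 0 then ρ (ψ y) else 0) := by
    refine Finset.sum_congr rfl fun x _ => ?_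
    split_ifs <;> simp
  simp only [Finset.sum_add_distrib] at e1 e2
  rw [e3] at e1
  unfold energy liftCost
  rw [e4]
  linarith

/-- The number of bonds leaving a region. -/
def boundaryCard (D : Finset (Site d)) : ℕ := ∑ x ∈ D, (neighbors x \ D).card

/-- A bond leaves the box through one of `2d` faces, and its inner end has one coordinate fixed at
an extreme value. -/
theorem boundaryCard_box_le (d N : ℕ) : boundaryCard (box d N) ≤ 2 * d * N ^ (d - 1) := by
  have hbox : ∀ x : Site d, x ∈ box d N ↔
      ∀ i, -((N / 2 : ℕ) : ℤ) ≤ x i ∧ x i < (N : ℤ) - ((N / 2 : ℕ) : ℤ) := by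
    intro x
    simp [box, Fintype.mem_piFinset]
  set A : Fin d → Finset (Site d) := fun i => (box d N).filter fun x => x + Pi.single i 1 ∉ box d N
  set B : Fin d → Finset (Site d) := fun i => (box d N).filter fun x => x - Pi.single i 1 ∉ box d N
  have hslab : ∀ (i : Fin d) (a : ℤ) (S : Finset (Site d)),
      (∀ x ∈ S, x ∈ box d N ∧ x i = a) → S.card ≤ N ^ (d - 1) := by
    intro i a S hS
    have hsub : S ⊆ Fintype.piFinset fun j => if j = i then {a} else
        Finset.Ico (-((N / 2 : ℕ) : ℤ)) ((N : ℤ) - ((N / 2 : ℕ) : ℤ)) := by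
      intro x hx
      rw [Fintype.mem_piFinset]
      intro j
      by_cases hj : j = i
      · subst hj; simp [(hS x hx).2]
      · simpa [hj] using (hbox x).1 (hS x hx).1 j
    refine (Finset.card_le_card hsub).trans ?_
    rw [Fintype.card_piFinset, ← Finset.mul_prod_erase _ _ (Finset.mem_univ i)]
    have : ∀ j ∈ Finset.univ.erase i, (if j = i then ({a} : Finset ℤ) else
        Finset.Ico (-((N / 2 : ℕ) : ℤ)) ((N : ℤ) - ((N / 2 : ℕ) : ℤ))).card = N := by
      intro j hj
      rw [if_neg (Finset.ne_of_mem_erase hj), Int.card_Ico]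
      omega
    rw [Finset.prod_congr rfl this, if_pos rfl, Finset.prod_const,
      Finset.card_erase_of_mem (Finset.mem_univ i)]
    simp
  have hA : ∀ i, (A i).card ≤ N ^ (d - 1) := by
    intro i
    refine hslab i ((N : ℤ) - ((N / 2 : ℕ) : ℤ) - 1) _ fun x hx => ?_
    obtain ⟨hx1, hx'⟩ := Finset.mem_filter.1 hx
    refine ⟨hx1, ?_⟩
    rw [hbox] at hx1 hx'
    by_contra hne
    apply hx'
    intro j
    by_cases hj : j = i
    · subst hj
      have := hx1 j
      simp only [Pi.add_apply, Pi.single_eq_same]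
      omega
    · simpa [hj] using hx1 j
  have hB : ∀ i, (B i).card ≤ N ^ (d - 1) := by
    intro i
    refine hslab i (-((N / 2 : ℕ) : ℤ)) _ fun x hx => ?_
    obtain ⟨hx1, hx'⟩ := Finset.mem_filter.1 hx
    refine ⟨hx1, ?_⟩
    rw [hbox] at hx1 hx'
    by_contra hne
    apply hx'
    intro j
    by_cases hj : j = i
    · subst hj
      have := hx1 j
      simp only [Pi.sub_apply, Pi.single_eq_same]
      omega
    · simpa [hj] using hx1 j
  have hx : ∀ x ∈ box d N, (neighbors x \ box d N).card ≤
      ∑ i : Fin d, ((if x + Pi.single i 1 ∉ box d N then 1 else 0) +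
        (if x - Pi.single i 1 ∉ box d N then 1 else 0)) := by
    intro x _
    have hsub : neighbors x \ box d N ⊆
        ((Finset.univ.filter fun i : Fin d => x + Pi.single i 1 ∉ box d N).image
          fun i => x + Pi.single i 1) ∪
        ((Finset.univ.filter fun i : Fin d => x - Pi.single i 1 ∉ box d N).image
          fun i => x - Pi.single i 1) := by
      intro y hy
      obtain ⟨hy1, hy2⟩ := Finset.mem_sdiff.1 hy
      obtain ⟨i, rfl | rfl⟩ := mem_neighbors_iff.1 hy1
      · refine Finset.mem_union_left _ (Finset.mem_image.2 ⟨i, ?_, rfl⟩)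
        simpa using hy2
      · refine Finset.mem_union_right _ (Finset.mem_image.2 ⟨i, ?_, rfl⟩)
        simpa using hy2
    refine (Finset.card_le_card hsub).trans ((Finset.card_union_le _ _).trans ?_)
    rw [Finset.sum_add_distrib, ← Finset.card_filter, ← Finset.card_filter]
    exact add_le_add Finset.card_image_le Finset.card_image_le
  unfold boundaryCard
  refine (Finset.sum_le_sum hx).trans ?_
  rw [Finset.sum_comm]
  calc ∑ i : Fin d, ∑ x ∈ box d N, ((if x + Pi.single i 1 ∉ box d N then 1 else 0) +
        (if x - Pi.single i 1 ∉ box d N then 1 else 0))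
      = ∑ i : Fin d, ((A i).card + (B i).card) := by
        refine Finset.sum_congr rfl fun i _ => ?_
        rw [Finset.sum_add_distrib, ← Finset.card_filter, ← Finset.card_filter]
    _ ≤ ∑ i : Fin d, (N ^ (d - 1) + N ^ (d - 1)) :=
        Finset.sum_le_sum fun i _ => add_le_add (hA i) (hB i)
    _ = 2 * d * N ^ (d - 1) := by
        rw [Finset.sum_const, Finset.card_univ, Fintype.card_fin, smul_eq_mul]
        ring

end Shift

/-! ### The SOS model -/

section SOS

variable {d : ℕ}

theorem isInteraction_sos : IsInteraction sos where
  measurable := measurable_norm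
  even t := abs_neg t
  zero := abs_zero
  nonneg t := abs_nonneg t
  sub_le a b ha hb := abs_sub a b
  lintegral_ne_top := by
    have h : ∫⁻ t in Set.Ioi (0 : ℝ), ENNReal.ofReal (Real.exp (-t)) ≠ ⊤ := by
      have := (integrableOn_exp_neg_Ioi 0)
      exact (hasFiniteIntegral_iff_ofReal
        (Eventually.of_forall fun t => (Real.exp_pos _).le)).1 this.2 |>.ne
    rw [← lintegral_add_compl _ (measurableSet_Ioi (a := (0 : ℝ)))]
    refine ENNReal.add_ne_top.2 ⟨?_, ?_⟩
    · rw [setLIntegral_congr_fun measurableSet_Ioi (g := fun t => ENNReal.ofReal (Real.exp (-t)))]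
      · exact h
      · intro t ht
        simp only [sos, abs_of_pos (Set.mem_Ioi.1 ht)]
    · have h2 : ∫⁻ t in Set.Iio (0 : ℝ), ENNReal.ofReal (Real.exp (- -t)) ≠ ⊤ := by
        rw [← lintegral_indicator measurableSet_Iio]
        rw [← lintegral_indicator measurableSet_Ioi] at h
        rw [← lintegral_neg_eq_self]
        convert h using 3 with t
        simp [Set.indicator]
      rw [Set.compl_Ioi, ← setLIntegral_congr Iio_ae_eq_Iic,
        setLIntegral_congr_fun measurableSet_Iio
        (g := fun t => ENNReal.ofReal (Real.exp (- -t)))]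
      · exact h2
      · intro t ht
        simp only [sos, abs_of_neg (Set.mem_Iio.1 ht)]

theorem abs_sub_lower_le {t : ℝ} (ht : 0 ≤ t) :
    0 ≤ lower t + 1 - t ∧ lower t + 1 - t ≤ if lower t = 0 then 1 else 0 := by
  unfold lower
  rcases le_total t 1 with h | h
  · rw [max_eq_right (by linarith)]
    simp [ht, h]
  · rw [max_eq_left (by linarith)]
    split_ifs <;> constructor <;> linarith

/-- Lifting costs at most one per bond with a pinned end and one per boundary bond. A pinned site
has at most `2d` neighbours, so its total cost is exactly compensated by reducing the unit pinning
strength to `exp(-2d)`. -/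
theorem partitionOn_sos_le (D : Finset (Site d)) :
    partitionOn sos (siteMeasure (Real.exp (-(2 * (d : ℝ))))) D ≤
      ENNReal.ofReal (Real.exp (boundaryCard D)) * partitionOn sos (siteMeasure 0) D := by
  set l : ℝ := Real.exp (-(2 * (d : ℝ))) with hl
  have hwm := measurable_weight isInteraction_sos.measurable D
  have hpm : Measurable fun φ : Site d → ℝ => ∏ i ∈ D, pinWeight l (φ i) :=
    Finset.measurable_prod _ fun i _ => (measurable_pinWeight l).comp (measurable_pi_apply i)
  have hpw : Measurable fun φ : Site d → ℝ => (∏ i ∈ D, pinWeight l (φ i)) * weight sos D φ :=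
    hpm.mul hwm
  have key := lmarginal_le_partitionOn_of_lower (Ψ := sos) D
    (G := fun φ => ENNReal.ofReal (Real.exp (-(boundaryCard D : ℝ))) *
      ((∏ i ∈ D, pinWeight l (φ i)) * weight sos D φ)) (hpw.const_mul _) ?_
  · rw [lmarginal_const_mul (hg := hpw) (h := fun _ _ => rfl),
      ← lmarginal_pinWeight (Real.exp_pos _).le D hwm, mul_one] at key
    calc partitionOn sos (siteMeasure l) D
        = ENNReal.ofReal (Real.exp (boundaryCard D)) *
          (ENNReal.ofReal (Real.exp (-(boundaryCard D : ℝ))) *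
            partitionOn sos (siteMeasure l) D) := by
          rw [← mul_assoc, ← ENNReal.ofReal_mul (Real.exp_pos _).le, ← Real.exp_add]
          simp
      _ ≤ _ := mul_le_mul_right key _
  · intro φ hφ
    set ψ : Site d → ℝ := fun x => lower (φ x) with hψ
    have hψD : ∀ x ∈ D, (if x ∈ D then lower (φ x) else φ x) = ψ x := fun x hx => by simp [hx, hψ]
    have h1 := energy_le_add_liftCost (Ψ := sos) (ρ := fun _ => 1)
      (fun a b ha hb => by
        have h1 := abs_sub_lower_le ha
        have h2 := abs_sub_lower_le hb
        have h3 : a - b = (lower a - lower b) + (-(lower a + 1 - a) + (lower b + 1 - b)) := by ring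
        unfold sos
        rw [h3]
        refine (abs_add_le _ _).trans ?_
        have : |-(lower a + 1 - a) + (lower b + 1 - b)| ≤
            (lower a + 1 - a) + (lower b + 1 - b) := by
          rw [abs_le]; constructor <;> linarith
        linarith)
      (fun a ha => by
        have h1 := abs_sub_lower_le ha
        unfold sos
        rw [abs_of_nonneg ha, abs_of_nonneg (lower_nonneg a)]
        linarith) D φ hφ
    have h2 : liftCost (fun _ => 1) D ψ ≤
        ∑ x ∈ D, (if ψ x = 0 then (2 * d : ℝ) else 0) + boundaryCard D := by
      unfold liftCost boundaryCard
      push_cast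
      refine add_le_add (Finset.sum_le_sum fun x _ => ?_) (by simp)
      split_ifs
      · rw [Finset.sum_const, nsmul_eq_mul, mul_one]
        exact_mod_cast (Finset.card_le_card Finset.inter_subset_left).trans (card_neighbors_le x)
      · exact le_rfl
    have h3 : ∏ i ∈ D, pinWeight l (if i ∈ D then lower (φ i) else φ i) =
        ENNReal.ofReal (Real.exp (-∑ x ∈ D, (if ψ x = 0 then (2 * d : ℝ) else 0))) := by
      rw [← Finset.sum_neg_distrib, Real.exp_sum,
        ENNReal.ofReal_prod_of_nonneg fun _ _ => (Real.exp_pos _).le]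
      refine Finset.prod_congr rfl fun x hx => ?_
      rw [hψD x hx]
      unfold pinWeight
      split_ifs <;> simp [hl]
    simp only
    rw [h3, weight_congr D hψD, weight, weight, ← ENNReal.ofReal_mul (Real.exp_pos _).le,
      ← ENNReal.ofReal_mul (Real.exp_pos _).le, ← Real.exp_add, ← Real.exp_add]
    exact ENNReal.ofReal_le_ofReal (Real.exp_le_exp.2 (by linarith))

theorem partitionOn_sos_box_le {ε : ℝ} (hε : 0 < ε) (N : ℕ) :
    partitionOn sos (siteMeasure (Real.exp (-(2 * (d : ℝ))))) (box d N) ≤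
      ENNReal.ofReal (Real.exp (2 * d * (N : ℝ) ^ (d - 1))) *
        partitionOn sos (siteMeasure ε) (box d N) := by
  refine (partitionOn_sos_le (box d N)).trans (mul_le_mul' ?_
    (partitionOn_mono isInteraction_sos _ le_rfl hε))
  exact ENNReal.ofReal_le_ofReal (Real.exp_le_exp.2 (by exact_mod_cast boundaryCard_box_le d N))

theorem pinnedTailBound_sos (hd : 1 ≤ d) {ε : ℝ} (hε : 0 < ε)
    (h : ε < Real.exp (-(2 * (d : ℝ)))) :
    PinnedTailBound d sos ε ∧ DensityVanishes d sos ε :=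
  ⟨pinnedTailBound_of_partitionOn_le hd isInteraction_sos hε h (by positivity)
      fun N _ => partitionOn_sos_box_le hε N,
    densityVanishes_of_partitionOn_le hd isInteraction_sos hε h
      fun N _ => partitionOn_sos_box_le hε N⟩

end SOS

/-! ### Discrete Dirichlet estimate on a planar wedge -/

section Wedge

theorem sum_range_succ_mul_sub (b : ℕ → ℝ) (n : ℕ) :
    ∑ j ∈ Finset.range n, ((j : ℝ) + 1) * (b j - b (j + 1)) =
      ∑ j ∈ Finset.range n, b j - n * b n := by
  induction n with
  | zero => simp
  | succ n ih =>
    rw [Finset.sum_range_succ, ih, Finset.sum_range_succ]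
    push_cast
    ring

/-- The average over the `n`-th row of the wedge `{(j, r) | j ≤ r}`. -/
def rowAverage (ψ : ℕ → ℕ → ℝ) (n : ℕ) : ℝ :=
  (∑ j ∈ Finset.range (n + 1), ψ j n) / ((n : ℝ) + 1)

/-- The Dirichlet energy of the wedge between the rows `r` and `r + 1`. -/
def rowEnergy (ψ : ℕ → ℕ → ℝ) (r : ℕ) : ℝ :=
  ∑ j ∈ Finset.range (r + 1), (ψ j r - ψ j (r + 1)) ^ 2 +
    ∑ j ∈ Finset.range (r + 1), (ψ j (r + 1) - ψ (j + 1) (r + 1)) ^ 2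

/-- Consecutive averages differ by a mean of vertical increments plus a weighted mean of horizontal
ones. Cauchy–Schwarz over `r + 1` terms gives the decay `1 / (r + 1)`. -/
theorem rowAverage_sub_sq_le (ψ : ℕ → ℕ → ℝ) (r : ℕ) :
    (rowAverage ψ r - rowAverage ψ (r + 1)) ^ 2 ≤ 2 / ((r : ℝ) + 1) * rowEnergy ψ r := by
  have hr : (0 : ℝ) < (r : ℝ) + 1 := by positivity
  set A := ∑ j ∈ Finset.range (r + 1), (ψ j r - ψ j (r + 1)) with hA
  set B := ∑ j ∈ Finset.range (r + 1),
    ((j : ℝ) + 1) * (ψ j (r + 1) - ψ (j + 1) (r + 1)) with hB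
  have hid : rowAverage ψ r - rowAverage ψ (r + 1) =
      -- The second term is the change caused by the extra site of row `r + 1`, rewritten by
      -- summation by parts.
      A / (r + 1) + B / ((r + 1) * (r + 2)) := by
    rw [hA, hB, sum_range_succ_mul_sub (fun j => ψ j (r + 1)) (r + 1), Finset.sum_sub_distrib,
      rowAverage, rowAverage, Finset.sum_range_succ (fun j => ψ j (r + 1)) (r + 1)]
    push_cast
    have h2 : ((r : ℝ) + 1 + 1) ≠ 0 := by positivity
    have h3 : ((r : ℝ) + 2) ≠ 0 := by positivity
    field_simp
    ring
  have hA2 : A ^ 2 ≤ (r + 1) * ∑ j ∈ Finset.range (r + 1), (ψ j r - ψ j (r + 1)) ^ 2 := by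
    have := sq_sum_le_card_mul_sum_sq (s := Finset.range (r + 1))
      (f := fun j => ψ j r - ψ j (r + 1))
    rw [Finset.card_range] at this
    exact_mod_cast this
  have hB2 : B ^ 2 ≤ (r + 1) * ((r + 2) ^ 2 *
      ∑ j ∈ Finset.range (r + 1), (ψ j (r + 1) - ψ (j + 1) (r + 1)) ^ 2) := by
    have := sq_sum_le_card_mul_sum_sq (s := Finset.range (r + 1))
      (f := fun j => ((j : ℝ) + 1) * (ψ j (r + 1) - ψ (j + 1) (r + 1)))
    rw [Finset.card_range] at this
    push_cast at this
    refine this.trans (mul_le_mul_of_nonneg_left ?_ hr.le)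
    rw [Finset.mul_sum]
    refine Finset.sum_le_sum fun j hj => ?_
    have hj' : (j : ℝ) + 1 ≤ r + 2 := by
      have : j < r + 1 := Finset.mem_range.1 hj
      have : (j : ℝ) < r + 1 := by exact_mod_cast this
      linarith
    rw [mul_pow]
    gcongr
  rw [hid, rowEnergy]
  set a := ∑ j ∈ Finset.range (r + 1), (ψ j r - ψ j (r + 1)) ^ 2
  set b := ∑ j ∈ Finset.range (r + 1), (ψ j (r + 1) - ψ (j + 1) (r + 1)) ^ 2
  have h1 : (A / (r + 1)) ^ 2 ≤ a / (r + 1) := by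
    rw [div_pow, div_le_div_iff₀ (by positivity) hr]
    nlinarith
  have h2 : (B / ((r + 1) * (r + 2))) ^ 2 ≤ b / (r + 1) := by
    rw [div_pow, div_le_div_iff₀ (by positivity) hr]
    nlinarith
  calc (A / (r + 1) + B / ((r + 1) * (r + 2))) ^ 2
      ≤ 2 * (A / (r + 1)) ^ 2 + 2 * (B / ((r + 1) * (r + 2))) ^ 2 := by
        nlinarith [sq_nonneg (A / (r + 1) - B / ((r + 1) * (r + 2)))]
    _ ≤ 2 * (a / (r + 1)) + 2 * (b / (r + 1)) := by linarith
    _ = 2 / (r + 1) * (a + b) := by ring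

/-- Telescoping and Cauchy–Schwarz with weights `1 / (r + 1)`; the harmonic sum is the source of the
planar logarithm. -/
theorem sub_rowAverage_sq_le (ψ : ℕ → ℕ → ℝ) (n : ℕ) :
    (ψ 0 0 - rowAverage ψ n) ^ 2 ≤
      2 * (harmonic n : ℝ) * ∑ r ∈ Finset.range n, rowEnergy ψ r := by
  have h0 : ψ 0 0 = rowAverage ψ 0 := by simp [rowAverage]
  have hE : ∀ r, 0 ≤ rowEnergy ψ r := fun r =>
    add_nonneg (Finset.sum_nonneg fun _ _ => sq_nonneg _) (Finset.sum_nonneg fun _ _ => sq_nonneg _)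
  have hH : 2 * (harmonic n : ℝ) = ∑ r ∈ Finset.range n, 2 / ((r : ℝ) + 1) := by
    rw [harmonic]
    push_cast
    rw [Finset.mul_sum]
    rfl
  rw [h0, ← Finset.sum_range_sub' (rowAverage ψ) n, hH]
  exact Finset.sum_sq_le_sum_mul_sum_of_sq_le_mul _ (fun r _ => by positivity)
    (fun r _ => hE r) fun r _ => rowAverage_sub_sq_le ψ r

end Wedge

/-! ### Logarithmic potential estimates in the plane -/

section Planar

theorem sum_neighbors_two (x : Site 2) (f : Site 2 → ℝ) :
    ∑ y ∈ neighbors x, f y = f (x + Pi.single 0 1) + f (x + Pi.single 1 1) +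
      (f (x - Pi.single 0 1) + f (x - Pi.single 1 1)) := by
  have hne : (Pi.single 0 1 : Site 2) ≠ Pi.single 1 1 := by
    intro h; simpa using congrFun h 0
  unfold neighbors
  rw [Finset.sum_union, Finset.sum_image, Finset.sum_image, Fin.sum_univ_two, Fin.sum_univ_two]
  · intro i _ j _ hij
    fin_cases i <;> fin_cases j <;> simp_all
  · intro i _ j _ hij
    fin_cases i <;> fin_cases j <;> simp_all
  · rw [Finset.disjoint_left]
    intro y hy hy'
    simp only [Finset.mem_image, Finset.mem_univ, true_and] at hy hy'
    obtain ⟨i, rfl⟩ := hy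
    obtain ⟨j, hj⟩ := hy'
    have h0 := congrFun hj 0
    have h1 := congrFun hj 1
    fin_cases i <;> fin_cases j <;> simp at h0 h1 <;> omega

/-- A bound on all partial sums of the Dirichlet energy over ordered bonds. -/
def EnergyBound {d : ℕ} (φ : Site d → ℝ) (Q : ℝ) : Prop :=
  ∀ S : Finset (Site d), ∑ x ∈ S, ∑ y ∈ neighbors x, (φ x - φ y) ^ 2 ≤ Q

/-- The wedge embeds injectively in the lattice, so its bonds parallel to `u`, and likewise those
parallel to `v`, contribute at most `Q`. -/
theorem sum_rowEnergy_le {φ : Site 2 → ℝ} {Q : ℝ} (hQ : EnergyBound φ Q) (x u v : Site 2)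
    (hu : ∀ p : Site 2, p + u ∈ neighbors p) (hv : ∀ p : Site 2, p + v ∈ neighbors p)
    (hinj : Injective fun q : ℕ × ℕ => x + q.1 • u + q.2 • v) (n : ℕ) :
    ∑ r ∈ Finset.range n, rowEnergy (fun j r => φ (x + j • u + r • v)) r ≤ 2 * Q := by
  have main : ∀ (T : Finset (ℕ × ℕ)) (w : Site 2), (∀ p : Site 2, p + w ∈ neighbors p) →
      ∑ q ∈ T, (φ (x + q.1 • u + q.2 • v) - φ (x + q.1 • u + q.2 • v + w)) ^ 2 ≤ Q := by
    intro T w hw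
    refine le_trans ?_ (hQ (T.image fun q => x + q.1 • u + q.2 • v))
    rw [Finset.sum_image hinj.injOn]
    refine Finset.sum_le_sum fun q _ => ?_
    exact Finset.single_le_sum (f := fun y => (φ (x + q.1 • u + q.2 • v) - φ y) ^ 2)
      (fun _ _ => sq_nonneg _) (hw _)
  unfold rowEnergy
  rw [Finset.sum_add_distrib, two_mul]
  refine add_le_add ?_ ?_
  · refine le_trans (le_of_eq ?_) (main ((Finset.range n).biUnion fun r =>
      (Finset.range (r + 1)).image fun j => (j, r)) v hv)
    rw [Finset.sum_biUnion]
    · refine Finset.sum_congr rfl fun r _ => ?_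
      rw [Finset.sum_image (by intro a _ b _ h; simpa using h)]
      refine Finset.sum_congr rfl fun j _ => ?_
      simp only [add_smul, one_smul]
      rw [← add_assoc]
    · intro r _ r' _ hrr
      simp only [Function.onFun, Finset.disjoint_left, Finset.mem_image, not_exists, not_and]
      rintro _ ⟨j, _, rfl⟩ j' _ h
      exact hrr (congrArg Prod.snd h).symm
  · refine le_trans (le_of_eq ?_) (main ((Finset.range n).biUnion fun r =>
      (Finset.range (r + 1)).image fun j => (j, r + 1)) u hu)
    rw [Finset.sum_biUnion]
    · refine Finset.sum_congr rfl fun r _ => ?_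
      rw [Finset.sum_image (by intro a _ b _ h; simpa using h)]
      refine Finset.sum_congr rfl fun j _ => ?_
      simp only [add_smul _ _ u, one_smul]
      congr 3
      abel_nf
    · intro r _ r' _ hrr
      simp only [Function.onFun, Finset.disjoint_left, Finset.mem_image, not_exists, not_and]
      rintro _ ⟨j, _, rfl⟩ j' _ h
      have := congrArg Prod.snd h
      simp only at this
      exact hrr (by omega)

/-- Two wedges with apices `x` and `x + n • u`, opening towards each other, have the same `n`-th
row. Both end values are thus compared with one average, each with squared error at most `4 *
harmonic n * Q`. -/
theorem sub_sq_le_harmonic {φ : Site 2 → ℝ} {Q : ℝ} (hQ : EnergyBound φ Q) (x u v : Site 2)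
    (hu : ∀ p : Site 2, p + u ∈ neighbors p) (hu' : ∀ p : Site 2, p + -u ∈ neighbors p)
    (hv : ∀ p : Site 2, p + v ∈ neighbors p)
    (hinj : ∀ a b c d : ℤ, a • u + b • v = c • u + d • v → a = c ∧ b = d) (n : ℕ) :
    (φ x - φ (x + n • u)) ^ 2 ≤ 16 * (harmonic n : ℝ) * Q := by
  have hH : (0 : ℝ) ≤ harmonic n := by
    exact_mod_cast Finset.sum_nonneg fun i _ => by positivity
  have h1 := sub_rowAverage_sq_le (fun j r => φ (x + j • u + r • v)) n
  have h2 := sub_rowAverage_sq_le (fun j r => φ (x + n • u + j • (-u) + r • v)) n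
  have e1 := sum_rowEnergy_le hQ x u v hu hv (by
    rintro ⟨a, b⟩ ⟨c, d⟩ h
    have h' : (a : ℤ) • u + (b : ℤ) • v = (c : ℤ) • u + (d : ℤ) • v := by
      simp only [add_assoc, add_right_inj] at h
      simpa using h
    obtain ⟨h3, h4⟩ := hinj _ _ _ _ h'
    exact Prod.ext (by exact_mod_cast h3) (by exact_mod_cast h4)) n
  have e2 := sum_rowEnergy_le hQ (x + n • u) (-u) v hu' hv (by
    rintro ⟨a, b⟩ ⟨c, d⟩ h
    have h' : (-a : ℤ) • u + (b : ℤ) • v = (-c : ℤ) • u + (d : ℤ) • v := by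
      simp only [add_assoc, add_right_inj] at h
      simpa using h
    obtain ⟨h3, h4⟩ := hinj _ _ _ _ h'
    exact Prod.ext (by simpa using h3) (by exact_mod_cast h4)) n
  have havg : rowAverage (fun j r => φ (x + n • u + j • (-u) + r • v)) n =
      rowAverage (fun j r => φ (x + j • u + r • v)) n := by
    unfold rowAverage
    congr 1
    rw [← Finset.sum_range_reflect]
    refine Finset.sum_congr rfl fun j hj => ?_
    have : j ≤ n := Nat.lt_succ_iff.1 (Finset.mem_range.1 hj)
    obtain ⟨k, rfl⟩ := Nat.exists_eq_add_of_le this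
    have : j + k + 1 - 1 - j = k := by omega
    rw [this, add_smul]
    simp only [smul_neg]
    abel_nf
  rw [havg] at h2
  simp only [zero_smul, add_zero] at h1 h2
  have m1 : (φ x - rowAverage (fun j r => φ (x + j • u + r • v)) n) ^ 2 ≤
      2 * (harmonic n : ℝ) * (2 * Q) := h1.trans (mul_le_mul_of_nonneg_left e1 (by positivity))
  have m2 : (φ (x + n • u) - rowAverage (fun j r => φ (x + j • u + r • v)) n) ^ 2 ≤
      2 * (harmonic n : ℝ) * (2 * Q) := h2.trans (mul_le_mul_of_nonneg_left e2 (by positivity))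
  set m := rowAverage (fun j r => φ (x + j • u + r • v)) n
  nlinarith [sq_nonneg (φ x - m + (φ (x + n • u) - m))]

/-- In the plane the potential difference between two sites is controlled by the Dirichlet energy
up to a factor growing logarithmically with the distance. -/
theorem sub_sq_le_harmonic_add {φ : Site 2 → ℝ} {Q : ℝ} (hQ : EnergyBound φ Q) (x z : Site 2) :
    (φ z - φ x) ^ 2 ≤ 32 * ((harmonic ((z - x) 0).natAbs : ℝ) +
      (harmonic ((z - x) 1).natAbs : ℝ)) * Q := by
  have axis : ∀ (i j : Fin 2), i ≠ j → ∀ (p : Site 2) (m : ℤ),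
      (φ p - φ (p + Pi.single i m)) ^ 2 ≤ 16 * (harmonic m.natAbs : ℝ) * Q := by
    intro i j hij p m
    have hs : ∀ (k : Fin 2) (q : Site 2), q + Pi.single k 1 ∈ neighbors q :=
      fun k q => mem_neighbors_iff.2 ⟨k, Or.inl rfl⟩
    have hs' : ∀ (k : Fin 2) (q : Site 2), q + -Pi.single k 1 ∈ neighbors q :=
      fun k q => mem_neighbors_iff.2 ⟨k, Or.inr (sub_eq_add_neg _ _).symm⟩
    have hind : ∀ a b c d : ℤ, a • (Pi.single i 1 : Site 2) + b • (Pi.single j 1 : Site 2) =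
        c • (Pi.single i 1 : Site 2) + d • (Pi.single j 1 : Site 2) → a = c ∧ b = d := by
      intro a b c d h
      have hi := congrFun h i
      have hj := congrFun h j
      simp [hij, hij.symm] at hi hj
      exact ⟨hi, hj⟩
    rcases Int.natAbs_eq m with hm | hm
    · have := sub_sq_le_harmonic hQ p (Pi.single i 1) (Pi.single j 1) (hs i) (hs' i) (hs j) hind
        m.natAbs
      have e : m.natAbs • (Pi.single i 1 : Site 2) = Pi.single i m := by
        rw [← natCast_zsmul, ← Pi.single_smul]
        rw [smul_eq_mul, mul_one, ← hm]
      rwa [e] at this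
    · have := sub_sq_le_harmonic hQ p (-Pi.single i 1) (Pi.single j 1) (hs' i)
        (by simpa using hs i) (hs j) (by
          intro a b c d h
          have := hind (-a) b (-c) d (by simpa using h)
          exact ⟨by linarith [this.1], this.2⟩) m.natAbs
      have e : m.natAbs • (-Pi.single i 1 : Site 2) = Pi.single i m := by
        rw [← natCast_zsmul, ← Pi.single_neg, ← Pi.single_smul]
        rw [smul_eq_mul, mul_neg, mul_one, ← hm]
      rwa [e] at this
  -- Go from `x` to `z` along the first axis and then along the second.
  have h1 := axis 0 1 (by simp) x ((z - x) 0)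
  have h2 := axis 1 0 (by simp) (x + Pi.single 0 ((z - x) 0)) ((z - x) 1)
  have e : x + Pi.single 0 ((z - x) 0) + Pi.single 1 ((z - x) 1) = z := by
    funext k
    fin_cases k <;> simp
  rw [e] at h2
  set w := x + Pi.single 0 ((z - x) 0)
  nlinarith [sq_nonneg ((φ x - φ w) - (φ w - φ z))]

/-- The squared Euclidean norm. -/
def normSq (w : Site 2) : ℝ := (w 0 : ℝ) ^ 2 + (w 1 : ℝ) ^ 2

/-- A nonnegative function of logarithmic growth, vanishing at the origin and superharmonic
elsewhere. -/
def logProfile (κ : ℝ) (w : Site 2) : ℝ := if w = 0 then 0 else κ + Real.log (4 * normSq w - 3)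

theorem one_le_normSq {w : Site 2} (hw : w ≠ 0) : 1 ≤ normSq w := by
  unfold normSq
  have : (1 : ℤ) ≤ (w 0) ^ 2 + (w 1) ^ 2 := by
    by_contra h
    have h0 : w 0 = 0 := by nlinarith [sq_nonneg (w 0), sq_nonneg (w 1)]
    have h1 : w 1 = 0 := by nlinarith [sq_nonneg (w 0), sq_nonneg (w 1)]
    apply hw
    funext k
    fin_cases k <;> simp [h0, h1]
  exact_mod_cast this

theorem logProfile_nonneg {κ : ℝ} (hκ : 0 ≤ κ) (w : Site 2) : 0 ≤ logProfile κ w := by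
  unfold logProfile
  split_ifs with h
  · exact le_rfl
  · have := one_le_normSq h
    exact add_nonneg hκ (Real.log_nonneg (by linarith))

/-- Away from the origin's neighbours this is a polynomial inequality after exponentiation. At a
neighbour of the origin the other three neighbours have squared norms `2, 2, 4` and give `3κ + log
(5 * 5 * 13)`, so the jump `κ` at the origin must be at least `log 325`. -/
theorem logProfile_superharmonic {κ : ℝ} (hκ : Real.log 325 ≤ κ) {w : Site 2} (hw : w ≠ 0) :
    ∑ y ∈ neighbors w, logProfile κ y ≤ 4 * logProfile κ w := by
  have hlog : Real.log 325 = 2 * Real.log 5 + Real.log 13 := by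
    rw [show (325 : ℝ) = 5 ^ 2 * 13 by norm_num, Real.log_mul (by norm_num) (by norm_num),
      Real.log_pow]
    norm_num
  rw [sum_neighbors_two]
  by_cases hs : (w 0) ^ 2 + (w 1) ^ 2 = 1
  · have hw0 : (w 0) ^ 2 ≤ 1 := by nlinarith [sq_nonneg (w 1)]
    have hw1 : (w 1) ^ 2 ≤ 1 := by nlinarith [sq_nonneg (w 0)]
    have b0 := abs_le_of_sq_le_sq' (by simpa using hw0) (zero_le_one' ℤ)
    have b1 := abs_le_of_sq_le_sq' (by simpa using hw1) (zero_le_one' ℤ)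
    have hw' : w = ![w 0, w 1] := by
      funext k; fin_cases k <;> rfl
    obtain ⟨b00, b01⟩ := b0
    obtain ⟨b10, b11⟩ := b1
    generalize w 0 = p at *
    generalize w 1 = q at *
    subst hw'
    interval_cases p <;> interval_cases q <;> simp at hs <;>
      simp [logProfile, normSq, funext_iff, Fin.forall_fin_two, Matrix.vecHead,
        Matrix.vecTail] <;> norm_num <;> linarith
  · have hs2 : 2 ≤ (w 0) ^ 2 + (w 1) ^ 2 := by
      have h1 : (1 : ℝ) ≤ normSq w := one_le_normSq hw
      have h1' : (1 : ℤ) ≤ (w 0) ^ 2 + (w 1) ^ 2 := by unfold normSq at h1; exact_mod_cast h1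
      omega
    have hne : ∀ y ∈ neighbors w, y ≠ 0 := by
      rintro y hy rfl
      rw [neighbors_symm, mem_neighbors_iff] at hy
      obtain ⟨i, h | h⟩ := hy <;> rw [h] at hs2 <;> fin_cases i <;> simp at hs2
    have m1 := hne _ (mem_neighbors_iff.2 ⟨0, Or.inl rfl⟩)
    have m2 := hne _ (mem_neighbors_iff.2 ⟨1, Or.inl rfl⟩)
    have m3 := hne _ (mem_neighbors_iff.2 ⟨0, Or.inr rfl⟩)
    have m4 := hne _ (mem_neighbors_iff.2 ⟨1, Or.inr rfl⟩)
    have p1 := one_le_normSq m1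
    have p2 := one_le_normSq m2
    have p3 := one_le_normSq m3
    have p4 := one_le_normSq m4
    have p0 := one_le_normSq hw
    simp only [logProfile, m1, m2, m3, m4, hw, if_false]
    have key : (4 * normSq (w + Pi.single 0 1) - 3) * (4 * normSq (w + Pi.single 1 1) - 3) *
        ((4 * normSq (w - Pi.single 0 1) - 3) * (4 * normSq (w - Pi.single 1 1) - 3)) ≤
        (4 * normSq w - 3) ^ 4 := by
      have hs3 : (2 : ℝ) ≤ (w 0 : ℝ) ^ 2 + (w 1 : ℝ) ^ 2 := by exact_mod_cast hs2
      simp only [normSq, Pi.add_apply, Pi.sub_apply, Pi.single_eq_same, ne_eq,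
        Pi.single_eq_of_ne, one_ne_zero, zero_ne_one, not_false_eq_true, add_zero, sub_zero]
      push_cast
      set p : ℝ := (w 0 : ℝ)
      set q : ℝ := (w 1 : ℝ)
      have e : (4 * (p ^ 2 + q ^ 2) - 3) ^ 4 - (4 * ((p + 1) ^ 2 + q ^ 2) - 3) *
          (4 * (p ^ 2 + (q + 1) ^ 2) - 3) * ((4 * ((p - 1) ^ 2 + q ^ 2) - 3) *
          (4 * (p ^ 2 + (q - 1) ^ 2) - 3)) =
          16 * (4 * (p ^ 2 + q ^ 2) - 1) * (4 * (p ^ 2 + q ^ 2) - 5) +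
            1024 * (p ^ 2 - q ^ 2) ^ 2 := by ring
      have : 0 ≤ 16 * (4 * (p ^ 2 + q ^ 2) - 1) * (4 * (p ^ 2 + q ^ 2) - 5) := by
        apply mul_nonneg <;> nlinarith
      nlinarith [sq_nonneg (p ^ 2 - q ^ 2)]
    have := Real.log_le_log (by
      have := mul_pos (mul_pos (show 0 < 4 * normSq (w + Pi.single 0 1) - 3 by linarith)
        (show 0 < 4 * normSq (w + Pi.single 1 1) - 3 by linarith))
        (mul_pos (show 0 < 4 * normSq (w - Pi.single 0 1) - 3 by linarith)
        (show 0 < 4 * normSq (w - Pi.single 1 1) - 3 by linarith))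
      exact this) key
    rw [Real.log_mul, Real.log_mul, Real.log_mul, Real.log_pow] at this
    · push_cast at this
      linarith
    all_goals first | (apply ne_of_gt; linarith) | (apply ne_of_gt; apply mul_pos <;> linarith)

theorem harmonic_add_le_logProfile {κ : ℝ} (hκ : 1 ≤ κ) {w : Site 2} (hw : w ≠ 0) :
    (harmonic (w 0).natAbs : ℝ) + (harmonic (w 1).natAbs : ℝ) ≤ 2 * logProfile κ w := by
  have h : ∀ k : Fin 2, (harmonic (w k).natAbs : ℝ) ≤ logProfile κ w := by
    intro k
    rcases eq_or_ne (w k) 0 with h0 | h0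
    · rw [h0]
      simpa using logProfile_nonneg (by linarith) w
    · have h1 := harmonic_le_one_add_log (w k).natAbs
      have hk : (1 : ℝ) ≤ |(w k : ℝ)| := by
        have : (1 : ℤ) ≤ |w k| := Int.one_le_abs h0
        exact_mod_cast this
      have hsq : (w k : ℝ) ^ 2 ≤ normSq w := by
        unfold normSq
        fin_cases k
        · simpa using sq_nonneg (w 1 : ℝ)
        · simpa using sq_nonneg (w 0 : ℝ)
      have h2 : Real.log ((w k).natAbs : ℝ) ≤ Real.log (4 * normSq w - 3) := by
        have e : ((w k).natAbs : ℝ) = |(w k : ℝ)| := by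
          rw [Nat.cast_natAbs, Int.cast_abs]
        rw [e]
        refine Real.log_le_log (by linarith) ?_
        have := sq_abs (w k : ℝ)
        nlinarith
      rw [logProfile, if_neg hw]
      linarith
  linarith [h 0, h 1]

/-- The summand is `exp(-2 * log (4 * normSq w - 3))`, the form of the error in the union bound for
positivity. Domination by the product of `(1 + (w k)^2)⁻¹` reduces summability to one dimension. -/
theorem exists_sum_logProfile_bound : ∃ S : ℝ, 0 ≤ S ∧ ∀ T : Finset (Site 2), 0 ∉ T →
    ∑ w ∈ T, ((4 * normSq w - 3) ^ 2)⁻¹ ≤ S := by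
  have hsum : Summable fun n : ℤ => 1 / (n : ℝ) ^ 2 :=
    Real.summable_one_div_int_pow.2 one_lt_two
  set t : ℝ := 1 + ∑' n : ℤ, 1 / (n : ℝ) ^ 2 with ht
  have ht0 : 0 ≤ t := add_nonneg zero_le_one (tsum_nonneg fun n => by positivity)
  have h1 : ∀ A : Finset ℤ, ∑ n ∈ A, (1 + (n : ℝ) ^ 2)⁻¹ ≤ t := by
    intro A
    calc ∑ n ∈ A, (1 + (n : ℝ) ^ 2)⁻¹ ≤ ∑ n ∈ A, ((if n = 0 then 1 else 0) + 1 / (n : ℝ) ^ 2) := by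
          refine Finset.sum_le_sum fun n _ => ?_
          split_ifs with h
          · simp [h]
          · have : (0 : ℝ) < (n : ℝ) ^ 2 := by positivity
            rw [zero_add, ← one_div]
            exact one_div_le_one_div_of_le this (by linarith)
      _ = ∑ n ∈ A, (if n = 0 then (1 : ℝ) else 0) + ∑ n ∈ A, 1 / (n : ℝ) ^ 2 :=
          Finset.sum_add_distrib
      _ ≤ t := by
          refine add_le_add ?_ (hsum.sum_le_tsum _ fun n _ => by positivity)
          rw [Finset.sum_ite_eq']
          split_ifs <;> norm_num
  refine ⟨4 * (t * t), by positivity, fun T hT => ?_⟩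
  set A : Finset ℤ := T.image (fun w => w 0) ∪ T.image (fun w => w 1) with hA
  have hTA : T ⊆ Fintype.piFinset fun _ : Fin 2 => A := by
    intro w hw
    rw [Fintype.mem_piFinset]
    intro k
    fin_cases k
    · exact Finset.mem_union_left _ (Finset.mem_image_of_mem _ hw)
    · exact Finset.mem_union_right _ (Finset.mem_image_of_mem _ hw)
  calc ∑ w ∈ T, ((4 * normSq w - 3) ^ 2)⁻¹
      ≤ ∑ w ∈ T, 4 * ∏ k : Fin 2, (1 + (w k : ℝ) ^ 2)⁻¹ := by
        refine Finset.sum_le_sum fun w hw => ?_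
        have hw0 : w ≠ 0 := fun h => hT (h ▸ hw)
        have h := one_le_normSq hw0
        have hp : (0 : ℝ) < (1 + (w 0 : ℝ) ^ 2) * (1 + (w 1 : ℝ) ^ 2) := by positivity
        rw [Fin.prod_univ_two, ← mul_inv, ← div_eq_mul_inv, ← one_div,
          div_le_div_iff₀ (by nlinarith) hp]
        have e : (1 + (w 0 : ℝ) ^ 2) * (1 + (w 1 : ℝ) ^ 2) =
          1 + normSq w + (w 0 : ℝ) ^ 2 * (w 1 : ℝ) ^ 2 := by unfold normSq; ring
        have e2 : (w 0 : ℝ) ^ 2 * (w 1 : ℝ) ^ 2 ≤ normSq w ^ 2 / 4 := by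
          unfold normSq
          nlinarith [sq_nonneg ((w 0 : ℝ) ^ 2 - (w 1 : ℝ) ^ 2)]
        rw [e]
        nlinarith
    _ ≤ ∑ w ∈ Fintype.piFinset fun _ : Fin 2 => A, 4 * ∏ k : Fin 2, (1 + (w k : ℝ) ^ 2)⁻¹ :=
        Finset.sum_le_sum_of_subset_of_nonneg hTA fun _ _ _ => by positivity
    _ = 4 * ((∑ n ∈ A, (1 + (n : ℝ) ^ 2)⁻¹) * ∑ n ∈ A, (1 + (n : ℝ) ^ 2)⁻¹) := by
        rw [← Finset.mul_sum, ← Finset.prod_univ_sum (fun _ : Fin 2 => A)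
          (fun _ n => (1 + (n : ℝ) ^ 2)⁻¹), Fin.prod_univ_two]
    _ ≤ 4 * (t * t) := by
        have := h1 A
        have h0 : 0 ≤ ∑ n ∈ A, (1 + (n : ℝ) ^ 2)⁻¹ := Finset.sum_nonneg fun _ _ => by positivity
        gcongr

end Planar

/-! ### Gaussian fields: Green function and exponential moments -/

section Gaussian

variable {d : ℕ}

theorem isInteraction_gaussian : IsInteraction gaussian where
  measurable := by unfold gaussian; fun_prop
  even t := by simp [gaussian]
  zero := by simp [gaussian]
  nonneg t := by unfold gaussian; positivity
  sub_le a b ha hb := by unfold gaussian; nlinarith [mul_nonneg ha hb]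
  lintegral_ne_top := by
    have h := integrable_exp_neg_mul_sq (b := 1 / 2) (by norm_num)
    have := (hasFiniteIntegral_iff_ofReal
        (Eventually.of_forall fun t => (Real.exp_pos _).le)).1 h.2 |>.ne
    convert this using 5 with t
    unfold gaussian
    ring

/-- The (positive) lattice Laplacian with zero boundary condition. -/
def dirichletLaplacian (D : Finset (Site d)) (ψ : Site d → ℝ) (x : Site d) : ℝ :=
  ∑ y ∈ neighbors x, (ψ x - truncate D ψ y)

/-- Completing the square: the cross term, summed by parts, is the pairing of `φ` with the Laplacian
of `ψ`. -/
theorem energy_gaussian_sub (D : Finset (Site d)) (φ ψ : Site d → ℝ) :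
    energy gaussian D (φ - ψ) = energy gaussian D φ -
      ∑ x ∈ D, φ x * dirichletLaplacian D ψ x + energy gaussian D ψ := by
  have h1 : ∑ x ∈ D, φ x * dirichletLaplacian D ψ x =
      ∑ x ∈ D, ∑ y ∈ neighbors x ∩ D, φ x * (ψ x - ψ y) +
        ∑ x ∈ D, ∑ _y ∈ neighbors x \ D, φ x * ψ x := by
    rw [← Finset.sum_add_distrib]
    refine Finset.sum_congr rfl fun x _ => ?_
    rw [dirichletLaplacian, Finset.mul_sum, ← Finset.sum_inter_add_sum_sdiff (neighbors x) D]
    congr 1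
    · refine Finset.sum_congr rfl fun y hy => ?_
      simp [truncate, (Finset.mem_inter.1 hy).2]
    · refine Finset.sum_congr rfl fun y hy => ?_
      simp [truncate, (Finset.mem_sdiff.1 hy).2]
  have h2 : ∑ x ∈ D, ∑ y ∈ neighbors x ∩ D, φ x * (ψ x - ψ y) =
      (1 / 2 : ℝ) * ∑ x ∈ D, ∑ y ∈ neighbors x ∩ D, (φ x - φ y) * (ψ x - ψ y) := by
    have h3 := sum_neighbors_inter_comm D fun x y => φ x * (ψ x - ψ y)
    have h4 : ∑ x ∈ D, ∑ y ∈ neighbors x ∩ D, (φ x - φ y) * (ψ x - ψ y) =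
        ∑ x ∈ D, ∑ y ∈ neighbors x ∩ D, φ x * (ψ x - ψ y) +
          ∑ x ∈ D, ∑ y ∈ neighbors x ∩ D, φ y * (ψ y - ψ x) := by
      simp only [← Finset.sum_add_distrib]
      refine Finset.sum_congr rfl fun x _ => Finset.sum_congr rfl fun y _ => ?_
      ring
    rw [h4, ← h3]
    ring
  have h5 : ∑ x ∈ D, ∑ y ∈ neighbors x ∩ D, gaussian ((φ - ψ) x - (φ - ψ) y) =
      ∑ x ∈ D, ∑ y ∈ neighbors x ∩ D, gaussian (φ x - φ y) -
        ∑ x ∈ D, ∑ y ∈ neighbors x ∩ D, (φ x - φ y) * (ψ x - ψ y) +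
          ∑ x ∈ D, ∑ y ∈ neighbors x ∩ D, gaussian (ψ x - ψ y) := by
    simp only [← Finset.sum_sub_distrib, ← Finset.sum_add_distrib]
    refine Finset.sum_congr rfl fun x _ => Finset.sum_congr rfl fun y _ => ?_
    simp only [gaussian, Pi.sub_apply]
    ring
  have h6 : ∑ x ∈ D, ∑ _y ∈ neighbors x \ D, gaussian ((φ - ψ) x) =
      ∑ x ∈ D, ∑ _y ∈ neighbors x \ D, gaussian (φ x) -
        ∑ x ∈ D, ∑ _y ∈ neighbors x \ D, φ x * ψ x +
          ∑ x ∈ D, ∑ _y ∈ neighbors x \ D, gaussian (ψ x) := by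
    simp only [← Finset.sum_sub_distrib, ← Finset.sum_add_distrib]
    refine Finset.sum_congr rfl fun x _ => Finset.sum_congr rfl fun y _ => ?_
    simp only [gaussian, Pi.sub_apply]
    ring
  rw [h1, h2, energy, h5, h6, energy, energy]
  ring

theorem energy_gaussian_eq (D : Finset (Site d)) (ψ : Site d → ℝ) :
    ∑ x ∈ D, ψ x * dirichletLaplacian D ψ x = 2 * energy gaussian D ψ := by
  have h := energy_gaussian_sub D ψ ψ
  rw [sub_self, energy_zero isInteraction_gaussian] at h
  linarith

theorem dirichletLaplacian_neg (D : Finset (Site d)) (ψ : Site d → ℝ) (x : Site d) :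
    dirichletLaplacian D (-ψ) x = -dirichletLaplacian D ψ x := by
  unfold dirichletLaplacian
  rw [← Finset.sum_neg_distrib]
  refine Finset.sum_congr rfl fun y _ => ?_
  simp only [truncate, Pi.neg_apply]
  split_ifs <;> ring

theorem energy_gaussian_neg (D : Finset (Site d)) (ψ : Site d → ℝ) :
    energy gaussian D (-ψ) = energy gaussian D ψ := by
  have h1 := energy_gaussian_eq D (-ψ)
  have h2 := energy_gaussian_eq D ψ
  simp only [dirichletLaplacian_neg, Pi.neg_apply, neg_mul_neg] at h1
  linarith

theorem energyBound_truncate (D : Finset (Site d)) (φ : Site d → ℝ) :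
    EnergyBound (truncate D φ) (4 * energy gaussian D φ) := by
  intro S
  have hS : D ⊆ S ∪ closure D := (subset_closure D).trans Finset.subset_union_right
  rw [energy_eq_sum isInteraction_gaussian D (S ∪ closure D) hS
    fun x hx => (neighbors_subset_closure D x hx).trans Finset.subset_union_right]
  calc ∑ x ∈ S, ∑ y ∈ neighbors x, (truncate D φ x - truncate D φ y) ^ 2
      ≤ ∑ x ∈ S ∪ closure D, ∑ y ∈ neighbors x, (truncate D φ x - truncate D φ y) ^ 2 :=
        Finset.sum_le_sum_of_subset_of_nonneg Finset.subset_union_left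
          fun _ _ _ => Finset.sum_nonneg fun _ _ => sq_nonneg _
    _ = _ := by
        rw [← mul_assoc, Finset.mul_sum]
        refine Finset.sum_congr rfl fun x _ => ?_
        rw [Finset.mul_sum]
        refine Finset.sum_congr rfl fun y _ => ?_
        unfold gaussian
        ring

/-- Pinning a planar Gaussian field at one site bounds its variance at distance `r` by a multiple
of `log r`. -/
theorem sq_le_logProfile_mul_energy {κ : ℝ} (hκ : 1 ≤ κ) {D : Finset (Site 2)} {o z : Site 2}
    (ho : o ∉ D) (hz : z ∈ D) (φ : Site 2 → ℝ) :
    φ z ^ 2 ≤ 256 * logProfile κ (z - o) * energy gaussian D φ := by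
  have hzo : z - o ≠ 0 := by
    intro h
    rw [sub_eq_zero] at h
    exact ho (h ▸ hz)
  have h := sub_sq_le_harmonic_add (energyBound_truncate D φ) o z
  have h2 := harmonic_add_le_logProfile hκ hzo
  have hE := energy_nonneg isInteraction_gaussian D φ
  have ez : truncate D φ z = φ z := by simp [truncate, hz]
  have eo : truncate D φ o = 0 := by simp [truncate, ho]
  rw [ez, eo, sub_zero] at h
  refine h.trans ?_
  nlinarith

/-- Pairing `g` with its Laplacian gives `g z = 2 * energy g`, so the bound of `g z ^ 2` by the
energy becomes a bound on the energy, that is, on the variance at `z`. -/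
theorem exists_green (D : Finset (Site 2)) {o z : Site 2} (ho : o ∉ D) (hz : z ∈ D) {κ : ℝ}
    (hκ : 1 ≤ κ) :
    ∃ g : Site 2 → ℝ, (∀ x ∈ D, dirichletLaplacian D g x = if x = z then 1 else 0) ∧
      2 * energy gaussian D g ≤ 128 * logProfile κ (z - o) := by
  let ext : (D → ℝ) → Site 2 → ℝ := fun h x => if hx : x ∈ D then h ⟨x, hx⟩ else 0
  have hext : ∀ (h : D → ℝ) (x : D), ext h x = h x := fun h x => by simp [ext]
  let T : (D → ℝ) →ₗ[ℝ] (D → ℝ) :=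
    { toFun := fun h x => dirichletLaplacian D (ext h) x
      map_add' := by
        intro h k
        funext x
        simp only [dirichletLaplacian, Pi.add_apply, ← Finset.sum_add_distrib]
        refine Finset.sum_congr rfl fun y _ => ?_
        rw [hext, hext, hext]
        by_cases hy : y ∈ D
        · simp only [truncate, ext, hy, if_true, dif_pos, Pi.add_apply]; ring
        · simp only [truncate, hy, if_false, Pi.add_apply]; ring
      map_smul' := by
        intro c h
        funext x
        simp only [dirichletLaplacian, Pi.smul_apply, smul_eq_mul, RingHom.id_apply,
          Finset.mul_sum]
        refine Finset.sum_congr rfl fun y _ => ?_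
        rw [hext, hext]
        by_cases hy : y ∈ D
        · simp only [truncate, ext, hy, if_true, dif_pos, Pi.smul_apply, smul_eq_mul]; ring
        · simp only [truncate, hy, if_false, Pi.smul_apply, smul_eq_mul]; ring }
  -- A field with zero Laplacian has zero energy, hence vanishes since `o ∉ D` acts as a pinned
  -- point. In finite dimension injectivity gives surjectivity.
  have hinj : Injective T := by
    rw [injective_iff_map_eq_zero]
    intro h hh
    have hE : energy gaussian D (ext h) = 0 := by
      have := energy_gaussian_eq D (ext h)
      rw [Finset.sum_eq_zero] at this
      · linarith
      · intro x hx
        have := congrFun hh ⟨x, hx⟩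
        simp only [T, LinearMap.coe_mk, AddHom.coe_mk, Pi.zero_apply] at this
        rw [this, mul_zero]
    funext x
    have := sq_le_logProfile_mul_energy hκ ho x.2 (ext h)
    rw [hE, mul_zero, hext] at this
    simpa using le_antisymm this (sq_nonneg _)
  obtain ⟨h, hh⟩ := (LinearMap.injective_iff_surjective.1 hinj)
    (fun x => if (x : Site 2) = z then 1 else 0)
  have hlap : ∀ x ∈ D, dirichletLaplacian D (ext h) x = if x = z then 1 else 0 :=
    fun x hx => congrFun hh ⟨x, hx⟩
  refine ⟨ext h, hlap, ?_⟩
  have h1 := energy_gaussian_eq D (ext h)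
  rw [Finset.sum_congr rfl fun x hx => by rw [hlap x hx]] at h1
  simp only [mul_ite, mul_one, mul_zero, Finset.sum_ite_eq', hz, if_true] at h1
  have h2 := sq_le_logProfile_mul_energy hκ ho hz (ext h)
  have h3 := energy_nonneg isInteraction_gaussian D (ext h)
  have h4 := logProfile_nonneg (by linarith : 0 ≤ κ) (z - o)
  rw [h1] at h2
  rcases h3.eq_or_lt with h5 | h5
  · rw [← h5]; linarith
  · nlinarith

theorem lmarginal_volume_sub (D : Finset (Site d)) (b : Site d → ℝ) {F : (Site d → ℝ) → ℝ≥0∞}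
    (hF : ∀ φ ψ : Site d → ℝ, (∀ x ∈ D, φ x = ψ x) → F φ = F ψ) :
    lmarginal (fun _ => (volume : Measure ℝ)) D (fun φ => F (φ - b)) 0 =
      lmarginal (fun _ => (volume : Measure ℝ)) D F 0 := by
  unfold lmarginal
  have := lintegral_sub_right_eq_self (μ := Measure.pi fun _ : D => (volume : Measure ℝ))
    (fun y : D → ℝ => F (updateFinset 0 D y)) (fun x => b x)
  rw [← this]
  refine lintegral_congr fun y => hF _ _ fun x hx => ?_
  simp [updateFinset, hx]

/-- Change of variables by a translation in a Gaussian integral. -/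
theorem lmarginal_gaussian_tilt (D : Finset (Site d)) (b : Site d → ℝ)
    {F : (Site d → ℝ) → ℝ≥0∞} (hFm : Measurable F)
    (hF : ∀ φ ψ : Site d → ℝ, (∀ x ∈ D, φ x = ψ x) → F φ = F ψ) :
    lmarginal (fun _ => (volume : Measure ℝ)) D (fun φ =>
        ENNReal.ofReal (Real.exp (∑ x ∈ D, φ x * dirichletLaplacian D b x)) *
          (F φ * weight gaussian D φ)) 0 =
      ENNReal.ofReal (Real.exp (energy gaussian D b)) *
        lmarginal (fun _ => (volume : Measure ℝ)) D
          (fun φ => F (φ + b) * weight gaussian D φ) 0 := by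
  have hw := measurable_weight isInteraction_gaussian.measurable D
  rw [← lmarginal_volume_sub D b (F := fun φ => F (φ + b) * weight gaussian D φ)]
  · refine lmarginal_const_mul _ _ _ _ _ ?_ fun φ _ => ?_
    · have hs : Measurable fun φ : Site d → ℝ => φ - b := measurable_id.sub_const b
      exact (hFm.comp (hs.add_const b)).mul (hw.comp hs)
    · rw [sub_add_cancel, weight, weight, energy_gaussian_sub, mul_left_comm,
        mul_left_comm _ (F φ), ← ENNReal.ofReal_mul (Real.exp_pos _).le,
        ← ENNReal.ofReal_mul (Real.exp_pos _).le, ← Real.exp_add, ← Real.exp_add]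
      congr 3
      ring
  · intro φ ψ h
    rw [hF (φ + b) (ψ + b) fun x hx => by simp [h x hx], weight_congr D h]

/-- Tilting by `s * φ z` is translation by `s` times the Green function, whose energy is half the
variance. -/
theorem lmarginal_exp_le (D : Finset (Site 2)) {o z : Site 2} (ho : o ∉ D) (hz : z ∈ D) {κ : ℝ}
    (hκ : 1 ≤ κ) {s : ℝ} (hs : s = 1 ∨ s = -1) :
    lmarginal (fun _ => (volume : Measure ℝ)) D
        (fun φ => ENNReal.ofReal (Real.exp (s * φ z)) * weight gaussian D φ) 0 ≤
      ENNReal.ofReal (Real.exp (64 * logProfile κ (z - o))) * partitionOn gaussian volume D := by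
  obtain ⟨g, hg, hgE⟩ := exists_green D ho hz hκ
  have key : ∀ b : Site 2 → ℝ, (∀ x ∈ D, dirichletLaplacian D b x = if x = z then s else 0) →
      energy gaussian D b = energy gaussian D g →
      lmarginal (fun _ => (volume : Measure ℝ)) D
        (fun φ => ENNReal.ofReal (Real.exp (s * φ z)) * weight gaussian D φ) 0 ≤
      ENNReal.ofReal (Real.exp (64 * logProfile κ (z - o))) * partitionOn gaussian volume D := by
    intro b hb hbE
    have h := lmarginal_gaussian_tilt D b (F := fun _ => 1) measurable_const fun _ _ _ => rfl
    simp only [one_mul] at h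
    have e : ∀ φ : Site 2 → ℝ, ∑ x ∈ D, φ x * dirichletLaplacian D b x = s * φ z := by
      intro φ
      rw [Finset.sum_congr rfl fun x hx => by rw [hb x hx]]
      simp only [mul_ite, mul_zero, Finset.sum_ite_eq', hz, if_true]
      ring
    simp only [e] at h
    rw [h, hbE]
    refine mul_le_mul_left (ENNReal.ofReal_le_ofReal (Real.exp_le_exp.2 ?_)) _
    linarith
  rcases hs with rfl | rfl
  · exact key g hg rfl
  · refine key (-g) (fun x hx => ?_) (energy_gaussian_neg D g)
    rw [dirichletLaplacian_neg, hg x hx]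
    split_ifs <;> simp

end Gaussian

/-! ### Mean height next to a pinned site -/

section Repulsion

variable {d : ℕ}

theorem lmarginal_add {δ : Type*} [DecidableEq δ] {μ : Measure ℝ} [SigmaFinite μ] (s : Finset δ)
    (f g : (δ → ℝ) → ℝ≥0∞) (hf : Measurable f) (x : δ → ℝ) :
    lmarginal (fun _ => μ) s (fun φ => f φ + g φ) x =
      lmarginal (fun _ => μ) s f x + lmarginal (fun _ => μ) s g x :=
  lintegral_add_left (hf.comp measurable_updateFinset) _

theorem lmarginal_sum {δ ι : Type*} [DecidableEq δ] {μ : Measure ℝ} [SigmaFinite μ]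
    (s : Finset δ) (T : Finset ι) (f : ι → (δ → ℝ) → ℝ≥0∞) (hf : ∀ i ∈ T, Measurable (f i))
    (x : δ → ℝ) :
    lmarginal (fun _ => μ) s (fun φ => ∑ i ∈ T, f i φ) x =
      ∑ i ∈ T, lmarginal (fun _ => μ) s (f i) x :=
  lintegral_finsetSum T fun i hi => (hf i hi).comp measurable_updateFinset

/-- The indicator of the positive heights. -/
def posIndicator (t : ℝ) : ℝ≥0∞ := if 0 < t then 1 else 0

theorem measurable_posIndicator : Measurable posIndicator :=
  Measurable.ite measurableSet_Ioi measurable_const measurable_const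

theorem monotone_posIndicator : Monotone posIndicator := by
  intro a b hab
  unfold posIndicator
  split_ifs with h1 h2
  · exact le_rfl
  · exact absurd (h1.trans_le hab) h2
  · exact zero_le
  · exact le_rfl

/-- Positivity excludes the atom at zero; this is why the final bounds do not depend on `ε`. -/
theorem lmarginal_posIndicator (ε : ℝ) (D : Finset (Site d)) {F : (Site d → ℝ) → ℝ≥0∞}
    (hF : Measurable F) (x : Site d → ℝ) :
    lmarginal (fun _ => siteMeasure ε) D (fun φ => (∏ i ∈ D, posIndicator (φ i)) * F φ) x =
      lmarginal (fun _ => (volume : Measure ℝ)) D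
        (fun φ => (∏ i ∈ D, posIndicator (φ i)) * F φ) x := by
  have hind : ∀ f : ℝ → ℝ≥0∞, (fun t => posIndicator t * f t) = (Set.Ioi 0).indicator f := by
    intro f
    funext t
    by_cases ht : 0 < t
    · rw [Set.indicator_of_mem (Set.mem_Ioi.2 ht), posIndicator, if_pos ht, one_mul]
    · rw [Set.indicator_of_notMem (by simpa using ht), posIndicator, if_neg ht, zero_mul]
  have h1 := lmarginal_site_change (μ := siteMeasure ε)
    (ν := (volume : Measure ℝ).restrict (Set.Ioi 0)) measurable_posIndicator measurable_id
    (fun f _ => by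
      simp only [id, hind]
      rw [lintegral_siteMeasure, Set.indicator_of_notMem (by simp), mul_zero, add_zero,
        setLIntegral_indicator measurableSet_Ioi, Set.inter_eq_left.2 Set.Ioi_subset_Ici_self])
    D F hF x
  have h2 := lmarginal_site_change (μ := (volume : Measure ℝ))
    (ν := (volume : Measure ℝ).restrict (Set.Ioi 0)) measurable_posIndicator measurable_id
    (fun f _ => by
      simp only [id, hind]
      rw [lintegral_indicator measurableSet_Ioi]) D F hF x
  simp only [id, ite_self] at h1 h2
  rw [← h1, h2]

/-- If `φ` and `ψ` are ordered oppositely at the two ends of a bond, taking maximum and minimum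
decreases the sum of the squared gradients; otherwise nothing changes. -/
theorem weight_gaussian_supermodular (D : Finset (Site d)) (φ ψ : Site d → ℝ) :
    weight gaussian D φ * weight gaussian D ψ ≤
      weight gaussian D (φ ⊔ ψ) * weight gaussian D (φ ⊓ ψ) := by
  unfold weight
  rw [← ENNReal.ofReal_mul (Real.exp_pos _).le, ← ENNReal.ofReal_mul (Real.exp_pos _).le,
    ← Real.exp_add, ← Real.exp_add]
  refine ENNReal.ofReal_le_ofReal (Real.exp_le_exp.2 ?_)
  have h1 : ∑ x ∈ D, ∑ y ∈ neighbors x ∩ D, gaussian ((φ ⊔ ψ) x - (φ ⊔ ψ) y) +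
      ∑ x ∈ D, ∑ y ∈ neighbors x ∩ D, gaussian ((φ ⊓ ψ) x - (φ ⊓ ψ) y) ≤
      ∑ x ∈ D, ∑ y ∈ neighbors x ∩ D, gaussian (φ x - φ y) +
        ∑ x ∈ D, ∑ y ∈ neighbors x ∩ D, gaussian (ψ x - ψ y) := by
    simp only [← Finset.sum_add_distrib]
    refine Finset.sum_le_sum fun x _ => Finset.sum_le_sum fun y _ => ?_
    simp only [gaussian, Pi.sup_apply, Pi.inf_apply]
    rcases le_total (φ x) (ψ x) with h | h <;> rcases le_total (φ y) (ψ y) with h' | h' <;>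
      simp only [h, h', sup_of_le_left, sup_of_le_right, inf_of_le_left, inf_of_le_right] <;>
      nlinarith [mul_nonneg (sub_nonneg.2 h) (sub_nonneg.2 h')]
  have h2 : ∑ x ∈ D, ∑ _y ∈ neighbors x \ D, gaussian ((φ ⊔ ψ) x) +
      ∑ x ∈ D, ∑ _y ∈ neighbors x \ D, gaussian ((φ ⊓ ψ) x) ≤
      ∑ x ∈ D, ∑ _y ∈ neighbors x \ D, gaussian (φ x) +
        ∑ x ∈ D, ∑ _y ∈ neighbors x \ D, gaussian (ψ x) := by
    simp only [← Finset.sum_add_distrib]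
    refine Finset.sum_le_sum fun x _ => Finset.sum_le_sum fun y _ => ?_
    simp only [Pi.sup_apply, Pi.inf_apply]
    rcases le_total (φ x) (ψ x) with h | h <;>
      simp only [h, sup_of_le_left, sup_of_le_right, inf_of_le_left, inf_of_le_right] <;>
      linarith
  unfold energy
  linarith

/-- A Gaussian field pinned at `o` and raised by a large multiple of the logarithmic profile is
positive with probability at least `1 / 2`. -/
theorem partitionOn_volume_le_two_mul (D : Finset (Site 2)) {o : Site 2} (ho : o ∉ D) {κ S : ℝ}
    (hκ : 1 ≤ κ) (hS : ∀ T : Finset (Site 2), 0 ∉ T →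
      ∑ w ∈ T, ((4 * normSq w - 3) ^ 2)⁻¹ ≤ S)
    (hκS : Real.exp (-(2 * κ)) * S ≤ 1 / 2) :
    partitionOn gaussian volume D ≤ 2 * lmarginal (fun _ => (volume : Measure ℝ)) D
      (fun φ => (∏ x ∈ D, posIndicator (φ x + 66 * logProfile κ (x - o))) *
        weight gaussian D φ) 0 := by
  set a : Site 2 → ℝ := fun x => 66 * logProfile κ (x - o) with ha
  set Z := partitionOn gaussian volume D with hZ
  have hZt : Z ≠ ⊤ := partitionOn_volume_ne_top (by norm_num) isInteraction_gaussian D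
  have hw := measurable_weight (d := 2) isInteraction_gaussian.measurable D
  have hpm : Measurable fun φ : Site 2 → ℝ => ∏ x ∈ D, posIndicator (φ x + a x) :=
    Finset.measurable_prod _ fun x _ =>
      measurable_posIndicator.comp ((measurable_pi_apply x).add_const _)
  have hem : ∀ x : Site 2, Measurable fun φ : Site 2 → ℝ =>
      ENNReal.ofReal (Real.exp (-1 * φ x)) * weight gaussian D φ := fun x =>
    ((measurable_pi_apply x).const_mul (-1)).exp.ennreal_ofReal.mul hw
  -- Union bound: if positivity fails at `x`, then `exp(-a x - φ x) ≥ 1`.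
  have h1 : Z ≤ lmarginal (fun _ => (volume : Measure ℝ)) D (fun φ =>
      (∏ x ∈ D, posIndicator (φ x + a x)) * weight gaussian D φ +
        ∑ x ∈ D, ENNReal.ofReal (Real.exp (-a x)) *
          (ENNReal.ofReal (Real.exp (-1 * φ x)) * weight gaussian D φ)) 0 := by
    refine lmarginal_mono (fun φ => ?_) 0
    by_cases hpos : ∀ x ∈ D, 0 < φ x + a x
    · rw [Finset.prod_eq_one fun x hx => by rw [posIndicator, if_pos (hpos x hx)], one_mul]
      exact self_le_add_right _ _
    · push Not at hpos
      obtain ⟨x, hx, hle⟩ := hpos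
      refine le_trans ?_ (self_le_add_left _ _)
      refine le_trans ?_ (Finset.single_le_sum (fun _ _ => zero_le) hx)
      rw [← mul_assoc, ← ENNReal.ofReal_mul (Real.exp_pos _).le, ← Real.exp_add]
      refine le_mul_of_one_le_left zero_le ?_
      rw [← ENNReal.ofReal_one]
      exact ENNReal.ofReal_le_ofReal (Real.one_le_exp (by linarith))
  have hpw : Measurable fun φ : Site 2 → ℝ =>
      (∏ x ∈ D, posIndicator (φ x + a x)) * weight gaussian D φ := hpm.mul hw
  rw [lmarginal_add _ _ _ hpw, lmarginal_sum _ _ _ fun x _ => (hem x).const_mul _] at h1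
  have h2 : ∑ x ∈ D, lmarginal (fun _ => (volume : Measure ℝ)) D (fun φ =>
      ENNReal.ofReal (Real.exp (-a x)) *
          (ENNReal.ofReal (Real.exp (-1 * φ x)) * weight gaussian D φ)) 0 ≤
      ENNReal.ofReal (1 / 2) * Z := by
    calc _ ≤ ∑ x ∈ D, ENNReal.ofReal (Real.exp (-(2 * κ)) *
              ((4 * normSq (x - o) - 3) ^ 2)⁻¹) * Z := by
          refine Finset.sum_le_sum fun x hx => ?_
          have hxo : x - o ≠ 0 := by
            intro h
            rw [sub_eq_zero] at h
            exact ho (h ▸ hx)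
          rw [lmarginal_const_mul (hg := hem x) (h := fun _ _ => rfl)]
          refine (mul_le_mul_right (lmarginal_exp_le D ho hx hκ (Or.inr rfl)) _).trans ?_
          rw [← mul_assoc, ← ENNReal.ofReal_mul (Real.exp_pos _).le, ← Real.exp_add]
          refine mul_le_mul_left (ENNReal.ofReal_le_ofReal (le_of_eq ?_)) _
          have hn := one_le_normSq hxo
          have hp : 0 < 4 * normSq (x - o) - 3 := by linarith
          -- The factor `66` is `64 + 2`: `64` pays for the exponential moment and `2` leaves a
          -- summable error with small prefactor `exp(-2κ)`.
          have : -a x + 64 * logProfile κ (x - o) =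
              -(2 * κ) + -(Real.log (4 * normSq (x - o) - 3) * 2) := by
            simp only [ha, logProfile, hxo, if_false]
            ring
          rw [this, Real.exp_add, Real.exp_neg (_ * 2), Real.exp_mul, Real.exp_log hp]
          norm_num
      _ = ENNReal.ofReal (∑ x ∈ D, Real.exp (-(2 * κ)) *
              ((4 * normSq (x - o) - 3) ^ 2)⁻¹) * Z := by
          rw [ENNReal.ofReal_sum_of_nonneg fun x _ => by positivity, Finset.sum_mul]
      _ ≤ _ := by
          refine mul_le_mul_left (ENNReal.ofReal_le_ofReal ?_) _
          rw [← Finset.mul_sum]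
          refine le_trans (mul_le_mul_of_nonneg_left ?_ (Real.exp_pos _).le) hκS
          have := hS (D.image fun x => x - o) (by
            intro h
            obtain ⟨x, hx, hxo⟩ := Finset.mem_image.1 h
            rw [sub_eq_zero] at hxo
            exact ho (hxo ▸ hx))
          rwa [Finset.sum_image (by intro p _ q _ h; simpa using h)] at this
  have h3 := h1.trans (add_le_add le_rfl h2)
  set A := lmarginal (fun _ => (volume : Measure ℝ)) D
      (fun φ => (∏ x ∈ D, posIndicator (φ x + a x)) * weight gaussian D φ) 0
  have hhalf : ENNReal.ofReal (1 / 2) * Z + ENNReal.ofReal (1 / 2) * Z = Z := by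
    rw [← add_mul, ← ENNReal.ofReal_add (by norm_num) (by norm_num)]
    norm_num
  have h4 : ENNReal.ofReal (1 / 2) * Z ≤ A := by
    refine (ENNReal.add_le_add_iff_right
      (ENNReal.mul_ne_top ENNReal.ofReal_ne_top hZt : ENNReal.ofReal (1 / 2) * Z ≠ ⊤)).1 ?_
    rw [hhalf]
    exact h3
  calc Z = ENNReal.ofReal (1 / 2) * Z + ENNReal.ofReal (1 / 2) * Z := hhalf.symm
    _ ≤ A + A := add_le_add h4 h4
    _ = 2 * A := (two_mul A).symm

/-- The profile is superharmonic off `o ∉ D`, and setting it to zero outside `D` only raises the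
Laplacian because the profile is nonnegative. -/
theorem dirichletLaplacian_logProfile_nonneg {D : Finset (Site 2)} {o : Site 2} (ho : o ∉ D)
    {κ : ℝ} (hκ0 : 0 ≤ κ) (hκ : Real.log 325 ≤ κ) {x : Site 2} (hx : x ∈ D) :
    0 ≤ dirichletLaplacian D (fun z => 66 * logProfile κ (z - o)) x := by
  have hxo : x - o ≠ 0 := by
    intro h
    rw [sub_eq_zero] at h
    exact ho (h ▸ hx)
  have h := logProfile_superharmonic hκ hxo
  have h1 : ∑ y ∈ neighbors x, logProfile κ (y - o) ≤ 4 * logProfile κ (x - o) := by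
    refine le_trans (le_of_eq ?_) h
    rw [sub_eq_add_neg, sum_neighbors_add]
    simp only [sub_eq_add_neg]
  unfold dirichletLaplacian
  rw [Finset.sum_sub_distrib]
  have h2 : ∑ y ∈ neighbors x, truncate D (fun z => 66 * logProfile κ (z - o)) y ≤
      66 * ∑ y ∈ neighbors x, logProfile κ (y - o) := by
    rw [Finset.mul_sum]
    refine Finset.sum_le_sum fun y _ => ?_
    unfold truncate
    split_ifs
    · exact le_rfl
    · exact mul_nonneg (by norm_num) (logProfile_nonneg hκ0 _)
  have h3 : ∑ _y ∈ neighbors x, 66 * logProfile κ (x - o) = 4 * (66 * logProfile κ (x - o)) := by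
    rw [sum_neighbors_two]
    ring
  rw [h3]
  linarith

/-- In the plane a height next to a pinned site has bounded mean, uniformly in the region and in
the pinning strength. -/
theorem exists_mean_height_bound : ∃ C : ℝ, 0 ≤ C ∧ ∀ (ε : ℝ) (D : Finset (Site 2))
    (o y : Site 2), o ∉ D → y ∈ D → y ∈ neighbors o →
    lmarginal (fun _ => siteMeasure ε) D
        (fun φ => ENNReal.ofReal (φ y) * weight gaussian D φ) 0 ≤
      ENNReal.ofReal C * partitionOn gaussian (siteMeasure ε) D := by
  obtain ⟨S, hS0, hS⟩ := exists_sum_logProfile_bound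
  obtain ⟨κ, hκ1, hκ2, hκS⟩ : ∃ κ : ℝ, 1 ≤ κ ∧ Real.log 325 ≤ κ ∧
      Real.exp (-(2 * κ)) * S ≤ 1 / 2 := by
    -- Since `κ ≥ S`, one has `exp(2κ) ≥ 1 + 2κ ≥ 2S`.
    refine ⟨max 1 (max (Real.log 325) S), le_max_left _ _,
      (le_max_left _ _).trans (le_max_right _ _), ?_⟩
    set κ := max 1 (max (Real.log 325) S)
    have h1 : S ≤ κ := (le_max_right _ _).trans (le_max_right _ _)
    have h2 := Real.add_one_le_exp (2 * κ)
    have h3 : 0 < Real.exp (2 * κ) := Real.exp_pos _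
    rw [Real.exp_neg, inv_mul_le_iff₀ h3]
    linarith
  set C₁ : ℝ := 2 * Real.exp (64 * κ) + 66 * κ with hC₁
  have hC₁0 : 0 ≤ C₁ := by positivity
  refine ⟨2 * C₁, by positivity, fun ε D o y ho hy hyo => ?_⟩
  set a : Site 2 → ℝ := fun z => 66 * logProfile κ (z - o) with ha
  set q : Site 2 → ℝ := dirichletLaplacian D a with hq
  have hq0 : ∀ x ∈ D, 0 ≤ q x := fun x hx =>
    dirichletLaplacian_logProfile_nonneg ho (by linarith) hκ2 hx
  have hlog : logProfile κ (y - o) = κ := by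
    have hne : y - o ≠ 0 := by
      intro h
      rw [sub_eq_zero] at h
      exact ho (h ▸ hy)
    have hn : normSq (y - o) = 1 := by
      obtain ⟨i, rfl | rfl⟩ := mem_neighbors_iff.1 hyo <;> fin_cases i <;> simp [normSq]
    rw [logProfile, if_neg hne, hn]
    norm_num
  have hw := measurable_weight (d := 2) isInteraction_gaussian.measurable D
  have hy' : Measurable fun φ : Site 2 → ℝ => φ y := measurable_pi_apply y
  set pos : (Site 2 → ℝ) → ℝ≥0∞ := fun φ => ∏ x ∈ D, posIndicator (φ x) with hpos
  set tilt : (Site 2 → ℝ) → ℝ≥0∞ := fun φ => ENNReal.ofReal (Real.exp (∑ x ∈ D, φ x * q x))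
    with htilt
  have hposm : Measurable pos := Finset.measurable_prod _ fun x _ =>
    measurable_posIndicator.comp (measurable_pi_apply x)
  have htiltm : Measurable tilt := (Finset.measurable_sum _ fun x _ =>
    (measurable_pi_apply x).mul_const _).exp.ennreal_ofReal
  have hposc : ∀ φ ψ : Site 2 → ℝ, (∀ x ∈ D, φ x = ψ x) → pos φ = pos ψ := fun φ ψ h =>
    Finset.prod_congr rfl fun x hx => by rw [h x hx]
  have hfm : Measurable fun φ : Site 2 → ℝ => ENNReal.ofReal (φ y) := hy'.ennreal_ofReal
  -- The tilt is increasing because `q ≥ 0` on `D`. Hence the mean of `φ y` is at most its mean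
  -- after conditioning on positivity and tilting.
  have fkg := fkg_lmarginal (siteMeasure ε) D (weight gaussian D)
    (fun φ => ENNReal.ofReal (φ y)) (fun φ => pos φ * tilt φ) hw hfm (hposm.mul htiltm)
    (fun φ ψ h => ENNReal.ofReal_le_ofReal (h y))
    (fun φ ψ h => mul_le_mul' (Finset.prod_le_prod' fun x _ => monotone_posIndicator (h x))
      (ENNReal.ofReal_le_ofReal (Real.exp_le_exp.2 (Finset.sum_le_sum fun x hx =>
        mul_le_mul_of_nonneg_right (h x) (hq0 x hx)))))
    (weight_gaussian_supermodular D) 0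
  set Z := partitionOn gaussian volume D with hZ
  have hZt : Z ≠ ⊤ := partitionOn_volume_ne_top (by norm_num) isInteraction_gaussian D
  have hZ0 : Z ≠ 0 := partitionOn_ne_zero isInteraction_gaussian
    (by
      intro h
      have := congrArg (fun ν => ν Set.univ) h
      simp at this) D
  set e := ENNReal.ofReal (Real.exp (energy gaussian D a)) with he
  have he0 : e ≠ 0 := by rw [he]; simpa using Real.exp_pos _
  have het : e ≠ ⊤ := ENNReal.ofReal_ne_top
  set P := lmarginal (fun _ => (volume : Measure ℝ)) D
      (fun φ => (∏ x ∈ D, posIndicator (φ x + a x)) * weight gaussian D φ) 0 with hP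
  have hhalf : Z ≤ 2 * P := partitionOn_volume_le_two_mul D ho hκ1 hS hκS
  have hP0 : P ≠ 0 := by
    intro h
    rw [h, mul_zero] at hhalf
    exact hZ0 (le_antisymm hhalf zero_le)
  have hPt : P ≠ ⊤ := by
    refine ne_top_of_le_ne_top hZt (lmarginal_mono (fun φ => ?_) 0)
    refine mul_le_of_le_one_left zero_le (Finset.prod_le_one' fun x _ => ?_)
    unfold posIndicator
    split_ifs <;> simp
  -- The tilt becomes a translation by `a` in a Gaussian integral. Its constant `e` also appears in
  -- `hB` and cancels.
  have hA : lmarginal (fun _ => siteMeasure ε) D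
      (fun φ => pos φ * tilt φ * weight gaussian D φ) 0 = e * P := by
    have htw : Measurable fun φ : Site 2 → ℝ => tilt φ * weight gaussian D φ := htiltm.mul hw
    simp only [mul_assoc, hpos]
    rw [lmarginal_posIndicator ε D htw]
    refine Eq.trans ?_ (lmarginal_gaussian_tilt D a hposm hposc)
    congr 1
    funext φ
    exact mul_left_comm _ _ _
  have hB : lmarginal (fun _ => siteMeasure ε) D
      (fun φ => ENNReal.ofReal (φ y) * (pos φ * tilt φ) * weight gaussian D φ) 0 ≤
      e * (ENNReal.ofReal C₁ * Z) := by
    have e1 : (fun φ : Site 2 → ℝ => ENNReal.ofReal (φ y) * (pos φ * tilt φ) *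
        weight gaussian D φ) = fun φ => (∏ i ∈ D, posIndicator (φ i)) *
          (ENNReal.ofReal (φ y) * (tilt φ * weight gaussian D φ)) := by
      funext φ
      simp only [hpos]
      ring
    have hftw : Measurable fun φ : Site 2 → ℝ =>
        ENNReal.ofReal (φ y) * (tilt φ * weight gaussian D φ) := hfm.mul (htiltm.mul hw)
    rw [e1, lmarginal_posIndicator ε D hftw]
    have h1 := lmarginal_gaussian_tilt D a (F := fun φ => pos φ * ENNReal.ofReal (φ y))
      (hposm.mul hfm) (fun φ ψ h => by rw [hposc φ ψ h, h y hy])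
    have e2 : (fun φ : Site 2 → ℝ => (∏ i ∈ D, posIndicator (φ i)) *
          (ENNReal.ofReal (φ y) * (tilt φ * weight gaussian D φ))) =
        fun φ => ENNReal.ofReal (Real.exp (∑ x ∈ D, φ x * dirichletLaplacian D a x)) *
          (pos φ * ENNReal.ofReal (φ y) * weight gaussian D φ) := by
      funext φ
      simp only [hpos, htilt, hq]
      ring
    rw [e2, h1]
    refine mul_le_mul_right ?_ _
    have hem : ∀ s : ℝ, Measurable fun φ : Site 2 → ℝ =>
        ENNReal.ofReal (Real.exp (s * φ y)) * weight gaussian D φ := fun s =>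
      (hy'.const_mul s).exp.ennreal_ofReal.mul hw
    -- The positivity indicator is dropped and `φ y + a y`, where `a y = 66 * κ`, is bounded through
    -- the exponential moments of `φ y`.
    calc _ ≤ lmarginal (fun _ => (volume : Measure ℝ)) D (fun φ =>
          ENNReal.ofReal (Real.exp (1 * φ y)) * weight gaussian D φ +
          (ENNReal.ofReal (Real.exp (-1 * φ y)) * weight gaussian D φ +
          ENNReal.ofReal (66 * κ) * weight gaussian D φ)) 0 := by
          refine lmarginal_mono (fun φ => ?_) 0
          simp only
          rw [← add_mul, ← add_mul, ← ENNReal.ofReal_add (Real.exp_pos _).le (by positivity),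
            ← ENNReal.ofReal_add (Real.exp_pos _).le (by positivity)]
          refine mul_le_mul_left ?_ _
          refine (mul_le_of_le_one_left zero_le (Finset.prod_le_one' fun x _ => ?_)).trans
            (ENNReal.ofReal_le_ofReal ?_)
          · unfold posIndicator
            split_ifs <;> simp
          · simp only [Pi.add_apply, ha, hlog]
            have := Real.add_one_le_exp (1 * φ y)
            have := Real.exp_pos (-1 * φ y)
            linarith
      _ ≤ ENNReal.ofReal (Real.exp (64 * κ)) * Z + (ENNReal.ofReal (Real.exp (64 * κ)) * Z +
          ENNReal.ofReal (66 * κ) * Z) := by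
          rw [lmarginal_add _ _ _ (hem 1), lmarginal_add _ _ _ (hem (-1)),
            lmarginal_const_mul (hg := hw) (h := fun _ _ => rfl)]
          have h1 := lmarginal_exp_le D ho hy hκ1 (s := 1) (Or.inl rfl)
          have h2 := lmarginal_exp_le D ho hy hκ1 (s := -1) (Or.inr rfl)
          rw [hlog] at h1 h2
          exact add_le_add h1 (add_le_add h2 le_rfl)
      _ = ENNReal.ofReal C₁ * Z := by
          rw [← add_mul, ← add_mul, ← ENNReal.ofReal_add (Real.exp_pos _).le (by positivity),
            ← ENNReal.ofReal_add (Real.exp_pos _).le (by positivity), hC₁]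
          congr 2
          ring
  rw [hA] at fkg
  have heP0 : e * P ≠ 0 := mul_ne_zero he0 hP0
  have hePt : e * P ≠ ⊤ := ENNReal.mul_ne_top het hPt
  refine (ENNReal.mul_le_mul_iff_left heP0 hePt).1 (fkg.trans ?_)
  refine (mul_le_mul_left hB _).trans ?_
  have h5 : ENNReal.ofReal C₁ * Z ≤ ENNReal.ofReal (2 * C₁) * P := by
    refine (mul_le_mul_right hhalf _).trans (le_of_eq ?_)
    rw [ENNReal.ofReal_mul (by norm_num), ENNReal.ofReal_ofNat]
    ring
  calc e * (ENNReal.ofReal C₁ * Z) * partitionOn gaussian (siteMeasure ε) D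
      ≤ e * (ENNReal.ofReal (2 * C₁) * P) * partitionOn gaussian (siteMeasure ε) D := by
        gcongr
    _ = _ := by ring

end Repulsion

/-! ### The planar Gaussian model and the wetting transitions -/

section GaussianWetting

variable {d : ℕ}

theorem liftCost_congr (ρ : ℝ → ℝ) (D : Finset (Site d)) {φ ψ : Site d → ℝ}
    (h : ∀ x ∈ D, φ x = ψ x) : liftCost ρ D φ = liftCost ρ D ψ := by
  unfold liftCost
  congr 1
  · refine Finset.sum_congr rfl fun x hx => ?_
    rw [h x hx, Finset.sum_congr rfl fun y hy => by rw [h y (Finset.mem_inter.1 hy).2]]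
  · refine Finset.sum_congr rfl fun x hx => ?_
    rw [h x hx]

theorem measurable_liftCost {ρ : ℝ → ℝ} (hρ : Measurable ρ) (D : Finset (Site d)) :
    Measurable (liftCost ρ D) := by
  unfold liftCost
  have h : ∀ x : Site d, Measurable fun φ : Site d → ℝ => φ x := fun x => measurable_pi_apply x
  refine Measurable.add (Finset.measurable_sum _ fun x _ => Measurable.ite
    (h x (measurableSet_singleton 0)) ?_ measurable_const)
    (Finset.measurable_sum _ fun x _ => Finset.measurable_sum _ fun y _ => hρ.comp (h x))
  exact Finset.measurable_sum _ fun y _ => hρ.comp (h y)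

/-- The cost of a lifted bond for the quadratic interaction. -/
def gaussianCost (b : ℝ) : ℝ := b + 1 / 2

/-- When one end is at most `1` and the other is `t + 1`, the gradient is at most `t + 1`, and `(t +
1)^2 / 2 = t^2 / 2 + (t + 1/2)`. -/
theorem gaussian_sub_le (a b : ℝ) (ha : 0 ≤ a) (hb : 0 ≤ b) :
    gaussian (a - b) ≤ gaussian (lower a - lower b) +
      (if lower a = 0 then gaussianCost (lower b) else 0) +
      (if lower b = 0 then gaussianCost (lower a) else 0) := by
  unfold gaussian gaussianCost lower
  rcases le_or_gt a 1 with h | h <;> rcases le_or_gt b 1 with h' | h'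
  · rw [max_eq_right (by linarith), max_eq_right (by linarith)]
    simp only [if_true]
    nlinarith
  · have hb0 : b - 1 ≠ 0 := by linarith
    rw [max_eq_right (by linarith), max_eq_left (by linarith)]
    simp only [if_true, hb0, if_false]
    nlinarith
  · have ha0 : a - 1 ≠ 0 := by linarith
    rw [max_eq_left (by linarith), max_eq_right (by linarith)]
    simp only [if_true, ha0, if_false]
    nlinarith
  · have ha0 : a - 1 ≠ 0 := by linarith
    have hb0 : b - 1 ≠ 0 := by linarith
    rw [max_eq_left (by linarith), max_eq_left (by linarith)]
    simp only [ha0, hb0, if_false]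
    nlinarith

theorem gaussian_le_lower (a : ℝ) (ha : 0 ≤ a) :
    gaussian a ≤ gaussian (lower a) + gaussianCost (lower a) := by
  unfold gaussian gaussianCost lower
  rcases le_or_gt a 1 with h | h
  · rw [max_eq_right (by linarith)]
    nlinarith
  · rw [max_eq_left (by linarith)]
    nlinarith

theorem lmarginal_exp_liftCost_le (D : Finset (Site d)) :
    lmarginal (fun _ => siteMeasure 1) D (fun φ =>
      ENNReal.ofReal (Real.exp (-liftCost gaussianCost D φ)) * weight gaussian D φ) 0 ≤
        partitionOn gaussian (siteMeasure 0) D := by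
  have hρ : Measurable gaussianCost := measurable_id.add_const _
  refine lmarginal_le_partitionOn_of_lower D ((measurable_liftCost hρ D).neg.exp.ennreal_ofReal.mul
    (measurable_weight isInteraction_gaussian.measurable D)) fun φ hφ => ?_
  have hψ : ∀ x ∈ D, (if x ∈ D then lower (φ x) else φ x) = lower (φ x) := fun x hx => by simp [hx]
  rw [liftCost_congr gaussianCost D hψ, weight_congr D hψ, weight, weight,
    ← ENNReal.ofReal_mul (Real.exp_pos _).le, ← Real.exp_add]
  have := energy_le_add_liftCost gaussian_sub_le gaussian_le_lower D φ hφ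
  exact ENNReal.ofReal_le_ofReal (Real.exp_le_exp.2 (by linarith))

/-- The indicator of height zero. -/
def zeroIndicator (t : ℝ) : ℝ≥0∞ := if t = 0 then 1 else 0

theorem measurable_zeroIndicator : Measurable zeroIndicator :=
  Measurable.ite (measurableSet_singleton 0) measurable_const measurable_const

theorem lintegral_zeroIndicator (ε : ℝ) (f : ℝ → ℝ≥0∞) :
    ∫⁻ t, zeroIndicator t * f t ∂siteMeasure ε = ENNReal.ofReal ε * f 0 := by
  rw [lintegral_siteMeasure]
  have : ∫⁻ t in Set.Ici (0 : ℝ), zeroIndicator t * f t = ∫⁻ t in Set.Ici (0 : ℝ), 0 := by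
    refine lintegral_congr_ae ?_
    have : ∀ᵐ t : ℝ, t ≠ 0 := by simp [ae_iff]
    filter_upwards [ae_restrict_of_ae this] with t ht
    simp [zeroIndicator, ht]
  rw [this]
  simp [zeroIndicator]

/-- Only the atom sees the indicator, so pinning `x` yields a factor `ε` and the model on the region
without `x`. -/
theorem lmarginal_zeroIndicator (ε : ℝ) {D : Finset (Site d)} {x : Site d} (hx : x ∈ D)
    {G G' : (Site d → ℝ) → ℝ≥0∞} (hG : Measurable G) (hG' : Measurable G')
    (h : ∀ φ, G (update φ x 0) = G' φ) :
    lmarginal (fun _ => siteMeasure ε) D (fun φ => zeroIndicator (φ x) * G φ) 0 =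
      ENNReal.ofReal ε * lmarginal (fun _ => siteMeasure ε) (D.erase x) G' 0 := by
  have hm : Measurable fun φ : Site d → ℝ => zeroIndicator (φ x) * G φ :=
    (measurable_zeroIndicator.comp (measurable_pi_apply x)).mul hG
  rw [lmarginal_erase' _ hm hx]
  refine lmarginal_const_mul _ _ _ _ _ hG' fun φ _ => ?_
  simp only [update_self]
  rw [lintegral_zeroIndicator ε fun t => G (update φ x t), h]

/-- Let `L` be the lifting cost. The shift gives `Z^0 ≥ ∫ exp(K * ν - L)` against the unnormalized
weight of strength `c = exp(-K)`, and `exp t ≥ 1 + t` reduces the claim to the mean of `L` being at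
most that of `K * ν` plus `m`. A pinned site has at most four bonds of conditional mean cost `C +
1/2`, hence `K`; boundary bonds give `m`. -/
theorem partitionOn_gaussian_le {C : ℝ} (hC0 : 0 ≤ C)
    (hC : ∀ (ε : ℝ) (D : Finset (Site 2)) (o y : Site 2), o ∉ D → y ∈ D → y ∈ neighbors o →
      lmarginal (fun _ => siteMeasure ε) D
        (fun φ => ENNReal.ofReal (φ y) * weight gaussian D φ) 0 ≤
      ENNReal.ofReal C * partitionOn gaussian (siteMeasure ε) D) (D : Finset (Site 2)) :
    partitionOn gaussian (siteMeasure (Real.exp (-(4 * (C + 1 / 2))))) D ≤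
      ENNReal.ofReal (Real.exp ((C + 1 / 2) * boundaryCard D)) *
        partitionOn gaussian (siteMeasure 0) D := by
  set K : ℝ := 4 * (C + 1 / 2) with hK
  have hK0 : 0 ≤ K := by positivity
  set c : ℝ := Real.exp (-K) with hc
  set m : ℝ := (C + 1 / 2) * boundaryCard D with hm
  have hm0 : 0 ≤ m := by positivity
  have hw := measurable_weight (d := 2) isInteraction_gaussian.measurable D
  have hρ : Measurable gaussianCost := measurable_id.add_const _
  have hlift := measurable_liftCost hρ D
  set Z := partitionOn gaussian (siteMeasure c) D with hZ
  have hZt : Z ≠ ⊤ := partitionOn_siteMeasure_ne_top (by norm_num) isInteraction_gaussian c D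
  have hap : ∀ x : Site 2, Measurable fun φ : Site 2 → ℝ => φ x := fun x => measurable_pi_apply x
  have hz : ∀ x : Site 2, Measurable fun φ : Site 2 → ℝ =>
      zeroIndicator (φ x) * weight gaussian D φ := fun x =>
    (measurable_zeroIndicator.comp (hap x)).mul hw
  have hzy : ∀ x y : Site 2, Measurable fun φ : Site 2 → ℝ =>
      zeroIndicator (φ x) * (ENNReal.ofReal (φ y) * weight gaussian D φ) := fun x y =>
    (measurable_zeroIndicator.comp (hap x)).mul ((hap y).ennreal_ofReal.mul hw)
  have hyw : ∀ y : Site 2, Measurable fun φ : Site 2 → ℝ =>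
      ENNReal.ofReal (φ y) * weight gaussian D φ := fun y => (hap y).ennreal_ofReal.mul hw
  set p : Site 2 → ℝ≥0∞ := fun x => lmarginal (fun _ => siteMeasure c) D
    (fun φ => zeroIndicator (φ x) * weight gaussian D φ) 0 with hp
  have hpt : ∀ x, p x ≠ ⊤ := by
    intro x
    refine ne_top_of_le_ne_top hZt (lmarginal_mono (fun φ => ?_) 0)
    refine mul_le_of_le_one_left zero_le ?_
    unfold zeroIndicator
    split_ifs <;> simp
  -- Given `φ x = 0` the model lives on `D.erase x`, where `x` serves as the pinned exterior point
  -- of `hC`.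
  have hpair : ∀ x ∈ D, ∀ y ∈ neighbors x ∩ D, lmarginal (fun _ => siteMeasure c) D
      (fun φ => zeroIndicator (φ x) * (ENNReal.ofReal (φ y) * weight gaussian D φ)) 0 ≤
      ENNReal.ofReal C * p x := by
    intro x hx y hy
    obtain ⟨hyx, hyD⟩ := Finset.mem_inter.1 hy
    have hne : y ≠ x := by
      rintro rfl
      obtain ⟨i, h | h⟩ := mem_neighbors_iff.1 hyx <;>
      (have h' := congrFun h i; simp at h'; try omega)
    have hwe : ∀ φ : Site 2 → ℝ, weight gaussian D (update φ x 0) =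
        weight gaussian (D.erase x) φ := fun φ => by
      rw [weight, energy_update_zero isInteraction_gaussian, weight]
    have hw' := measurable_weight (d := 2) isInteraction_gaussian.measurable (D.erase x)
    rw [lmarginal_zeroIndicator c hx (hyw y) ((hap y).ennreal_ofReal.mul hw')
        (fun φ => by rw [hwe, update_of_ne hne]; rfl), hp]
    simp only
    rw [lmarginal_zeroIndicator c hx hw hw' hwe, mul_left_comm]
    exact mul_le_mul_right (hC c (D.erase x) x y (Finset.notMem_erase x D)
      (Finset.mem_erase.2 ⟨hne, hyD⟩) hyx) _
  have hlow : lmarginal (fun _ => siteMeasure c) D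
      (fun φ => (∏ i ∈ D, pinWeight (Real.exp K) (φ i)) *
        (ENNReal.ofReal (Real.exp (-liftCost gaussianCost D φ)) * weight gaussian D φ)) 0 ≤
      partitionOn gaussian (siteMeasure 0) D := by
    have h1 : Real.exp K * c = 1 := by rw [hc, ← Real.exp_add]; simp
    have hlw : Measurable fun φ : Site 2 → ℝ =>
        ENNReal.ofReal (Real.exp (-liftCost gaussianCost D φ)) * weight gaussian D φ :=
      hlift.neg.exp.ennreal_ofReal.mul hw
    rw [← lmarginal_pinWeight (Real.exp_pos K).le D hlw, h1]
    exact lmarginal_exp_liftCost_le D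
  have hpin : ∀ φ : Site 2 → ℝ, ∏ i ∈ D, pinWeight (Real.exp K) (φ i) =
      ENNReal.ofReal (Real.exp (∑ x ∈ D, if φ x = 0 then K else 0)) := by
    intro φ
    rw [Real.exp_sum, ENNReal.ofReal_prod_of_nonneg fun _ _ => (Real.exp_pos _).le]
    refine Finset.prod_congr rfl fun x _ => ?_
    unfold pinWeight
    split_ifs <;> simp
  -- The integrated form of `1 + (m + K * ν - L) ≤ exp(m + K * ν - L)`, with `L` moved to the right
  -- to avoid subtraction in `ℝ≥0∞`.
  have hpoint : lmarginal (fun _ => siteMeasure c) D (fun φ => weight gaussian D φ +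
        (∑ x ∈ D, ENNReal.ofReal K * (zeroIndicator (φ x) * weight gaussian D φ) +
          ENNReal.ofReal m * weight gaussian D φ)) 0 ≤
      lmarginal (fun _ => siteMeasure c) D (fun φ => ENNReal.ofReal (Real.exp m) *
        ((∏ i ∈ D, pinWeight (Real.exp K) (φ i)) *
          (ENNReal.ofReal (Real.exp (-liftCost gaussianCost D φ)) * weight gaussian D φ)) +
        (∑ x ∈ D, ∑ y ∈ neighbors x ∩ D,
          (zeroIndicator (φ x) * (ENNReal.ofReal (φ y) * weight gaussian D φ) +
            ENNReal.ofReal (1 / 2) * (zeroIndicator (φ x) * weight gaussian D φ)) +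
          ∑ x ∈ D, ∑ _y ∈ neighbors x \ D, (ENNReal.ofReal (φ x) * weight gaussian D φ +
            ENNReal.ofReal (1 / 2) * weight gaussian D φ))) 0 := by
    refine lmarginal_mono_ae (siteMeasure_ae_nonneg c) _ _ _ _ fun φ hφ _ => ?_
    set ν : ℝ := ∑ x ∈ D, if φ x = 0 then K else 0 with hν
    have hν0 : 0 ≤ ν := Finset.sum_nonneg fun x _ => by split_ifs <;> simp [hK0]
    have hcost : ∀ x ∈ D, 0 ≤ gaussianCost (φ x) := fun x hx => by
      unfold gaussianCost; linarith [hφ x hx]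
    have hL0 : 0 ≤ liftCost gaussianCost D φ := by
      unfold liftCost
      refine add_nonneg (Finset.sum_nonneg fun x _ => ?_)
        (Finset.sum_nonneg fun x hx => Finset.sum_nonneg fun y _ => hcost x hx)
      split_ifs
      · exact Finset.sum_nonneg fun y hy => hcost y (Finset.mem_inter.1 hy).2
      · exact le_rfl
    have e1 : ∑ x ∈ D, ENNReal.ofReal K * (zeroIndicator (φ x) * weight gaussian D φ) =
        ENNReal.ofReal ν * weight gaussian D φ := by
      rw [hν, ENNReal.ofReal_sum_of_nonneg fun x _ => by split_ifs <;> simp [hK0],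
        Finset.sum_mul]
      refine Finset.sum_congr rfl fun x _ => ?_
      unfold zeroIndicator
      split_ifs <;> simp
    have hsplit : ∀ x ∈ D, ENNReal.ofReal (gaussianCost (φ x)) =
        ENNReal.ofReal (φ x) + ENNReal.ofReal (1 / 2) := fun x hx => by
      rw [gaussianCost, ENNReal.ofReal_add (hφ x hx) (by norm_num)]
    have e2 : ∑ x ∈ D, ∑ y ∈ neighbors x ∩ D,
          (zeroIndicator (φ x) * (ENNReal.ofReal (φ y) * weight gaussian D φ) +
            ENNReal.ofReal (1 / 2) * (zeroIndicator (φ x) * weight gaussian D φ)) +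
          ∑ x ∈ D, ∑ _y ∈ neighbors x \ D, (ENNReal.ofReal (φ x) * weight gaussian D φ +
            ENNReal.ofReal (1 / 2) * weight gaussian D φ) =
        ENNReal.ofReal (liftCost gaussianCost D φ) * weight gaussian D φ := by
      unfold liftCost
      rw [ENNReal.ofReal_add, ENNReal.ofReal_sum_of_nonneg, ENNReal.ofReal_sum_of_nonneg, add_mul,
        Finset.sum_mul, Finset.sum_mul]
      · congr 1
        · refine Finset.sum_congr rfl fun x _ => ?_
          unfold zeroIndicator
          split_ifs
          · rw [ENNReal.ofReal_sum_of_nonneg fun y hy => hcost y (Finset.mem_inter.1 hy).2,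
              Finset.sum_mul]
            refine Finset.sum_congr rfl fun y hy => ?_
            rw [hsplit y (Finset.mem_inter.1 hy).2]
            ring
          · simp
        · refine Finset.sum_congr rfl fun x hx => ?_
          rw [ENNReal.ofReal_sum_of_nonneg fun y hy => hcost x hx, Finset.sum_mul]
          refine Finset.sum_congr rfl fun y hy => ?_
          rw [hsplit x hx]
          ring
      · exact fun x hx => Finset.sum_nonneg fun y _ => hcost x hx
      · intro x _
        split_ifs
        · exact Finset.sum_nonneg fun y hy => hcost y (Finset.mem_inter.1 hy).2
        · exact le_rfl
      · refine Finset.sum_nonneg fun x _ => ?_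
        split_ifs
        · exact Finset.sum_nonneg fun y hy => hcost y (Finset.mem_inter.1 hy).2
        · exact le_rfl
      · exact Finset.sum_nonneg fun x hx => Finset.sum_nonneg fun y _ => hcost x hx
    rw [e1, e2, hpin, ← mul_assoc, ← mul_assoc, ← ENNReal.ofReal_mul (Real.exp_pos _).le,
      ← Real.exp_add, ← ENNReal.ofReal_mul (Real.exp_pos _).le, ← Real.exp_add, ← add_mul,
      ← add_mul, ← ENNReal.ofReal_add (Real.exp_pos _).le hL0, ← ENNReal.ofReal_add hν0 hm0]
    nth_rewrite 1 [← one_mul (weight gaussian D φ)]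
    rw [← add_mul, ← ENNReal.ofReal_one, ← ENNReal.ofReal_add zero_le_one (by positivity)]
    refine mul_le_mul_left (ENNReal.ofReal_le_ofReal ?_) _
    have := Real.add_one_le_exp (m + ν + -liftCost gaussianCost D φ)
    linarith
  have hKz : ∀ x ∈ D, Measurable fun φ : Site 2 → ℝ =>
      ENNReal.ofReal K * (zeroIndicator (φ x) * weight gaussian D φ) :=
    fun x _ => (hz x).const_mul _
  have hF : Measurable fun φ : Site 2 → ℝ => (∏ i ∈ D, pinWeight (Real.exp K) (φ i)) *
      (ENNReal.ofReal (Real.exp (-liftCost gaussianCost D φ)) * weight gaussian D φ) :=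
    (Finset.measurable_prod _ fun i _ => (measurable_pinWeight _).comp (hap i)).mul
      (hlift.neg.exp.ennreal_ofReal.mul hw)
  have hin : ∀ x y : Site 2, Measurable fun φ : Site 2 → ℝ =>
      zeroIndicator (φ x) * (ENNReal.ofReal (φ y) * weight gaussian D φ) +
        ENNReal.ofReal (1 / 2) * (zeroIndicator (φ x) * weight gaussian D φ) :=
    fun x y => (hzy x y).add ((hz x).const_mul _)
  have hout : ∀ x : Site 2, Measurable fun φ : Site 2 → ℝ =>
      ENNReal.ofReal (φ x) * weight gaussian D φ + ENNReal.ofReal (1 / 2) * weight gaussian D φ :=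
    fun x => (hyw x).add (hw.const_mul _)
  rw [lmarginal_add _ _ _ hw, lmarginal_add _ _ _ (Finset.measurable_sum _ hKz),
    lmarginal_sum _ _ _ hKz, lmarginal_add _ _ _ (hF.const_mul _),
    lmarginal_add _ _ _ (Finset.measurable_sum _ fun x _ =>
      Finset.measurable_sum _ fun y _ => hin x y),
    lmarginal_sum _ _ _ (fun x _ => Finset.measurable_sum _ fun y _ => hin x y),
    lmarginal_sum _ _ _ (fun x _ => Finset.measurable_sum _ fun y _ => hout x),
    lmarginal_const_mul (hg := hw) (h := fun _ _ => rfl),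
    lmarginal_const_mul (hg := hF) (h := fun _ _ => rfl)] at hpoint
  have hhalf : ENNReal.ofReal C + ENNReal.ofReal (1 / 2) = ENNReal.ofReal (C + 1 / 2) :=
    (ENNReal.ofReal_add hC0 (by norm_num)).symm
  have h1 : ∑ x ∈ D, lmarginal (fun _ => siteMeasure c) D (fun φ => ∑ y ∈ neighbors x ∩ D,
          (zeroIndicator (φ x) * (ENNReal.ofReal (φ y) * weight gaussian D φ) +
            ENNReal.ofReal (1 / 2) * (zeroIndicator (φ x) * weight gaussian D φ))) 0 ≤
      ∑ x ∈ D, ENNReal.ofReal K * p x := by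
    refine Finset.sum_le_sum fun x hx => ?_
    rw [lmarginal_sum _ _ _ fun y _ => hin x y]
    calc _ ≤ ∑ y ∈ neighbors x ∩ D, ENNReal.ofReal (C + 1 / 2) * p x := by
          refine Finset.sum_le_sum fun y hy => ?_
          rw [lmarginal_add _ _ _ (hzy x y), lmarginal_const_mul (hg := hz x) (h := fun _ _ => rfl),
            ← hhalf, add_mul]
          exact add_le_add (hpair x hx y hy) le_rfl
      _ ≤ 4 * (ENNReal.ofReal (C + 1 / 2) * p x) := by
          rw [Finset.sum_const, nsmul_eq_mul]
          refine mul_le_mul_left ?_ _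
          have := (Finset.card_le_card (Finset.inter_subset_left (s₁ := neighbors x) (s₂ := D))).trans
            (card_neighbors_le x)
          exact_mod_cast this
      _ = ENNReal.ofReal K * p x := by
          rw [hK, ENNReal.ofReal_mul (by norm_num), ENNReal.ofReal_ofNat, mul_assoc]
  have h2 : ∑ x ∈ D, lmarginal (fun _ => siteMeasure c) D (fun φ => ∑ _y ∈ neighbors x \ D,
          (ENNReal.ofReal (φ x) * weight gaussian D φ +
            ENNReal.ofReal (1 / 2) * weight gaussian D φ)) 0 ≤ ENNReal.ofReal m * Z := by
    calc _ ≤ ∑ x ∈ D, ∑ _y ∈ neighbors x \ D, ENNReal.ofReal (C + 1 / 2) * Z := by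
          refine Finset.sum_le_sum fun x hx => ?_
          rw [lmarginal_sum _ _ _ fun y _ => hout x]
          refine Finset.sum_le_sum fun y hy => ?_
          obtain ⟨hyx, hyD⟩ := Finset.mem_sdiff.1 hy
          rw [lmarginal_add _ _ _ (hyw x), lmarginal_const_mul (hg := hw) (h := fun _ _ => rfl),
            ← hhalf, add_mul]
          exact add_le_add (hC c D y x hyD hx (neighbors_symm.1 hyx)) le_rfl
      _ = ENNReal.ofReal m * Z := by
          simp only [Finset.sum_const, nsmul_eq_mul]
          rw [← Finset.sum_mul, ← mul_assoc, hm, mul_comm (C + 1 / 2),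
            ENNReal.ofReal_mul (by positivity), ENNReal.ofReal_natCast, boundaryCard]
          push_cast
          rfl
  have h3 : ∑ x ∈ D, lmarginal (fun _ => siteMeasure c) D
      (fun φ => ENNReal.ofReal K * (zeroIndicator (φ x) * weight gaussian D φ)) 0 =
      ∑ x ∈ D, ENNReal.ofReal K * p x := by
    refine Finset.sum_congr rfl fun x _ => ?_
    rw [lmarginal_const_mul (hg := hz x) (h := fun _ _ => rfl)]
  rw [h3] at hpoint
  -- Finiteness permits cancelling the mean of `K * ν + m`, which dominates the mean of `L`, from
  -- both sides.
  have hfin : ∑ x ∈ D, ENNReal.ofReal K * p x + ENNReal.ofReal m * Z ≠ ⊤ :=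
    ENNReal.add_ne_top.2 ⟨ENNReal.sum_ne_top.2 fun x _ =>
      ENNReal.mul_ne_top ENNReal.ofReal_ne_top (hpt x),
      ENNReal.mul_ne_top ENNReal.ofReal_ne_top hZt⟩
  refine (ENNReal.add_le_add_iff_right hfin).1 (hpoint.trans ?_)
  exact add_le_add (mul_le_mul_right hlow _) (add_le_add h1 h2)

theorem exists_pinnedTailBound_gaussian : ∃ ε₀ : ℝ, 0 < ε₀ ∧ ∀ ε : ℝ, 0 < ε → ε < ε₀ →
    PinnedTailBound 2 gaussian ε ∧ DensityVanishes 2 gaussian ε := by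
  obtain ⟨C, hC0, hC⟩ := exists_mean_height_bound
  refine ⟨Real.exp (-(4 * (C + 1 / 2))), Real.exp_pos _, fun ε hε hlt => ?_⟩
  have key : ∀ N : ℕ, 1 ≤ N →
      partitionOn gaussian (siteMeasure (Real.exp (-(4 * (C + 1 / 2))))) (box 2 N) ≤
        ENNReal.ofReal (Real.exp (((C + 1 / 2) * 4) * (N : ℝ) ^ (2 - 1))) *
          partitionOn gaussian (siteMeasure ε) (box 2 N) := by
    intro N _
    refine (partitionOn_gaussian_le hC0 hC (box 2 N)).trans (mul_le_mul' ?_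
      (partitionOn_mono isInteraction_gaussian _ le_rfl hε))
    refine ENNReal.ofReal_le_ofReal (Real.exp_le_exp.2 ?_)
    have h : (boundaryCard (box 2 N) : ℝ) ≤ 4 * (N : ℝ) ^ (2 - 1) := by
      have := boundaryCard_box_le 2 N
      exact_mod_cast this
    rw [mul_assoc]
    exact mul_le_mul_of_nonneg_left h (by positivity)
  exact ⟨pinnedTailBound_of_partitionOn_le (by norm_num) isInteraction_gaussian hε hlt
      (by positivity) key,
    densityVanishes_of_partitionOn_le (by norm_num) isInteraction_gaussian hε hlt key⟩

theorem hasWettingTransition_sos (hd : 1 ≤ d) : HasWettingTransition d sos :=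
  hasWettingTransition hd isInteraction_sos (half_pos (Real.exp_pos (-(2 * (d : ℝ)))))
    (pinnedTailBound_sos hd (half_pos (Real.exp_pos _)) (half_lt_self (Real.exp_pos _))).2

theorem hasWettingTransition_gaussian : HasWettingTransition 2 gaussian := by
  obtain ⟨ε₀, hε₀, h⟩ := exists_pinnedTailBound_gaussian
  exact hasWettingTransition (by norm_num) isInteraction_gaussian (half_pos hε₀)
    (h _ (half_pos hε₀) (half_lt_self hε₀)).2

end GaussianWetting

end Wetting

end

theorem theorem2 :
    (∀ d : ℕ, 1 ≤ d → ∀ ε : ℝ, 0 < ε → ε < Real.exp (-(2 * (d : ℝ))) →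
      Wetting.PinnedTailBound d Wetting.sos ε ∧ Wetting.DensityVanishes d Wetting.sos ε) ∧
    (∃ ε₀ : ℝ, 0 < ε₀ ∧ ∀ ε : ℝ, 0 < ε → ε < ε₀ →
      Wetting.PinnedTailBound 2 Wetting.gaussian ε ∧
        Wetting.DensityVanishes 2 Wetting.gaussian ε) ∧
    (∀ d : ℕ, 1 ≤ d → Wetting.HasWettingTransition d Wetting.sos) ∧
    Wetting.HasWettingTransition 2 Wetting.gaussian :=
  ⟨fun _ hd _ hε h => Wetting.pinnedTailBound_sos hd hε h,
    Wetting.exists_pinnedTailBound_gaussian, fun _ hd => Wetting.hasWettingTransition_sos hd,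
    Wetting.hasWettingTransition_gaussian⟩
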